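/- Let $G$ be a compact Lie group acting smoothly and freely on a nonempty smooth finite-dimensional manifold $P$ (without boundary, Hausdorff, second countable). Let $M=P/G$ carry the quotient topology, and let $\pi:P\to M$ be the projection. For $p\in P$ let $I_p:\mathfrak g\to T_pP$ be the derivative at the identity of $g\mapsto g\cdot p$, so that $I_p(\mathfrak g)$ is the tangent space of the orbit $G\cdot p$ at $p$. A *local section* of $P$ over an open set $\theta\subset M$ is an embedded submanifold $\Sigma\subset P$ with $\pi(\Sigma)=\theta$ such that, for every $q\in\Sigma$, $T_q\Sigma+I_q(\mathfrak g)=T_qP$ and $(G\cdot q)\cap\Sigma=\{q\}$. Then: 1. (Slices.) There is a $G$-invariant smooth Riemannian metric on $P$. For every such metric and every $p\in P$ there is $\delta_0>0$ such that for all $0<\delta\le\delta_0$ the exponential $\mathrm{Exp}_p(v)$ is defined for every $v\in T_pP$ normal to $I_p(\mathfrak g)$ with $|v|<\delta$, and $$\Sigma_{p,\delta}=\{\mathrm{Exp}_p(v): v\in T_pP,\ v\perp I_p(\mathfrak g),\ |v|<\delta\}$$ is a local section of $P$ (over some open set of $M$) that contains $p$. In particular there is a local section through every point of $P$. 2. (Smooth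 structure of $M$.) $M$ is Hausdorff and second countable. There is exactly one smooth structure on the topological space $M$ (of some finite dimension, compatible with the quotient topology) for which $\pi:P\to M$ is a smooth submersion. There is also exactly one for which, for every open $\theta\subset M$ and every local section $\Sigma$ of $P$ over $\theta$, $\pi|_\Sigma$ is a diffeomorphism of $\Sigma$ onto $\theta$. The two conditions are equivalent for every smooth structure on $M$, so the two structures coincide. 3. (Local triviality.) For this structure, every $m\in M$ has an open neighbourhood $\theta$ with a diffeomorphism $\phi:\pi^{-1}(\theta)\to\theta\times G$ whose first component is $\pi$ and which is $G$-equivariant: if $\phi(y)=(m',g)$ then $\phi(h\cdot y)=(m',hg)$ for $h\in G$. Moreover, for every local section $\Sigma$ over any open $\theta\subset M$ there is such a $\phi$ on $\pi^{-1}(\theta)$ with $\phi(g\cdot x)=(\pi(x),g)$ for all $x\in\Sigma$, $g\in G$. -/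

import Mathlib

open scoped Manifold ContDiff Topology

noncomputable section

namespace SliceTheorem

/-! ### Smooth structures on a topological space -/

/-- A smooth structure on a topological space `X`: a dimension `dim` together with a maximal
smooth atlas of charts with values in `ℝ^dim`. -/
@[ext]
structure SmoothStructure (X : Type*) [TopologicalSpace X] where
  dim : ℕ
  charts : Set (OpenPartialHomeomorph X (EuclideanSpace ℝ (Fin dim)))
  cover : ∀ x : X, ∃ e ∈ charts, x ∈ e.source
  compatible : ∀ e ∈ charts, ∀ e' ∈ charts, e.symm.trans e' ∈ contDiffGroupoid ∞ (𝓡 dim)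
  maximal : ∀ e : OpenPartialHomeomorph X (EuclideanSpace ℝ (Fin dim)),
    (∀ e' ∈ charts, e.symm.trans e' ∈ contDiffGroupoid ∞ (𝓡 dim) ∧
      e'.symm.trans e ∈ contDiffGroupoid ∞ (𝓡 dim)) → e ∈ charts

namespace SmoothStructure

variable {X : Type*} [TopologicalSpace X]

/-- The charted space whose atlas is the given maximal atlas. -/
@[reducible]
def chartedSpace (s : SmoothStructure X) : ChartedSpace (EuclideanSpace ℝ (Fin s.dim)) X where
  atlas := s.charts
  chartAt x := (s.cover x).choose
  mem_chart_source x := (s.cover x).choose_spec.2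
  chart_mem_atlas x := (s.cover x).choose_spec.1

theorem isManifold (s : SmoothStructure X) :
    letI := s.chartedSpace
    IsManifold (𝓡 s.dim) ∞ X := by
  letI := s.chartedSpace
  haveI : HasGroupoid X (contDiffGroupoid ∞ (𝓡 s.dim)) :=
    ⟨fun {e e'} he he' => s.compatible e he e' he'⟩
  exact IsManifold.mk' _ _ _

theorem maximalAtlas_eq (s : SmoothStructure X) :
    letI := s.chartedSpace
    IsManifold.maximalAtlas (𝓡 s.dim) ∞ X = s.charts := by
  letI := s.chartedSpace
  haveI := s.isManifold
  apply Set.Subset.antisymm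
  · intro e he
    exact s.maximal e fun e' he' => (mem_maximalAtlas_iff.1 he) e' he'
  · exact IsManifold.subset_maximalAtlas

end SmoothStructure

/-! ### Riemannian metrics, geodesics and the exponential map

Below, `E` is a finite-dimensional real vector space and `P` is a smooth manifold modelled
on `E`. -/

section Riemannian

variable {E : Type*} [NormedAddCommGroup E] [NormedSpace ℝ E]
  {P : Type*} [TopologicalSpace P] [ChartedSpace E P] [IsManifold 𝓘(ℝ, E) ∞ P]

variable (E P) in
/-- Smooth Riemannian metrics on `P`. -/
abbrev RiemMetric : Type _ :=
  Bundle.ContMDiffRiemannianMetric 𝓘(ℝ, E) ∞ E (fun x : P => TangentSpace 𝓘(ℝ, E) x)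

/-- The components of the metric in the chart `e`, at the point `x` of the target of `e`. -/
def RiemMetric.coord (γ : RiemMetric E P) (e : OpenPartialHomeomorph P E) (x a b : E) : ℝ :=
  γ.inner (e.symm x) (mfderiv 𝓘(ℝ, E) 𝓘(ℝ, E) e.symm x a) (mfderiv 𝓘(ℝ, E) 𝓘(ℝ, E) e.symm x b)

/-- The Christoffel symbols of the first kind in the chart `e`:
`Γ(a, b; w) = (∂_a g(b, w) + ∂_b g(a, w) - ∂_w g(a, b)) / 2`. -/
def RiemMetric.christoffel (γ : RiemMetric E P) (e : OpenPartialHomeomorph P E)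
    (x a b w : E) : ℝ :=
  (fderiv ℝ (fun y => γ.coord e y b w) x a + fderiv ℝ (fun y => γ.coord e y a w) x b
    - fderiv ℝ (fun y => γ.coord e y a b) x w) / 2

/-- `c` is a geodesic of `γ` on the open set `J` of times: in every smooth chart `e`, the
coordinate curve `u = e ∘ c` satisfies the geodesic equation
`g(u'', w) + Γ(u', u'; w) = 0` for all `w`. -/
def RiemMetric.IsGeodesicOn (γ : RiemMetric E P) (c : ℝ → P) (J : Set ℝ) : Prop :=
  ContMDiffOn 𝓘(ℝ, ℝ) 𝓘(ℝ, E) 2 c J ∧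
  ∀ e ∈ IsManifold.maximalAtlas 𝓘(ℝ, E) ∞ P, ∀ t ∈ J, c t ∈ e.source → ∀ w : E,
    γ.coord e (e (c t)) (deriv (deriv (e ∘ c)) t) w
      + γ.christoffel e (e (c t)) (deriv (e ∘ c) t) (deriv (e ∘ c) t) w = 0

/-- The relation `Exp_p(v) = q`: the geodesic with initial point `p` and initial velocity `v`
is defined up to time `1`, where it takes the value `q`. -/
def RiemMetric.IsExp (γ : RiemMetric E P) (p : P) (v : TangentSpace 𝓘(ℝ, E) p) (q : P) : Prop :=
  ∃ (c : ℝ → P) (ε : ℝ), 0 < ε ∧ γ.IsGeodesicOn c (Set.Ioo (-ε) (1 + ε)) ∧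
    (⟨c 0, mfderiv 𝓘(ℝ, ℝ) 𝓘(ℝ, E) c 0 (1 : ℝ)⟩ : TangentBundle 𝓘(ℝ, E) P) = ⟨p, v⟩ ∧
    c 1 = q

end Riemannian

/-! ### Group actions, orbits and local sections

Here `G` is a Lie group modelled on `F`, acting smoothly on `P`. -/

section Action

variable {E : Type*} [NormedAddCommGroup E] [NormedSpace ℝ E]
  {P : Type*} [TopologicalSpace P] [ChartedSpace E P]
  (F : Type*) [NormedAddCommGroup F] [NormedSpace ℝ F]
  (G : Type*) [TopologicalSpace G] [ChartedSpace F G] [Group G] [MulAction G P]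

/-- The infinitesimal action at `p`, from the Lie algebra `T_1 G` to `T_p P`: the derivative at `1`
of `g ↦ g • p`. -/
def infinitesimalAction (p : P) :
    TangentSpace 𝓘(ℝ, F) (1 : G) →L[ℝ] TangentSpace 𝓘(ℝ, E) p :=
  mfderiv 𝓘(ℝ, F) 𝓘(ℝ, E) (fun g : G => g • p) 1

/-- The tangent space at `p` of the orbit of `p`: the image of the infinitesimal action. -/
def orbitTangent (p : P) : Submodule ℝ (TangentSpace 𝓘(ℝ, E) p) :=
  LinearMap.range (infinitesimalAction (E := E) F G p).toLinearMap

variable (P) in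
/-- The orbit space `P / G`, with the quotient topology. -/
abbrev OrbitSpace : Type _ := Quotient (MulAction.orbitRel G P)

/-- The projection `π : P → P / G`. -/
def orbitProj (p : P) : OrbitSpace P G := Quotient.mk (MulAction.orbitRel G P) p

theorem continuous_orbitProj : Continuous (orbitProj G : P → OrbitSpace P G) :=
  continuous_quotient_mk'

/-- The open subset `π⁻¹(θ)` of `P`. -/
def preimageOpens (θ : TopologicalSpace.Opens (OrbitSpace P G)) : TopologicalSpace.Opens P :=
  θ.comap ⟨orbitProj G, continuous_orbitProj G⟩

/-- `S`, with its smooth structure `s`, is a local section of `P` over the open subset `θ` of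
`P / G`: an embedded submanifold of `P`, transversal to the orbits, meeting each orbit in at most
one point, and with image `θ` in `P / G`. -/
structure IsLocalSection (E : Type*) [NormedAddCommGroup E] [NormedSpace ℝ E]
    {P : Type*} [TopologicalSpace P] [ChartedSpace E P]
    (F : Type*) [NormedAddCommGroup F] [NormedSpace ℝ F]
    (G : Type*) [TopologicalSpace G] [ChartedSpace F G] [Group G] [MulAction G P]
    (θ : TopologicalSpace.Opens (OrbitSpace P G)) (S : Set P) (s : SmoothStructure S) :
    Prop where
  isSmoothEmbedding :
    letI := s.chartedSpace
    Manifold.IsSmoothEmbedding (𝓡 s.dim) 𝓘(ℝ, E) ∞ (Subtype.val : S → P)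
  transversal :
    letI := s.chartedSpace
    ∀ x : S, LinearMap.range
        (mfderiv (𝓡 s.dim) 𝓘(ℝ, E) (Subtype.val : S → P) x).toLinearMap
      ⊔ orbitTangent (E := E) F G (x : P) = ⊤
  orbit_inter : ∀ x ∈ S, MulAction.orbit G x ∩ S = {x}
  image_eq : orbitProj G '' S = (θ : Set (OrbitSpace P G))

/-- The smooth structure `t` on `P / G` makes the projection a smooth submersion. -/
def IsSubmersionStructure (E : Type*) [NormedAddCommGroup E] [NormedSpace ℝ E]
    {P : Type*} [TopologicalSpace P] [ChartedSpace E P]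
    (G : Type*) [Group G] [MulAction G P]
    (t : SmoothStructure (OrbitSpace P G)) : Prop :=
  letI := t.chartedSpace
  Manifold.IsSubmersion 𝓘(ℝ, E) (𝓡 t.dim) ∞ (orbitProj G : P → OrbitSpace P G)

/-- The smooth structure `t` on `P / G` makes the restriction of the projection to every local
section `S` over `θ` a diffeomorphism of `S` onto `θ`. -/
def IsSectionStructure (E : Type*) [NormedAddCommGroup E] [NormedSpace ℝ E]
    {P : Type*} [TopologicalSpace P] [ChartedSpace E P]
    (F : Type*) [NormedAddCommGroup F] [NormedSpace ℝ F]
    (G : Type*) [TopologicalSpace G] [ChartedSpace F G] [Group G] [MulAction G P]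
    (t : SmoothStructure (OrbitSpace P G)) : Prop :=
  ∀ (θ : TopologicalSpace.Opens (OrbitSpace P G)) (S : Set P) (s : SmoothStructure S),
    IsLocalSection E F G θ S s →
      letI := t.chartedSpace
      letI := s.chartedSpace
      ∃ φ : Diffeomorph (𝓡 s.dim) (𝓡 t.dim) S θ ∞,
        ∀ x : S, (φ x : OrbitSpace P G) = orbitProj G (x : P)

/-- Diffeomorphisms `π⁻¹(θ) ≃ θ × G`, where `P / G` carries the smooth structure `t`. -/
abbrev ProductDiffeo (E : Type*) [NormedAddCommGroup E] [NormedSpace ℝ E]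
    {P : Type*} [TopologicalSpace P] [ChartedSpace E P]
    (F : Type*) [NormedAddCommGroup F] [NormedSpace ℝ F]
    (G : Type*) [TopologicalSpace G] [ChartedSpace F G] [Group G] [MulAction G P]
    (t : SmoothStructure (OrbitSpace P G))
    (θ : TopologicalSpace.Opens (OrbitSpace P G)) : Type _ :=
  letI := t.chartedSpace
  Diffeomorph 𝓘(ℝ, E) ((𝓡 t.dim).prod 𝓘(ℝ, F)) (preimageOpens G θ) (θ × G) ∞

/-- The diffeomorphism `φ : π⁻¹(θ) ≃ θ × G` is a local trivialization: its first component is the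
projection, and it is equivariant: if `φ y = (m, g)` then `φ (h • y) = (m, h * g)`. -/
def IsTrivialization {t : SmoothStructure (OrbitSpace P G)}
    {θ : TopologicalSpace.Opens (OrbitSpace P G)} (φ : ProductDiffeo E F G t θ) : Prop :=
  letI := t.chartedSpace
  (∀ y, ((φ y).1 : OrbitSpace P G) = orbitProj G (y : P)) ∧
  ∀ (h : G) (y y' : preimageOpens (P := P) G θ), (y' : P) = h • (y : P) →
    (φ y').2 = h * (φ y).2

/-- The map `φ : π⁻¹(θ) ≃ θ × G` is adapted to `S`: the second component of `φ (g • x)` is `g` for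
all `x ∈ S` and `g ∈ G`. For a trivialization this means `φ (g • x) = (π x, g)`. -/
def IsAdapted {t : SmoothStructure (OrbitSpace P G)}
    {θ : TopologicalSpace.Opens (OrbitSpace P G)} (φ : ProductDiffeo E F G t θ)
    (S : Set P) : Prop :=
  letI := t.chartedSpace
  ∀ (y : preimageOpens (P := P) G θ) (g : G), ∀ x ∈ S, (y : P) = g • x → (φ y).2 = g

variable [IsManifold 𝓘(ℝ, E) ∞ P]

/-- The metric `γ` is `G`-invariant: `G` acts by isometries. -/
def RiemMetric.IsInvariant (γ : RiemMetric E P) : Prop :=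
  ∀ (g : G) (p : P) (v w : TangentSpace 𝓘(ℝ, E) p),
    γ.inner (g • p) (mfderiv 𝓘(ℝ, E) 𝓘(ℝ, E) (fun x : P => g • x) p v)
      (mfderiv 𝓘(ℝ, E) 𝓘(ℝ, E) (fun x : P => g • x) p w) = γ.inner p v w

/-- The vectors at `p` of length `< δ` that are normal to the orbit of `p`. -/
def RiemMetric.normalBall (γ : RiemMetric E P) (p : P) (δ : ℝ) :
    Set (TangentSpace 𝓘(ℝ, E) p) :=
  {v | (∀ w ∈ orbitTangent (E := E) F G p, γ.inner p v w = 0) ∧ Real.sqrt (γ.inner p v v) < δ}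

/-- The image of the normal ball at `p` of radius `δ` under the exponential map. -/
def RiemMetric.expNormalBall (γ : RiemMetric E P) (p : P) (δ : ℝ) : Set P :=
  {q | ∃ v ∈ RiemMetric.normalBall F G γ p δ, γ.IsExp p v q}

end Action

end SliceTheorem

end

open SliceTheorem

open SliceTheorem

/-! Everything rests on the tube map `(g, x) ↦ g • f x` of a map `f` transversal to the orbits. A
free action has injective infinitesimal action (`injective_infinitesimalAction`): an integral curve
of a left-invariant field in its kernel would have to fix a point. So if `f` is an immersion at `0`
onto a complement of the orbit direction, the tube map has bijective derivative at `(1, 0)` and is a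
local diffeomorphism there. Group elements near `1` are controlled by local injectivity; the others
form a compact set on which `g • f 0 ≠ f 0`, so none of them maps a point of a small slice into that
slice. This is `exists_slice`. By equivariance and injectivity the tube map is then a diffeomorphism
of `G × O` onto an open saturated set.

Slices are the charts of the orbit space: a transition map slides one slice along the orbits onto
another, and the inverse tube map shows that this is smooth. In the structure so obtained the
projection is a submersion (`exists_isSubmersionStructure`). For any structure with this property
the derivative of the projection kills orbit directions, so by transversality the projection
restricts to an injective local diffeomorphism on each local section. Conversely there is a local
section through every point, so a structure that makes these restrictions diffeomorphisms is unique.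
Uniqueness and the equivalence of the two conditions follow. Inverting the tube map of a section
gives the trivialization, and properness of a compact group action gives the Hausdorff property.

For an invariant metric, the group component `k` of an inverse tube map satisfies `k (h • y) = h * k
y`. Moving `y` by `(k y)⁻¹` into a chart and pulling back a constant form is therefore invariant,
and a partition of unity on the orbit space glues these local metrics.

For the exponential map, the geodesic acceleration `spray` is quadratic in the velocity, so it
vanishes with its derivative at velocity zero. The integral equation for the velocity, posed on
continuous curves over the fixed interval `[-1, 2]`, is then a perturbation of the identity with the
same derivative at the rest solution. The Banach space inverse function theorem gives geodesics up
to time `1`, smooth in the initial velocity (`exists_velocity`, `exists_exp`). The exponential map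
has derivative the identity at `0`, and its restriction to the normal space satisfies the hypotheses
of `exists_slice`. -/

section Development

set_option linter.unusedSectionVars false

open Set Function Filter

noncomputable section

namespace SliceTheorem

/-! ### Inverse function theorem and injective local diffeomorphisms. -/

section LocalDiffeo

variable {E : Type*} [NormedAddCommGroup E] [NormedSpace ℝ E]
  {H : Type*} [TopologicalSpace H] {I : ModelWithCorners ℝ E H}
  {M : Type*} [TopologicalSpace M] [ChartedSpace H M]
  {E' : Type*} [NormedAddCommGroup E'] [NormedSpace ℝ E']
  {H' : Type*} [TopologicalSpace H'] {J : ModelWithCorners ℝ E' H'}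
  {N : Type*} [TopologicalSpace N] [ChartedSpace H' N]

/-- The restriction of a partial diffeomorphism to an open set. -/
def restrPartialDiffeomorph (Φ : PartialDiffeomorph I J M N ∞) (s : Set M) (hs : IsOpen s) :
    PartialDiffeomorph I J M N ∞ where
  toPartialEquiv := (Φ.toOpenPartialHomeomorph.restrOpen s hs).toPartialEquiv
  open_source := (Φ.toOpenPartialHomeomorph.restrOpen s hs).open_source
  open_target := (Φ.toOpenPartialHomeomorph.restrOpen s hs).open_target
  contMDiffOn_toFun := Φ.contMDiffOn_toFun.mono inter_subset_left
  contMDiffOn_invFun := Φ.contMDiffOn_invFun.mono <| by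
    rintro y ⟨hy, -⟩; exact hy

theorem isLocalDiffeomorphAt_congr {f g : M → N} {x : M}
    (hf : IsLocalDiffeomorphAt I J ∞ f x) (h : f =ᶠ[𝓝 x] g) : IsLocalDiffeomorphAt I J ∞ g x := by
  obtain ⟨Φ, hx, hΦ⟩ := hf
  obtain ⟨s, hs, hso, hxs⟩ := eventually_nhds_iff.1 h
  exact ⟨restrPartialDiffeomorph Φ s hso, ⟨hx, hxs⟩, fun y hy => (hs y hy.2).symm.trans (hΦ hy.1)⟩

/-- The inverse function theorem in a normed space. -/
theorem isLocalDiffeomorphAt_of_bijective_fderiv [FiniteDimensional ℝ E] [FiniteDimensional ℝ E']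
    {f : E → E'} {a : E} (hf : ∀ᶠ y in 𝓝 a, ContDiffAt ℝ ∞ f y) (hb : Bijective (fderiv ℝ f a)) :
    IsLocalDiffeomorphAt 𝓘(ℝ, E) 𝓘(ℝ, E') ∞ f a := by
  have : CompleteSpace E := FiniteDimensional.complete ℝ E
  have : CompleteSpace E' := FiniteDimensional.complete ℝ E'
  let L : E ≃L[ℝ] E' := (LinearEquiv.ofBijective (fderiv ℝ f a).toLinearMap hb).toContinuousLinearEquiv
  have hL : (L : E →L[ℝ] E') = fderiv ℝ f a := by ext; rfl
  have hfa : ContDiffAt ℝ ∞ f a := hf.self_of_nhds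
  have hd : HasFDerivAt f (L : E →L[ℝ] E') a := by
    rw [hL]; exact (hfa.differentiableAt (by simp)).hasFDerivAt
  let e := hfa.toOpenPartialHomeomorph f hd (by simp)
  -- Invertibility of the derivative is an open condition, so the local inverse is smooth on a whole
  -- neighbourhood and not only at `f a`.
  have hinv : ∀ᶠ y in 𝓝 a, fderiv ℝ f y ∈ range ((↑) : (E ≃L[ℝ] E') → E →L[ℝ] E') := by
    have hc : ContinuousAt (fderiv ℝ f) a := (hfa.fderiv_right (m := 0) (by simp)).continuousAt
    exact hc (by rw [← hL]; exact L.nhds)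
  obtain ⟨s, hs, hso, has⟩ := eventually_nhds_iff.1 (hf.and hinv)
  refine ⟨⟨(e.restrOpen s hso).toPartialEquiv, (e.restrOpen s hso).open_source,
    (e.restrOpen s hso).open_target, ?_, ?_⟩, ⟨?_, has⟩, fun y _ => rfl⟩
  · intro y hy
    exact ((hs y hy.2).1.contMDiffAt).contMDiffWithinAt
  · intro y hy
    refine ContMDiffAt.contMDiffWithinAt (ContDiffAt.contMDiffAt ?_)
    obtain ⟨hy1, hy2⟩ := hy
    obtain ⟨h1, L', h2⟩ := hs _ hy2
    refine e.contDiffAt_symm (f₀' := L') hy1 ?_ h1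
    rw [h2]
    exact (h1.differentiableAt (by simp)).hasFDerivAt
  · exact hfa.mem_toOpenPartialHomeomorph_source hd (by simp)

variable (I) in
/-- The preferred chart at a point, as a partial diffeomorphism to the model vector space. -/
def chartPartialDiffeomorph [I.Boundaryless] [IsManifold I ∞ M] (x : M) :
    PartialDiffeomorph I 𝓘(ℝ, E) M E ∞ where
  toPartialEquiv := extChartAt I x
  open_source := isOpen_extChartAt_source x
  open_target := isOpen_extChartAt_target x
  contMDiffOn_toFun := by
    have := contMDiffOn_extChartAt (I := I) (x := x) (n := ∞)
    rwa [← extChartAt_source I x] at this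
  contMDiffOn_invFun := contMDiffOn_extChartAt_symm x

theorem eventually_contDiffAt_writtenInExtChartAt [I.Boundaryless] [J.Boundaryless]
    [IsManifold I ∞ M] [IsManifold J ∞ N] {f : M → N} {x : M}
    (hf : ∀ᶠ y in 𝓝 x, ContMDiffAt I J ∞ f y) :
    ∀ᶠ z in 𝓝 (extChartAt I x x), ContDiffAt ℝ ∞ (writtenInExtChartAt I J x f) z := by
  have hc : ContinuousAt f x := hf.self_of_nhds.continuousAt
  have h1 : ∀ᶠ y in 𝓝 x, f y ∈ (extChartAt J (f x)).source :=
    hc (extChartAt_source_mem_nhds (I := J) (f x))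
  have h2 := (continuousAt_extChartAt_symm (I := I) x).eventually
    (by rw [extChartAt_to_inv]; exact hf.and h1)
  filter_upwards [h2, extChartAt_target_mem_nhds (I := I) x] with z ⟨hz, hz'⟩ hzt
  rw [← contMDiffAt_iff_contDiffAt]
  have e1 : ContMDiffAt 𝓘(ℝ, E) I ∞ (extChartAt I x).symm z :=
    (contMDiffOn_extChartAt_symm x).contMDiffAt ((isOpen_extChartAt_target x).mem_nhds hzt)
  have e2 : ContMDiffAt J 𝓘(ℝ, E') ∞ (extChartAt J (f x)) (f ((extChartAt I x).symm z)) :=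
    contMDiffAt_extChartAt' (by rwa [extChartAt_source] at hz')
  exact e2.comp z (hz.comp z e1)

theorem mfderiv_eq_fderiv_writtenInExtChartAt [I.Boundaryless] {f : M → N} {x : M}
    (hf : MDifferentiableAt I J f x) :
    mfderiv I J f x = fderiv ℝ (writtenInExtChartAt I J x f) (extChartAt I x x) := by
  rw [hf.mfderiv, I.range_eq_univ, fderivWithin_univ]

theorem isLocalDiffeomorphAt_of_writtenInExtChartAt [I.Boundaryless] [J.Boundaryless]
    [IsManifold I ∞ M] [IsManifold J ∞ N] {f : M → N} {x : M} (hc : ContinuousAt f x)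
    (h : IsLocalDiffeomorphAt 𝓘(ℝ, E) 𝓘(ℝ, E') ∞ (writtenInExtChartAt I J x f)
      (extChartAt I x x)) :
    IsLocalDiffeomorphAt I J ∞ f x := by
  have h1 : IsLocalDiffeomorphAt I 𝓘(ℝ, E) ∞ (extChartAt I x) x :=
    ⟨chartPartialDiffeomorph I x, mem_extChartAt_source x, fun _ _ => rfl⟩
  have h2 : IsLocalDiffeomorphAt 𝓘(ℝ, E') J ∞ (extChartAt J (f x)).symm
      (writtenInExtChartAt I J x f (extChartAt I x x)) :=
    ⟨(chartPartialDiffeomorph J (f x)).symm, by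
      change writtenInExtChartAt I J x f (extChartAt I x x) ∈ (extChartAt J (f x)).target
      rw [writtenInExtChartAt, comp_apply, comp_apply, extChartAt_to_inv]
      exact mem_extChartAt_target (I := J) (f x), fun _ _ => rfl⟩
  have h3 := IsLocalDiffeomorphAt.comp (hf := IsLocalDiffeomorphAt.comp (hf := h1) (hg := h))
    (hg := h2)
  refine isLocalDiffeomorphAt_congr h3 ?_
  filter_upwards [extChartAt_source_mem_nhds (I := I) x,
    hc (extChartAt_source_mem_nhds (I := J) (f x))] with y hy hy'
  simp only [comp_apply, writtenInExtChartAt, (extChartAt I x).left_inv hy]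
  exact (extChartAt J (f x)).left_inv hy'

/-- The inverse function theorem for manifolds without boundary. -/
theorem isLocalDiffeomorphAt_of_bijective_mfderiv [FiniteDimensional ℝ E] [FiniteDimensional ℝ E']
    [I.Boundaryless] [J.Boundaryless]
    [IsManifold I ∞ M] [IsManifold J ∞ N] {f : M → N} {x : M}
    (hf : ∀ᶠ y in 𝓝 x, ContMDiffAt I J ∞ f y) (hb : Bijective (mfderiv I J f x)) :
    IsLocalDiffeomorphAt I J ∞ f x := by
  refine isLocalDiffeomorphAt_of_writtenInExtChartAt hf.self_of_nhds.continuousAt ?_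
  refine isLocalDiffeomorphAt_of_bijective_fderiv
    (eventually_contDiffAt_writtenInExtChartAt hf) ?_
  rwa [← mfderiv_eq_fderiv_writtenInExtChartAt (hf.self_of_nhds.mdifferentiableAt (by simp))]

/-- A locally injective submersion has injective derivative. -/
theorem injective_fderiv_of_injOn [FiniteDimensional ℝ E] [FiniteDimensional ℝ E']
    {f : E → E'} {a : E} (hf : ContDiffAt ℝ 1 f a)
    (hs : Surjective (fderiv ℝ f a)) {s : Set E} (hsa : s ∈ 𝓝 a) (hi : InjOn f s) :
    Injective (fderiv ℝ f a) := by
  have : CompleteSpace E := FiniteDimensional.complete ℝ E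
  have : CompleteSpace E' := FiniteDimensional.complete ℝ E'
  have hd : HasStrictFDerivAt f (fderiv ℝ f a) a := hf.hasStrictFDerivAt (by simp)
  have hr : (fderiv ℝ f a).range = ⊤ := LinearMap.range_eq_top.2 hs
  -- In these coordinates `f` is the first projection. A kernel vector `k'` gives points `(f a, t •
  -- k')` in the fibre of `a`, and injectivity of `f` near `a` collapses them to `a`.
  let e := hd.implicitToOpenPartialHomeomorph f (fderiv ℝ f a) hr
  have hea : e a = (f a, 0) := hd.implicitToOpenPartialHomeomorph_self hr
  have ha : a ∈ e.source := hd.mem_implicitToOpenPartialHomeomorph_source hr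
  have hes : e.symm (f a, 0) = a := by rw [← hea, e.left_inv ha]
  have hfst : ∀ y, (e y).1 = f y := fun y => hd.implicitToOpenPartialHomeomorph_fst hr y
  refine (injective_iff_map_eq_zero _).2 fun k hk => ?_
  let k' : (fderiv ℝ f a).ker := ⟨k, hk⟩
  have hat : (f a, 0) ∈ e.target := hea ▸ e.map_source ha
  have hc : Tendsto (fun t : ℝ => ((f a, t • k') : E' × (fderiv ℝ f a).ker)) (𝓝 0)
      (𝓝 (f a, 0)) := by
    have : Continuous (fun t : ℝ => ((f a, t • k') : E' × (fderiv ℝ f a).ker)) := by fun_prop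
    simpa using this.tendsto 0
  have h1 : ∀ᶠ t in 𝓝 (0 : ℝ), (f a, t • k') ∈ e.target := hc (e.open_target.mem_nhds hat)
  have h2 : ∀ᶠ t in 𝓝 (0 : ℝ), e.symm (f a, t • k') ∈ s := by
    have := (e.continuousAt_symm hat).tendsto.comp hc
    rw [hes] at this
    exact this hsa
  obtain ⟨t, ⟨ht1, ht2⟩, ht0⟩ :=
    (((h1.and h2).filter_mono nhdsWithin_le_nhds).and
      (self_mem_nhdsWithin (a := (0 : ℝ)) (s := {0}ᶜ))).exists
  have h3 : e (e.symm (f a, t • k')) = (f a, t • k') := e.right_inv ht1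
  have h4 : f (e.symm (f a, t • k')) = f a := by rw [← hfst, h3]
  have h5 : e.symm (f a, t • k') = a := hi ht2 (mem_of_mem_nhds hsa) h4
  rw [h5, hea] at h3
  have h6 : t • k' = 0 := (Prod.ext_iff.1 h3).2.symm
  have h7 : k' = 0 := (smul_eq_zero.1 h6).resolve_left ht0
  exact congrArg Subtype.val h7

/-- A locally injective submersion is a local diffeomorphism. -/
theorem isLocalDiffeomorphAt_of_injOn_of_surjective_mfderiv
    [FiniteDimensional ℝ E] [FiniteDimensional ℝ E'] [I.Boundaryless] [J.Boundaryless]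
    [IsManifold I ∞ M] [IsManifold J ∞ N] {f : M → N} {x : M}
    (hf : ∀ᶠ y in 𝓝 x, ContMDiffAt I J ∞ f y) (hs : Surjective (mfderiv I J f x))
    {s : Set M} (hsx : s ∈ 𝓝 x) (hi : InjOn f s) :
    IsLocalDiffeomorphAt I J ∞ f x := by
  refine isLocalDiffeomorphAt_of_bijective_mfderiv hf ⟨?_, hs⟩
  have hd := mfderiv_eq_fderiv_writtenInExtChartAt (hf.self_of_nhds.mdifferentiableAt (by simp))
  have hs' : Surjective (fderiv ℝ (writtenInExtChartAt I J x f) (extChartAt I x x)) := hd ▸ hs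
  have hc : ContinuousAt f x := hf.self_of_nhds.continuousAt
  have h1 : ∀ᶠ y in 𝓝 x, f y ∈ (extChartAt J (f x)).source :=
    hc (extChartAt_source_mem_nhds (I := J) (f x))
  have h2 := (continuousAt_extChartAt_symm (I := I) x).eventually
    (by rw [extChartAt_to_inv]; exact h1.and hsx)
  suffices Injective (fderiv ℝ (writtenInExtChartAt I J x f) (extChartAt I x x)) by
    rw [hd]; exact this
  refine injective_fderiv_of_injOn
    ((eventually_contDiffAt_writtenInExtChartAt hf).self_of_nhds.of_le (by simp)) hs'
    (h2.and (extChartAt_target_mem_nhds (I := I) x)) ?_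
  rintro y ⟨⟨hy1, hy2⟩, hy3⟩ z ⟨⟨hz1, hz2⟩, hz3⟩ hyz
  have := (extChartAt J (f x)).injOn hy1 hz1 hyz
  exact (extChartAt I x).symm.injOn hy3 hz3 (hi hy2 hz2 this)

/-- An injective local diffeomorphism is a diffeomorphism onto its image. -/
theorem exists_diffeomorph_of_injective {f : M → N} (hf : IsLocalDiffeomorph I J ∞ f)
    (hi : Injective f) (O : TopologicalSpace.Opens N) (hO : range f = O)
    [IsManifold J ∞ N] :
    ∃ φ : Diffeomorph I J M O ∞, ∀ x, (φ x : N) = f x := by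
  have hmem : ∀ x, f x ∈ O := fun x => by
    have : f x ∈ (O : Set N) := hO ▸ mem_range_self x
    exact this
  have hsurj : ∀ y : O, ∃ x, f x = y := fun y => by
    have : (y : N) ∈ range f := hO ▸ y.2
    exact this
  choose g hg using hsurj
  have hcd : ContMDiff I J ∞ (fun x => (⟨f x, hmem x⟩ : O)) :=
    (ContMDiff.iff_comp_isImmersion (Manifold.IsImmersion.of_opens O)).2
      ⟨hf.contMDiff.continuous.subtype_mk _, hf.contMDiff⟩
  refine ⟨⟨⟨fun x => ⟨f x, hmem x⟩, g, fun x => hi (hg _), fun y => Subtype.ext (hg y)⟩, hcd, ?_⟩,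
    fun x => rfl⟩
  intro y
  -- Injectivity forces the chosen inverse `g` to agree near `y` with the local inverse at `g y`,
  -- which is smooth.
  have h1 := hf (g y)
  have hy : (y : N) ∈ h1.localInverse.source := hg y ▸ h1.localInverse_mem_source
  have h2 : ContMDiffAt J I ∞ h1.localInverse (y : N) :=
    h1.localInverse_contMDiffOn.contMDiffAt (h1.localInverse.open_source.mem_nhds hy)
  have h3 : ContMDiffAt J I ∞ (fun z : O => h1.localInverse (z : N)) y :=
    h2.comp y (contMDiff_subtype_val y)
  refine h3.congr_of_eventuallyEq ?_
  filter_upwards [continuous_subtype_val.continuousAt.preimage_mem_nhds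
    (h1.localInverse.open_source.mem_nhds hy)] with z hz
  exact hi ((hg z).trans (h1.localInverse_right_inv hz).symm)

end LocalDiffeo

/-! ### Submersions and immersions recognised by their derivative. -/

section NormalForms

variable {E : Type*} [NormedAddCommGroup E] [NormedSpace ℝ E] [FiniteDimensional ℝ E]
  {M : Type*} [TopologicalSpace M] [ChartedSpace E M] [IsManifold 𝓘(ℝ, E) ∞ M]
  {E' : Type*} [NormedAddCommGroup E'] [NormedSpace ℝ E'] [FiniteDimensional ℝ E']
  {N : Type*} [TopologicalSpace N] [ChartedSpace E' N] [IsManifold 𝓘(ℝ, E') ∞ N]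

/-- A partial diffeomorphism to the model space belongs to the maximal atlas. -/
theorem partialDiffeomorph_mem_maximalAtlas (Φ : PartialDiffeomorph 𝓘(ℝ, E) 𝓘(ℝ, E) M E ∞) :
    Φ.toOpenPartialHomeomorph ∈ IsManifold.maximalAtlas 𝓘(ℝ, E) ∞ M :=
  OpenPartialHomeomorph.mem_maximalAtlas_of_contMDiffOn _ Φ.contMDiffOn_toFun
    Φ.contMDiffOn_invFun

/-- A map with surjective derivative is a submersion, with any complement of the right
dimension. -/
theorem isSubmersionAtOfComplement_of_surjective_mfderiv {f : M → N} {x : M}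
    {K : Type*} [NormedAddCommGroup K] [NormedSpace ℝ K] [FiniteDimensional ℝ K]
    (hf : ∀ᶠ y in 𝓝 x, ContMDiffAt 𝓘(ℝ, E) 𝓘(ℝ, E') ∞ f y)
    (hs : Surjective (mfderiv 𝓘(ℝ, E) 𝓘(ℝ, E') f x))
    (hK : Module.finrank ℝ E' + Module.finrank ℝ K = Module.finrank ℝ E) :
    Manifold.IsSubmersionAtOfComplement K 𝓘(ℝ, E) 𝓘(ℝ, E') ∞ f x := by
  let D : E →L[ℝ] E' := mfderiv 𝓘(ℝ, E) 𝓘(ℝ, E') f x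
  have hsD : Surjective D := hs
  have hker : Module.finrank ℝ D.ker = Module.finrank ℝ K := by
    have h1 := LinearMap.finrank_range_add_finrank_ker D.toLinearMap
    rw [LinearMap.range_eq_top.2 hsD, finrank_top] at h1
    have : Module.finrank ℝ D.ker = Module.finrank ℝ (LinearMap.ker D.toLinearMap) := rfl
    omega
  let eK : D.ker ≃L[ℝ] K := ContinuousLinearEquiv.ofFinrankEq hker
  -- Extending the identification of the kernel of `D` with `K` to all of `E` makes `(D, q)`
  -- injective, hence bijective by dimension. The map `h` below is its nonlinear counterpart and
  -- straightens `f` to a projection.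
  obtain ⟨q, hq⟩ : ∃ q : E →L[ℝ] K, ∀ k : D.ker, q k = eK k := by
    obtain ⟨q, hq⟩ := LinearMap.exists_extend eK.toLinearEquiv.toLinearMap
    exact ⟨LinearMap.toContinuousLinearMap q, fun k => LinearMap.congr_fun hq k⟩
  let D' : E →L[ℝ] E' × K := D.prod q
  have hD'i : Injective D' := by
    refine (injective_iff_map_eq_zero _).2 fun v hv => ?_
    have h1 : D v = 0 := congrArg Prod.fst hv
    have h2 : q v = 0 := congrArg Prod.snd hv
    have h3 : eK ⟨v, h1⟩ = 0 := by rw [← hq]; exact h2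
    have h4 : (⟨v, h1⟩ : D.ker) = 0 := by simpa using h3
    exact congrArg Subtype.val h4
  have hdim : Module.finrank ℝ E = Module.finrank ℝ (E' × K) := by
    rw [Module.finrank_prod, hK]
  have hD'b : Bijective D' := ⟨hD'i, (LinearMap.injective_iff_surjective_of_finrank_eq_finrank
    (f := D'.toLinearMap) hdim).1 hD'i⟩
  let L : E ≃L[ℝ] E' × K :=
    (LinearEquiv.ofBijective D'.toLinearMap hD'b).toContinuousLinearEquiv
  let φ := chartAt E x
  let ψ := chartAt E' (f x)
  have hfa := hf.self_of_nhds
  have hc : ContinuousAt f x := hfa.continuousAt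
  let h : M → E' × K := fun y => (ψ (f y), q (φ y))
  have hh : ∀ᶠ y in 𝓝 x, ContMDiffAt 𝓘(ℝ, E) 𝓘(ℝ, E' × K) ∞ h y := by
    filter_upwards [hf, hc (chart_source_mem_nhds E' (f x)), chart_source_mem_nhds E x]
      with y hy1 hy2 hy3
    refine ContMDiffAt.prodMk_space ?_ ?_
    · exact (contMDiffAt_of_mem_maximalAtlas (IsManifold.chart_mem_maximalAtlas (f x)) hy2).comp
        y hy1
    · exact q.contMDiff.contMDiffAt.comp y
        (contMDiffAt_of_mem_maximalAtlas (IsManifold.chart_mem_maximalAtlas x) hy3)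
  have hw : writtenInExtChartAt 𝓘(ℝ, E) 𝓘(ℝ, E' × K) x h
      =ᶠ[𝓝 (extChartAt 𝓘(ℝ, E) x x)] fun z =>
        (writtenInExtChartAt 𝓘(ℝ, E) 𝓘(ℝ, E') x f z, q z) := by
    filter_upwards [extChartAt_target_mem_nhds (I := 𝓘(ℝ, E)) x] with z hz
    have : φ ((extChartAt 𝓘(ℝ, E) x).symm z) = z := (extChartAt 𝓘(ℝ, E) x).right_inv hz
    simp only [writtenInExtChartAt, comp_apply, h, this]
    rfl
  have hdf := mfderiv_eq_fderiv_writtenInExtChartAt (hfa.mdifferentiableAt (by simp))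
  have hdh : mfderiv 𝓘(ℝ, E) 𝓘(ℝ, E' × K) h x = D' := by
    rw [mfderiv_eq_fderiv_writtenInExtChartAt (hh.self_of_nhds.mdifferentiableAt (by simp)),
      hw.fderiv_eq]
    have hd1 : DifferentiableAt ℝ (writtenInExtChartAt 𝓘(ℝ, E) 𝓘(ℝ, E') x f)
        (extChartAt 𝓘(ℝ, E) x x) :=
      (eventually_contDiffAt_writtenInExtChartAt hf).self_of_nhds.differentiableAt (by simp)
    refine HasFDerivAt.fderiv (HasFDerivAt.prodMk ?_ q.hasFDerivAt)
    have h0 : fderiv ℝ (writtenInExtChartAt 𝓘(ℝ, E) 𝓘(ℝ, E') x f) (extChartAt 𝓘(ℝ, E) x x) = D :=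
      hdf.symm
    rw [← h0]
    exact hd1.hasFDerivAt
  have hb : Bijective (mfderiv 𝓘(ℝ, E) 𝓘(ℝ, E' × K) h x) := by
    rw [hdh]; exact hD'b
  obtain ⟨Φ, hxΦ, hΦ⟩ := isLocalDiffeomorphAt_of_bijective_mfderiv hh hb
  obtain ⟨s, hs, hso, hxs⟩ := eventually_nhds_iff.1 (hc.eventually (chart_source_mem_nhds E' (f x)))
  let Φ' : PartialDiffeomorph 𝓘(ℝ, E) 𝓘(ℝ, E) M E ∞ :=
    Φ.trans L.symm.toDiffeomorph.toPartialDiffeomorph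
  refine Manifold.IsSubmersionAtOfComplement.mk_of_continuousAt hc L Φ'.toOpenPartialHomeomorph ψ
    ⟨hxΦ, trivial⟩ (mem_chart_source E' (f x)) (partialDiffeomorph_mem_maximalAtlas Φ')
    (IsManifold.chart_mem_maximalAtlas (f x)) ?_
  intro z hz
  have hz' : L z ∈ Φ.target := by
    have := hz
    simp only [OpenPartialHomeomorph.extend, mfld_simps] at this
    exact this.2
  have h1 : h (Φ.symm (L z)) = L z := by
    have := hΦ (Φ.symm.map_source hz')
    rw [this]
    exact Φ.right_inv hz'
  have h2 : ψ (f (Φ.symm (L z))) = (L z).1 := congrArg Prod.fst h1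
  simpa using! h2

/-- Freezing the complementary coordinate of the normal form at its value `c` gives a smooth `σ`
with `σ (f x) = x` and `f ∘ σ = id` near `f x`. The chain rule then provides a right inverse of the
derivative. -/
theorem surjective_mfderiv_of_isSubmersionAt {f : M → N} {x : M}
    (hf : Manifold.IsSubmersionAt 𝓘(ℝ, E) 𝓘(ℝ, E') ∞ f x) :
    Surjective (mfderiv 𝓘(ℝ, E) 𝓘(ℝ, E') f x) := by
  let φ := hf.domChart
  let ψ := hf.codChart
  let c := (hf.equiv (φ x)).2
  have hφ : φ ∈ IsManifold.maximalAtlas 𝓘(ℝ, E) ∞ M := hf.domChart_mem_maximalAtlas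
  have hψ : ψ ∈ IsManifold.maximalAtlas 𝓘(ℝ, E') ∞ N := hf.codChart_mem_maximalAtlas
  have hx : x ∈ φ.source := hf.mem_domChart_source
  have hfx : f x ∈ ψ.source := hf.mem_codChart_source
  have hw : ∀ z ∈ φ.target, ψ (f (φ.symm z)) = (hf.equiv z).1 := fun z hz => by
    have hz' : z ∈ (hf.domChart.extend 𝓘(ℝ, E)).target := by
      simpa [OpenPartialHomeomorph.extend] using hz
    have := hf.writtenInCharts hz'
    simpa [OpenPartialHomeomorph.extend] using this
  let τ : E' → E := fun w => hf.equiv.symm (w, c)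
  have hτ : ContDiff ℝ ∞ τ := hf.equiv.symm.contDiff.comp (contDiff_id.prodMk contDiff_const)
  have hψx : ψ (f x) = (hf.equiv (φ x)).1 := by
    rw [← hw _ (φ.map_source hx), φ.left_inv hx]
  have hτx : τ (ψ (f x)) = φ x := by
    change hf.equiv.symm (ψ (f x), c) = φ x
    rw [hψx]; exact hf.equiv.symm_apply_apply _
  let σ : N → M := fun n => φ.symm (τ (ψ n))
  have hσx : σ (f x) = x := by
    change φ.symm (τ (ψ (f x))) = x
    rw [hτx, φ.left_inv hx]
  have hψa : ContMDiffAt 𝓘(ℝ, E') 𝓘(ℝ, E') ∞ ψ (f x) := contMDiffAt_of_mem_maximalAtlas hψ hfx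
  have h1 : ContMDiffAt 𝓘(ℝ, E') 𝓘(ℝ, E) ∞ (fun n => τ (ψ n)) (f x) :=
    hτ.contMDiff.contMDiffAt.comp (f x) hψa
  have hσ : ContMDiffAt 𝓘(ℝ, E') 𝓘(ℝ, E) ∞ σ (f x) := by
    refine ContMDiffAt.comp (f x) ?_ h1
    rw [hτx]
    exact contMDiffAt_symm_of_mem_maximalAtlas hφ (φ.map_source hx)
  have hid : f ∘ σ =ᶠ[𝓝 (f x)] id := by
    have h2 : ∀ᶠ n in 𝓝 (f x), τ (ψ n) ∈ φ.target :=
      h1.continuousAt (by rw [hτx]; exact φ.open_target.mem_nhds (φ.map_source hx))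
    have h3 : ∀ᶠ n in 𝓝 (f x), f (σ n) ∈ ψ.source := by
      have h4 : ContinuousAt (fun n => f (σ n)) (f x) :=
        ContinuousAt.comp (by rw [hσx]; exact hf.contMDiffAt.continuousAt) hσ.continuousAt
      refine h4 ?_
      change ψ.source ∈ 𝓝 (f (σ (f x)))
      rw [hσx]; exact ψ.open_source.mem_nhds hfx
    filter_upwards [h2, h3, ψ.open_source.mem_nhds hfx] with n hn1 hn2 hn3
    refine ψ.injOn hn2 hn3 ?_
    rw [show ψ (f (σ n)) = (hf.equiv (τ (ψ n))).1 from hw _ hn1]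
    simp [τ]
  have hfd : MDifferentiableAt 𝓘(ℝ, E) 𝓘(ℝ, E') f (σ (f x)) := by
    rw [hσx]; exact hf.contMDiffAt.mdifferentiableAt (by simp)
  have hcomp := mfderiv_comp (f x) hfd (hσ.mdifferentiableAt (by simp))
  rw [hid.mfderiv_eq, mfderiv_id] at hcomp
  intro w
  have h5 := congrArg (fun T : E' →L[ℝ] E' => T w) hcomp
  have h6 : ∀ y, y = x → ∀ v : E, (mfderiv 𝓘(ℝ, E) 𝓘(ℝ, E') f y v : E') =
      (mfderiv 𝓘(ℝ, E) 𝓘(ℝ, E') f x v : E') := by rintro y rfl v; rfl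
  exact ⟨mfderiv 𝓘(ℝ, E') 𝓘(ℝ, E) σ (f x) w, (h6 _ hσx _).symm.trans h5.symm⟩

/-- A map with injective derivative is an immersion, with any complement of the right dimension. -/
theorem isImmersionAtOfComplement_of_injective_mfderiv {f : M → N} {x : M}
    {K : Type*} [NormedAddCommGroup K] [NormedSpace ℝ K] [FiniteDimensional ℝ K]
    (hf : ∀ᶠ y in 𝓝 x, ContMDiffAt 𝓘(ℝ, E) 𝓘(ℝ, E') ∞ f y)
    (hs : Injective (mfderiv 𝓘(ℝ, E) 𝓘(ℝ, E') f x))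
    (hK : Module.finrank ℝ E + Module.finrank ℝ K = Module.finrank ℝ E') :
    Manifold.IsImmersionAtOfComplement K 𝓘(ℝ, E) 𝓘(ℝ, E') ∞ f x := by
  let D : E →L[ℝ] E' := mfderiv 𝓘(ℝ, E) 𝓘(ℝ, E') f x
  have hD : Injective D := hs
  have hrank : Module.finrank ℝ D.range = Module.finrank ℝ E :=
    LinearMap.finrank_range_of_inj (f := D.toLinearMap) hD
  obtain ⟨C, hC⟩ := D.range.exists_isCompl
  have hCK : Module.finrank ℝ K = Module.finrank ℝ C := by
    have := Submodule.finrank_add_eq_of_isCompl hC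
    omega
  let eK : K ≃L[ℝ] C := ContinuousLinearEquiv.ofFinrankEq hCK
  let c : K →L[ℝ] E' := C.subtypeL.comp (eK : K →L[ℝ] C)
  let D' : E × K →L[ℝ] E' := D.coprod c
  have hD'i : Injective D' := by
    refine (injective_iff_map_eq_zero _).2 ?_
    rintro ⟨v, k⟩ hv
    have h1 : D v + c k = 0 := hv
    have h2 : D v ∈ C := by
      rw [eq_neg_of_add_eq_zero_left h1]; exact C.neg_mem (eK k).2
    have h3 : D v = 0 := Submodule.disjoint_def.1 hC.disjoint _ (LinearMap.mem_range_self _ v) h2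
    have h4 : c k = 0 := by rw [h3, zero_add] at h1; exact h1
    have h5 : eK k = 0 := Subtype.ext h4
    have h6 : k = 0 := by simpa using h5
    have h7 : v = 0 := hD (by rw [h3, map_zero])
    rw [h6, h7]; rfl
  have hdim : Module.finrank ℝ (E × K) = Module.finrank ℝ E' := by
    rw [Module.finrank_prod, hK]
  have hD'b : Bijective D' := ⟨hD'i, (LinearMap.injective_iff_surjective_of_finrank_eq_finrank
    (f := D'.toLinearMap) hdim).1 hD'i⟩
  let L : (E × K) ≃L[ℝ] E' :=
    (LinearEquiv.ofBijective D'.toLinearMap hD'b).toContinuousLinearEquiv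
  have hfa := hf.self_of_nhds
  let w := writtenInExtChartAt 𝓘(ℝ, E) 𝓘(ℝ, E') x f
  let a := extChartAt 𝓘(ℝ, E) x x
  have hw : ∀ᶠ z in 𝓝 a, ContDiffAt ℝ ∞ w z := eventually_contDiffAt_writtenInExtChartAt hf
  have hdf : fderiv ℝ w a = D :=
    (mfderiv_eq_fderiv_writtenInExtChartAt (hfa.mdifferentiableAt (by simp))).symm
  -- The map is thickened by directions complementary to its image. The local inverse of `h`
  -- straightens the image of `f` to `z ↦ (z, 0)`.
  let h : E × K → E' := fun z => w z.1 + c z.2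
  have hh : ∀ᶠ z in 𝓝 (a, (0 : K)), ContDiffAt ℝ ∞ h z := by
    filter_upwards [continuousAt_fst.eventually hw] with z hz
    exact (hz.comp z contDiffAt_fst).add (c.contDiff.contDiffAt.comp z contDiffAt_snd)
  have hdh : fderiv ℝ h (a, 0) = D' := by
    have h1 : HasFDerivAt w D ((a, (0 : K)) : E × K).1 := by
      rw [← hdf]
      exact (hw.self_of_nhds.differentiableAt (by simp)).hasFDerivAt
    have h2 : HasFDerivAt h (D.comp (ContinuousLinearMap.fst ℝ E K) +
        c.comp (ContinuousLinearMap.snd ℝ E K)) (a, 0) :=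
      (h1.comp (a, (0 : K)) hasFDerivAt_fst).add
        (c.hasFDerivAt.comp (a, (0 : K)) hasFDerivAt_snd)
    rw [h2.fderiv]
    ext <;> simp [D']
  obtain ⟨Φ, hxΦ, hΦ⟩ := isLocalDiffeomorphAt_of_bijective_fderiv hh (by rw [hdh]; exact hD'b)
  let Ψ : PartialDiffeomorph 𝓘(ℝ, E') 𝓘(ℝ, E') N E' ∞ :=
    ((chartPartialDiffeomorph 𝓘(ℝ, E') (f x)).trans Φ.symm).trans
      L.toDiffeomorph.toPartialDiffeomorph
  have hO : IsOpen ((fun z : E => (z, (0 : K))) ⁻¹' Φ.source) :=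
    Φ.open_source.preimage (by fun_prop)
  let Θ : PartialDiffeomorph 𝓘(ℝ, E) 𝓘(ℝ, E) M E ∞ :=
    (chartPartialDiffeomorph 𝓘(ℝ, E) x).trans
      (restrPartialDiffeomorph (Diffeomorph.refl 𝓘(ℝ, E) E ∞).toPartialDiffeomorph _ hO)
  have hh0 : h (a, 0) = chartAt E' (f x) (f x) := by
    have : w a = chartAt E' (f x) (f x) := by
      change chartAt E' (f x) (f ((extChartAt 𝓘(ℝ, E) x).symm (extChartAt 𝓘(ℝ, E) x x))) = _
      rw [extChartAt_to_inv]
    simp [h, this]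
  have hΦa : Φ (a, 0) = chartAt E' (f x) (f x) := (hΦ hxΦ).symm.trans hh0
  refine Manifold.IsImmersionAtOfComplement.mk_of_continuousAt hfa.continuousAt L
    Θ.toOpenPartialHomeomorph Ψ.toOpenPartialHomeomorph
    ⟨mem_extChartAt_source x, trivial, hxΦ⟩ ⟨⟨mem_extChartAt_source (f x), ?_⟩, trivial⟩
    (partialDiffeomorph_mem_maximalAtlas Θ) (partialDiffeomorph_mem_maximalAtlas Ψ) ?_
  · change chartAt E' (f x) (f x) ∈ Φ.target
    rw [← hΦa]; exact Φ.map_source hxΦ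
  · intro z hz
    have hz' : (z, (0 : K)) ∈ Φ.source := by
      have h1 : z ∈ Θ.target := by simpa [OpenPartialHomeomorph.extend] using! hz
      exact h1.1.2
    have h1 : w z = Φ (z, 0) := by
      rw [← hΦ hz']; simp [h]
    have h2 : Φ.symm (w z) = (z, 0) := by rw [h1]; exact Φ.left_inv hz'
    change L (Φ.symm (w z)) = L (z, 0)
    rw [h2]

end NormalForms

/-! ### Generating and comparing smooth structures. -/

namespace SmoothStructure

/-- The smooth structure generated by a compatible family of charts. -/
def ofAtlas {X : Type*} [TopologicalSpace X] (d : ℕ)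
    (A : Set (OpenPartialHomeomorph X (EuclideanSpace ℝ (Fin d))))
    (cover : ∀ x : X, ∃ e ∈ A, x ∈ e.source)
    (compatible : ∀ e ∈ A, ∀ e' ∈ A, e.symm.trans e' ∈ contDiffGroupoid ∞ (𝓡 d)) :
    SmoothStructure X :=
  letI _ : ChartedSpace (EuclideanSpace ℝ (Fin d)) X :=
    { atlas := A
      chartAt := fun x => (cover x).choose
      mem_chart_source := fun x => (cover x).choose_spec.2
      chart_mem_atlas := fun x => (cover x).choose_spec.1 }
  haveI : HasGroupoid X (contDiffGroupoid ∞ (𝓡 d)) :=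
    ⟨fun {e e'} he he' => compatible e he e' he'⟩
  haveI : IsManifold (𝓡 d) ∞ X := IsManifold.mk' _ _ _
  { dim := d
    charts := IsManifold.maximalAtlas (𝓡 d) ∞ X
    cover := fun x => ⟨chartAt _ x, IsManifold.chart_mem_maximalAtlas x, mem_chart_source _ x⟩
    compatible := fun _ he _ he' => IsManifold.compatible_of_mem_maximalAtlas he he'
    maximal := fun _ he => mem_maximalAtlas_iff.2 fun e' he' =>
      he e' (IsManifold.subset_maximalAtlas he') }

theorem subset_charts_ofAtlas {X : Type*} [TopologicalSpace X] (d : ℕ)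
    (A : Set (OpenPartialHomeomorph X (EuclideanSpace ℝ (Fin d))))
    (cover : ∀ x : X, ∃ e ∈ A, x ∈ e.source)
    (compatible : ∀ e ∈ A, ∀ e' ∈ A, e.symm.trans e' ∈ contDiffGroupoid ∞ (𝓡 d)) :
    A ⊆ (ofAtlas d A cover compatible).charts := by
  let c : ChartedSpace (EuclideanSpace ℝ (Fin d)) X :=
    { atlas := A
      chartAt := fun x => (cover x).choose
      mem_chart_source := fun x => (cover x).choose_spec.2
      chart_mem_atlas := fun x => (cover x).choose_spec.1 }
  have : HasGroupoid X (contDiffGroupoid ∞ (𝓡 d)) :=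
    ⟨fun {e e'} he he' => compatible e he e' he'⟩
  have : IsManifold (𝓡 d) ∞ X := IsManifold.mk' _ _ _
  exact IsManifold.subset_maximalAtlas (I := 𝓡 d) (n := ∞) (M := X)

variable {X : Type*} [TopologicalSpace X]

theorem transOpenPartialHomeomorph_mem_maximalAtlas {d : ℕ} {Y : Type*} [TopologicalSpace Y]
    {_ : ChartedSpace (EuclideanSpace ℝ (Fin d)) X} {_ : ChartedSpace (EuclideanSpace ℝ (Fin d)) Y}
    (_ : IsManifold (𝓡 d) ∞ X) (_ : IsManifold (𝓡 d) ∞ Y) (h : X ≃ₜ Y)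
    (h1 : ContMDiff (𝓡 d) (𝓡 d) ∞ h) (h2 : ContMDiff (𝓡 d) (𝓡 d) ∞ h.symm)
    {e : OpenPartialHomeomorph Y (EuclideanSpace ℝ (Fin d))}
    (he : e ∈ IsManifold.maximalAtlas (𝓡 d) ∞ Y) :
    h.transOpenPartialHomeomorph e ∈ IsManifold.maximalAtlas (𝓡 d) ∞ X := by
  refine OpenPartialHomeomorph.mem_maximalAtlas_of_contMDiffOn _ ?_ ?_
  · exact (contMDiffOn_of_mem_maximalAtlas he).comp (h1.contMDiffOn (s := h ⁻¹' e.source))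
      (fun x hx => hx)
  · exact (h2.contMDiffOn (s := univ)).comp (contMDiffOn_symm_of_mem_maximalAtlas he)
      (fun x hx => trivial)

theorem charts_subset_of_contMDiff {d : ℕ}
    {c c' : ChartedSpace (EuclideanSpace ℝ (Fin d)) X}
    (hc : @IsManifold ℝ _ _ _ _ _ _ (𝓡 d) ∞ X _ c)
    (hc' : @IsManifold ℝ _ _ _ _ _ _ (𝓡 d) ∞ X _ c')
    (h1 : @ContMDiff ℝ _ _ _ _ _ _ (𝓡 d) X _ c _ _ _ _ _ (𝓡 d) X _ c' ∞ id)
    (h2 : @ContMDiff ℝ _ _ _ _ _ _ (𝓡 d) X _ c' _ _ _ _ _ (𝓡 d) X _ c ∞ id)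
    {e : OpenPartialHomeomorph X (EuclideanSpace ℝ (Fin d))}
    (he : e ∈ @IsManifold.maximalAtlas ℝ _ _ _ _ _ _ (𝓡 d) ∞ X _ c) :
    e ∈ @IsManifold.maximalAtlas ℝ _ _ _ _ _ _ (𝓡 d) ∞ X _ c' := by
  have h := transOpenPartialHomeomorph_mem_maximalAtlas hc' hc (Homeomorph.refl X) h2 h1 he
  have h' : (Homeomorph.refl X).transOpenPartialHomeomorph e = e := by
    ext <;> simp
  rwa [h'] at h

/-- The derivative of the identity at any point is a linear isomorphism between the two model
spaces; nonemptiness supplies the point. -/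
theorem dim_eq_of_contMDiff [Nonempty X] {d d' : ℕ}
    {c : ChartedSpace (EuclideanSpace ℝ (Fin d)) X}
    {c' : ChartedSpace (EuclideanSpace ℝ (Fin d')) X}
    (h1 : @ContMDiff ℝ _ _ _ _ _ _ (𝓡 d) X _ c _ _ _ _ _ (𝓡 d') X _ c' ∞ id)
    (h2 : @ContMDiff ℝ _ _ _ _ _ _ (𝓡 d') X _ c' _ _ _ _ _ (𝓡 d) X _ c ∞ id) :
    d = d' := by
  let φ : @Diffeomorph ℝ _ _ _ _ _ _ _ _ _ _ _ (𝓡 d) (𝓡 d') X _ c X _ c' ∞ :=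
    @Diffeomorph.mk ℝ _ _ _ _ _ _ _ _ _ _ _ (𝓡 d) (𝓡 d') X _ c X _ c' ∞ (Equiv.refl X) h1 h2
  obtain ⟨x⟩ := (inferInstance : Nonempty X)
  have e : EuclideanSpace ℝ (Fin d) ≃L[ℝ] EuclideanSpace ℝ (Fin d') :=
    φ.mfderivToContinuousLinearEquiv (by simp) x
  simpa using e.toLinearEquiv.finrank_eq

/-- Two smooth structures for which the identity is smooth in both directions are equal. -/
theorem eq_of_contMDiff [Nonempty X] (s t : SmoothStructure X)
    (h1 : @ContMDiff ℝ _ _ _ _ _ _ (𝓡 s.dim) X _ s.chartedSpace _ _ _ _ _ (𝓡 t.dim) X _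
      t.chartedSpace ∞ id)
    (h2 : @ContMDiff ℝ _ _ _ _ _ _ (𝓡 t.dim) X _ t.chartedSpace _ _ _ _ _ (𝓡 s.dim) X _
      s.chartedSpace ∞ id) : s = t := by
  have hd : s.dim = t.dim := dim_eq_of_contMDiff h1 h2
  have key : ∀ s t : SmoothStructure X, s.dim = t.dim →
      (@ContMDiff ℝ _ _ _ _ _ _ (𝓡 s.dim) X _ s.chartedSpace _ _ _ _ _ (𝓡 t.dim) X _
        t.chartedSpace ∞ id) →
      (@ContMDiff ℝ _ _ _ _ _ _ (𝓡 t.dim) X _ t.chartedSpace _ _ _ _ _ (𝓡 s.dim) X _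
        s.chartedSpace ∞ id) → HEq s.charts t.charts := by
    intro s t hd h1 h2
    have ms := s.isManifold
    have mt := t.isManifold
    have as := s.maximalAtlas_eq
    have at' := t.maximalAtlas_eq
    generalize hcs : s.chartedSpace = cs at *
    generalize hct : t.chartedSpace = ct at *
    -- The two atlases have types that depend on different dimensions. Once the charted spaces are
    -- variables, the equality of dimensions can be substituted.
    rw [← as, ← at']
    clear hcs hct as at'
    revert cs
    rw [hd]
    intro cs ms h1 h2
    refine heq_of_eq (Set.Subset.antisymm ?_ ?_)
    · exact fun e he => charts_subset_of_contMDiff ms mt h1 h2 he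
    · exact fun e he => charts_subset_of_contMDiff mt ms h2 h1 he
  exact SmoothStructure.ext hd (key s t hd h1 h2)

end SmoothStructure

/-- Near `f x`, `h` is `h ∘ f` composed with the local inverse of `f`. This lets smoothness on the
orbit space be tested on a section. -/
theorem contMDiffAt_of_comp_isLocalDiffeomorphAt
    {E₁ E₂ E₃ H₁ H₂ H₃ : Type*} [NormedAddCommGroup E₁] [NormedSpace ℝ E₁]
    [NormedAddCommGroup E₂] [NormedSpace ℝ E₂] [NormedAddCommGroup E₃] [NormedSpace ℝ E₃]
    [TopologicalSpace H₁] [TopologicalSpace H₂] [TopologicalSpace H₃]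
    {I₁ : ModelWithCorners ℝ E₁ H₁} {I₂ : ModelWithCorners ℝ E₂ H₂} {I₃ : ModelWithCorners ℝ E₃ H₃}
    {S X Y : Type*} [TopologicalSpace S] [TopologicalSpace X] [TopologicalSpace Y]
    {_ : ChartedSpace H₁ S} {_ : ChartedSpace H₂ X} {_ : ChartedSpace H₃ Y}
    {f : S → X} {h : X → Y} {x : S} (hf : IsLocalDiffeomorphAt I₁ I₂ ∞ f x)
    (hh : ContMDiffAt I₁ I₃ ∞ (h ∘ f) x) : ContMDiffAt I₂ I₃ ∞ h (f x) := by
  have h1 : ContMDiffAt I₂ I₃ ∞ ((h ∘ f) ∘ hf.localInverse) (f x) := by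
    refine ContMDiffAt.comp (f x) ?_ hf.localInverse_contMDiffAt
    rwa [hf.localInverse_left_inv hf.localInverse_mem_target]
  refine h1.congr_of_eventuallyEq ?_
  filter_upwards [hf.localInverse_eventuallyEq_right] with y hy
  exact (congrArg h hy).symm

/-! ### Free actions, tube maps and the existence of slices. -/

section Action

variable {E : Type*} [NormedAddCommGroup E] [NormedSpace ℝ E] [FiniteDimensional ℝ E]
  {P : Type*} [TopologicalSpace P] [ChartedSpace E P] [IsManifold 𝓘(ℝ, E) ∞ P]
  {F : Type*} [NormedAddCommGroup F] [NormedSpace ℝ F] [FiniteDimensional ℝ F]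
  {G : Type*} [TopologicalSpace G] [ChartedSpace F G] [Group G] [LieGroup 𝓘(ℝ, F) ∞ G]
  [MulAction G P] [ContMDiffSMul 𝓘(ℝ, F) 𝓘(ℝ, E) ∞ G P]

variable (E F) in
theorem contMDiff_orbitMap (p : P) : ContMDiff 𝓘(ℝ, F) 𝓘(ℝ, E) ∞ (fun g : G => g • p) :=
  (contMDiff_smul (I := 𝓘(ℝ, F)) (I' := 𝓘(ℝ, E))).comp (contMDiff_id.prodMk contMDiff_const)

/-- The infinitesimal action of a free action is injective. -/
theorem injective_infinitesimalAction (hfree : ∀ (g : G) (p : P), g • p = p → g = 1) (p : P) :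
    Injective (infinitesimalAction (E := E) F G p) := by
  have : CompleteSpace F := FiniteDimensional.complete ℝ F
  have : CompleteSpace E := FiniteDimensional.complete ℝ E
  have : LieGroup 𝓘(ℝ, F) (minSmoothness ℝ 3) G := 
    LieGroup.of_le (n := ∞) (by
      rw [minSmoothness_of_isRCLikeNormedField]; exact ENat.LEInfty.out)
  have : LieGroup 𝓘(ℝ, F) 1 G := LieGroup.of_le (n := ∞) (by simp)
  refine (injective_iff_map_eq_zero _).2 fun ξ hξ => ?_
  let v : ∀ g : G, TangentSpace 𝓘(ℝ, F) g := mulInvariantVectorField ξ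
  have hv : ContMDiffAt 𝓘(ℝ, F) (𝓘(ℝ, F)).tangent 1
      (fun g : G => (⟨g, v g⟩ : TangentBundle 𝓘(ℝ, F) G)) 1 :=
    (contMDiffAt_mulInvariantVectorField ξ).of_le (by simp)
  obtain ⟨c, hc0, hc⟩ := exists_isMIntegralCurveAt_of_contMDiffAt_boundaryless (t₀ := 0) hv
  -- The orbit map intertwines left translation by `g` with the action of `g`. A vector killed at
  -- `1` therefore extends to a left-invariant field killed everywhere.
  have hker : ∀ g : G, mfderiv 𝓘(ℝ, F) 𝓘(ℝ, E) (fun h : G => h • p) g (v g) = 0 := by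
    intro g
    have h1 : (fun h : G => h • p) ∘ (fun h => g * h) = (fun q : P => g • q) ∘ (fun h : G => h • p) := by
      ext h; simp [mul_smul]
    have hL : MDifferentiableAt 𝓘(ℝ, F) 𝓘(ℝ, F) (fun h : G => g * h) 1 :=
      (contMDiff_mul_left (I := 𝓘(ℝ, F)) (n := 1)).mdifferentiableAt (by simp)
    have hO : ∀ h, MDifferentiableAt 𝓘(ℝ, F) 𝓘(ℝ, E) (fun h : G => h • p) h :=
      fun h => (contMDiff_orbitMap E F p).mdifferentiableAt (by simp)
    have hA : ∀ q : P, MDifferentiableAt 𝓘(ℝ, E) 𝓘(ℝ, E) (fun q : P => g • q) q :=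
      fun q => (ContMDiffSMul.contMDiff_const_smul (I := 𝓘(ℝ, F)) (I' := 𝓘(ℝ, E)) (n := ∞) g).mdifferentiableAt (by simp)
    have h2 := mfderiv_comp (1 : G) (hO (g * 1)) hL
    have h3 := mfderiv_comp (1 : G) (hA ((1 : G) • p)) (hO 1)
    rw [h1, h3] at h2
    have h4 := congrArg (fun T : F →L[ℝ] E => T ξ) h2
    have h5 : (mfderiv 𝓘(ℝ, F) 𝓘(ℝ, E) (fun h : G => h • p) 1 ξ : E) = 0 := hξ
    have h6 : (mfderiv 𝓘(ℝ, F) 𝓘(ℝ, E) (fun h : G => h • p) (g * 1)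
        (mfderiv 𝓘(ℝ, F) 𝓘(ℝ, F) (fun h : G => g * h) 1 ξ) : E) = 0 := by
      refine h4.symm.trans ?_
      change (mfderiv 𝓘(ℝ, E) 𝓘(ℝ, E) (fun q : P => g • q) ((1 : G) • p)
        (mfderiv 𝓘(ℝ, F) 𝓘(ℝ, E) (fun h : G => h • p) 1 ξ) : E) = 0
      rw [h5]
      exact map_zero _
    have h7 : ∀ g', g' = g → (mfderiv 𝓘(ℝ, F) 𝓘(ℝ, E) (fun h : G => h • p) g'
        (mfderiv 𝓘(ℝ, F) 𝓘(ℝ, F) (fun h : G => g * h) 1 ξ : F) : E) =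
        (mfderiv 𝓘(ℝ, F) 𝓘(ℝ, E) (fun h : G => h • p) g
        (mfderiv 𝓘(ℝ, F) 𝓘(ℝ, F) (fun h : G => g * h) 1 ξ : F) : E) := by rintro g' rfl; rfl
    exact (h7 _ (mul_one g)).symm.trans h6
  -- Both `c t • p` and the constant `p` are integral curves of the zero field, so they agree near
  -- `0`. Freeness makes `c` constant, and its velocity `ξ` vanishes.
  have hint : IsMIntegralCurveAt (I := 𝓘(ℝ, E)) (fun t => c t • p)
      (fun q : P => (0 : TangentSpace 𝓘(ℝ, E) q)) 0 := by
    filter_upwards [hc] with t ht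
    have hO : MDifferentiableAt 𝓘(ℝ, F) 𝓘(ℝ, E) (fun h : G => h • p) (c t) :=
      (contMDiff_orbitMap E F p).mdifferentiableAt (by simp)
    have h1 := hO.hasMFDerivAt.comp t ht
    refine h1.congr_mfderiv (ContinuousLinearMap.ext fun (s : ℝ) => ?_)
    change mfderiv 𝓘(ℝ, F) 𝓘(ℝ, E) (fun h : G => h • p) (c t) (s • v (c t)) = s • (0 : E)
    rw [map_smul, hker]
    rfl
  have hint' : IsMIntegralCurveAt (I := 𝓘(ℝ, E)) (fun _ : ℝ => p)
      (fun q : P => (0 : TangentSpace 𝓘(ℝ, E) q)) 0 := by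
    refine Eventually.of_forall fun t => ?_
    refine (hasMFDerivAt_const (I := 𝓘(ℝ, ℝ)) (I' := 𝓘(ℝ, E)) p t).congr_mfderiv
      (ContinuousLinearMap.ext fun (s : ℝ) => ?_)
    exact (smul_zero (A := E) s).symm
  have hzero : ContMDiffAt 𝓘(ℝ, E) (𝓘(ℝ, E)).tangent 1
      (fun q : P => (⟨q, 0⟩ : TangentBundle 𝓘(ℝ, E) P)) (c 0 • p) :=
    (Bundle.contMDiff_zeroSection ℝ (TangentSpace 𝓘(ℝ, E) : P → Type _)).contMDiffAt
  have heq := isMIntegralCurveAt_eventuallyEq_of_contMDiffAt_boundaryless hzero hint hint'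
    (by simp [hc0])
  have hc1 : c =ᶠ[𝓝 0] fun _ => 1 := heq.mono fun t ht => hfree _ _ ht
  have h8 := hc.hasMFDerivAt.mfderiv
  rw [hc1.mfderiv_eq, mfderiv_const] at h8
  have h9 : v (c 0) = 0 := by
    have h : (0 : F) = (1 : ℝ) • (v (c 0) : F) := congrArg (fun T : ℝ →L[ℝ] F => T 1) h8
    rw [one_smul] at h
    exact h.symm
  have h10 : v 1 = 0 := by rw [← hc0]; exact h9
  have h11 : v 1 = ξ := by
    have h12 : (fun x : G => 1 * x) = id := funext one_mul
    change (mfderiv 𝓘(ℝ, F) 𝓘(ℝ, F) (fun x : G => 1 * x) 1 ξ : F) = ξ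
    rw [h12, mfderiv_id]
    rfl
  rw [← h11, h10]

section Tube

variable {V : Type*} [NormedAddCommGroup V] [NormedSpace ℝ V] [FiniteDimensional ℝ V]
  {S : Type*} [TopologicalSpace S] [ChartedSpace V S] [IsManifold 𝓘(ℝ, V) ∞ S] {ι : S → P}

theorem contMDiffAt_tube {z : G × S} (hι : ContMDiffAt 𝓘(ℝ, V) 𝓘(ℝ, E) ∞ ι z.2) :
    ContMDiffAt (𝓘(ℝ, F).prod 𝓘(ℝ, V)) 𝓘(ℝ, E) ∞ (fun z : G × S => z.1 • ι z.2) z :=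
  ((contMDiff_smul (I := 𝓘(ℝ, F)) (I' := 𝓘(ℝ, E))).contMDiffAt (x := (z.1, ι z.2))).comp z
    (contMDiffAt_fst.prodMk (hι.comp z contMDiffAt_snd))

/-- The two partial derivatives at `(1, x)`: the orbit map in the group variable and, since `1` acts
trivially, `ι` itself in the other. -/
theorem mfderiv_tube_one {x : S} (hι : ContMDiffAt 𝓘(ℝ, V) 𝓘(ℝ, E) ∞ ι x)
    (v : TangentSpace (𝓘(ℝ, F).prod 𝓘(ℝ, V)) ((1, x) : G × S)) :
    (mfderiv (𝓘(ℝ, F).prod 𝓘(ℝ, V)) 𝓘(ℝ, E) (fun z : G × S => z.1 • ι z.2) (1, x) v : E) =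
      (infinitesimalAction (E := E) F G (ι x) v.1 : E) + (mfderiv 𝓘(ℝ, V) 𝓘(ℝ, E) ι x v.2 : E) := by
  rw [mfderiv_prod_eq_add_apply
    ((contMDiffAt_tube (F := F) (G := G) (z := (1, x)) hι).mdifferentiableAt (by simp))]
  have key : ∀ f : S → P, f = ι →
      (mfderiv 𝓘(ℝ, V) 𝓘(ℝ, E) f x v.2 : E) = (mfderiv 𝓘(ℝ, V) 𝓘(ℝ, E) ι x v.2 : E) := by
    rintro _ rfl; rfl
  have h1 := key (fun z : S => (1 : G) • ι z) (funext fun z => one_smul G _)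
  exact congrArg (fun e : E => HAdd.hAdd (α := E) (infinitesimalAction (E := E) F G (ι x) v.1) e) h1

/-- The tube map is equivariant, so its germ at `(g, x)` is its germ at `(1, x)` conjugated by the
translations by `g`. -/
theorem isLocalDiffeomorphAt_tube_of_one {x : S}
    (h : IsLocalDiffeomorphAt (𝓘(ℝ, F).prod 𝓘(ℝ, V)) 𝓘(ℝ, E) ∞
      (fun z : G × S => z.1 • ι z.2) (1, x)) (g : G) :
    IsLocalDiffeomorphAt (𝓘(ℝ, F).prod 𝓘(ℝ, V)) 𝓘(ℝ, E) ∞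
      (fun z : G × S => z.1 • ι z.2) (g, x) := by
  have hL : IsLocalDiffeomorph 𝓘(ℝ, E) 𝓘(ℝ, E) ∞ (fun p : P => g • p) :=
    (Diffeomorph.smul 𝓘(ℝ, F) 𝓘(ℝ, E) ∞ g).isLocalDiffeomorph
  have hR : IsLocalDiffeomorph (𝓘(ℝ, F).prod 𝓘(ℝ, V)) (𝓘(ℝ, F).prod 𝓘(ℝ, V)) ∞
      (fun z : G × S => (g⁻¹ * z.1, z.2)) :=
    ((Diffeomorph.smul (M := G) 𝓘(ℝ, F) 𝓘(ℝ, F) ∞ g⁻¹).prodCongr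
      (Diffeomorph.refl 𝓘(ℝ, V) S ∞)).isLocalDiffeomorph
  have h1 : IsLocalDiffeomorphAt (𝓘(ℝ, F).prod 𝓘(ℝ, V)) 𝓘(ℝ, E) ∞
      (fun z : G × S => z.1 • ι z.2) (g⁻¹ * g, x) := by rwa [inv_mul_cancel]
  have h2 := IsLocalDiffeomorphAt.comp (hf := hR (g, x)) (hg := h1)
  have h3 := IsLocalDiffeomorphAt.comp (hf := h2) (hg := hL _)
  refine isLocalDiffeomorphAt_congr h3 (Eventually.of_forall fun z => ?_)
  simp [smul_smul]

theorem injective_tube (hfree : ∀ (g : G) (p : P), g • p = p → g = 1)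
    (hinj : ∀ (x x' : S) (g : G), g • ι x = ι x' → x = x') :
    Injective (fun z : G × S => z.1 • ι z.2) := by
  rintro ⟨g, x⟩ ⟨g', x'⟩ h
  have h : g • ι x = g' • ι x' := h
  have h1 : (g'⁻¹ * g) • ι x = ι x' := by rw [mul_smul, h, inv_smul_smul]
  obtain rfl := hinj _ _ _ h1
  have h2 := hfree _ _ h1
  rw [inv_mul_eq_one] at h2
  rw [h2]

/-- If `ι` is transversal to the orbits and meets each orbit at most once, then `(g, x) ↦ g • ι x`
is a local diffeomorphism. -/
theorem isLocalDiffeomorph_tube (hfree : ∀ (g : G) (p : P), g • p = p → g = 1)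
    (hι : ContMDiff 𝓘(ℝ, V) 𝓘(ℝ, E) ∞ ι)
    (ht : ∀ x, LinearMap.range (mfderiv 𝓘(ℝ, V) 𝓘(ℝ, E) ι x).toLinearMap ⊔
      orbitTangent (E := E) F G (ι x) = ⊤)
    (hinj : ∀ (x x' : S) (g : G), g • ι x = ι x' → x = x') :
    IsLocalDiffeomorph (𝓘(ℝ, F).prod 𝓘(ℝ, V)) 𝓘(ℝ, E) ∞ (fun z : G × S => z.1 • ι z.2) := by
  rintro ⟨g, x⟩
  refine isLocalDiffeomorphAt_tube_of_one ?_ g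
  -- Transversality gives surjectivity of the derivative. Its injectivity comes from the global
  -- injectivity of the tube map, so no dimension count is needed.
  refine isLocalDiffeomorphAt_of_injOn_of_surjective_mfderiv
    (Eventually.of_forall fun z => contMDiffAt_tube (hι _)) ?_ univ_mem
    (injective_tube hfree hinj).injOn
  intro w
  have hw : ∀ w : TangentSpace 𝓘(ℝ, E) (ι x),
      w ∈ (LinearMap.range (mfderiv 𝓘(ℝ, V) 𝓘(ℝ, E) ι x).toLinearMap ⊔
        orbitTangent (E := E) F G (ι x)) := by rw [ht x]; exact fun _ => trivial
  obtain ⟨a, ⟨v, rfl⟩, b, ⟨ξ, rfl⟩, hab⟩ := Submodule.mem_sup.1 (hw w)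
  exact ⟨(ξ, v), (mfderiv_tube_one (hι x) _).trans ((add_comm (G := E) _ _).trans hab)⟩

end Tube

section Slice

variable (F G) in
/-- A map from an open set of parameters to `P` that is transversal to the orbits and meets each
orbit at most once. -/
structure IsSliceMap {V : Type*} [NormedAddCommGroup V] [NormedSpace ℝ V] (f : V → P)
    (O : TopologicalSpace.Opens V) : Prop where
  contMDiffAt : ∀ v ∈ O, ContMDiffAt 𝓘(ℝ, V) 𝓘(ℝ, E) ∞ f v
  transversal : ∀ v ∈ O, LinearMap.range (mfderiv 𝓘(ℝ, V) 𝓘(ℝ, E) f v).toLinearMap ⊔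
    orbitTangent (E := E) F G (f v) = ⊤
  injOn : ∀ v ∈ O, ∀ v' ∈ O, ∀ g : G, g • f v = f v' → v = v'

theorem IsSliceMap.mono {V : Type*} [NormedAddCommGroup V] [NormedSpace ℝ V] {f : V → P}
    {O O' : TopologicalSpace.Opens V} (h : IsSliceMap (E := E) F G f O) (hO : O' ≤ O) :
    IsSliceMap (E := E) F G f O' :=
  ⟨fun v hv => h.contMDiffAt v (hO hv), fun v hv => h.transversal v (hO hv),
    fun v hv v' hv' => h.injOn v (hO hv) v' (hO hv')⟩

variable {V : Type*} [NormedAddCommGroup V] [NormedSpace ℝ V] [FiniteDimensional ℝ V]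
  [T2Space P] [CompactSpace G]

/-- A map transversal to the orbits at a point gives a slice near that point. -/
theorem exists_slice (hfree : ∀ (g : G) (p : P), g • p = p → g = 1) {f : V → P}
    (hf : ∀ᶠ v in 𝓝 0, ContMDiffAt 𝓘(ℝ, V) 𝓘(ℝ, E) ∞ f v)
    (hi : Injective (mfderiv 𝓘(ℝ, V) 𝓘(ℝ, E) f 0))
    (hc : IsCompl (LinearMap.range (mfderiv 𝓘(ℝ, V) 𝓘(ℝ, E) f 0).toLinearMap)
      (orbitTangent (E := E) F G (f 0))) :
    ∃ O : TopologicalSpace.Opens V, (0 : V) ∈ O ∧ IsSliceMap (E := E) F G f O := by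
  have hcs : ContinuousSMul G P :=
    ContMDiffSMul.continuousSMul (I := 𝓘(ℝ, F)) (I' := 𝓘(ℝ, E)) ∞
  have hb : Bijective (mfderiv (𝓘(ℝ, F).prod 𝓘(ℝ, V)) 𝓘(ℝ, E)
      (fun z : G × V => z.1 • f z.2) (1, 0)) := by
    constructor
    · refine (injective_iff_map_eq_zero _).2 ?_
      rintro ⟨ξ, v⟩ h
      have h1 := (mfderiv_tube_one (F := F) (G := G) hf.self_of_nhds (ξ, v)).symm.trans h
      have h2 : (mfderiv 𝓘(ℝ, V) 𝓘(ℝ, E) f 0 v : E) =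
          -(infinitesimalAction (E := E) F G (f 0) ξ : E) := by
        rw [eq_neg_iff_add_eq_zero, add_comm]; exact h1
      have h3 : (mfderiv 𝓘(ℝ, V) 𝓘(ℝ, E) f 0 v) ∈ orbitTangent (E := E) F G (f 0) := by
        have : (mfderiv 𝓘(ℝ, V) 𝓘(ℝ, E) f 0 v) = -(infinitesimalAction (E := E) F G (f 0) ξ) := h2
        rw [this]
        exact Submodule.neg_mem _ (LinearMap.mem_range_self _ ξ)
      have h4 := Submodule.disjoint_def.1 hc.disjoint _ (LinearMap.mem_range_self _ v) h3
      have h5 : v = 0 := hi (h4.trans (map_zero _).symm)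
      have h6 : infinitesimalAction (E := E) F G (f 0) ξ = 0 := by
        have h7 : -(infinitesimalAction (E := E) F G (f 0) ξ : E) = 0 := h2.symm.trans h4
        exact neg_eq_zero.1 h7
      have h8 : ξ = 0 := injective_infinitesimalAction hfree (f 0) (h6.trans (map_zero _).symm)
      rw [h5, h8]; rfl
    · intro w
      have hw : ∀ w : TangentSpace 𝓘(ℝ, E) (f 0),
          w ∈ (LinearMap.range (mfderiv 𝓘(ℝ, V) 𝓘(ℝ, E) f 0).toLinearMap ⊔
            orbitTangent (E := E) F G (f 0)) := by rw [hc.sup_eq_top]; exact fun _ => trivial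
      obtain ⟨a, ⟨v, rfl⟩, b, ⟨ξ, rfl⟩, hab⟩ := Submodule.mem_sup.1 (hw w)
      exact ⟨(ξ, v), (mfderiv_tube_one hf.self_of_nhds _).trans
        ((add_comm (G := E) _ _).trans hab)⟩
  have hΘ : ∀ᶠ z in 𝓝 ((1, 0) : G × V), ContMDiffAt (𝓘(ℝ, F).prod 𝓘(ℝ, V)) 𝓘(ℝ, E) ∞
      (fun z : G × V => z.1 • f z.2) z := by
    filter_upwards [continuousAt_snd.eventually hf] with z hz
    exact contMDiffAt_tube hz
  obtain ⟨Φ, hΦ0, hΦ⟩ := isLocalDiffeomorphAt_of_bijective_mfderiv hΘ hb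
  obtain ⟨A, B, hA, hB, hA1, hB0, hAB⟩ := isOpen_prod_iff.1 Φ.open_source 1 0 hΦ0
  have hK : IsCompact Aᶜ := hA.isClosed_compl.isCompact
  -- Elements outside `A` move `f 0` off itself by freeness. As `Aᶜ` is compact and `P` is
  -- Hausdorff, one neighbourhood of `(0, 0)` works for all of them.
  have hsep : ∀ᶠ z in 𝓝 ((0, 0) : V × V), ∀ g ∈ Aᶜ, g • f z.1 ≠ f z.2 := by
    refine hK.eventually_forall_of_forall_eventually fun g hg => ?_
    have hne : g • f 0 ≠ f 0 := fun h => hg (hfree g _ h ▸ hA1)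
    have hfc : ContinuousAt f 0 := hf.self_of_nhds.continuousAt
    have h1 : Tendsto (fun z : (V × V) × G => z.2 • f z.1.1) (𝓝 ((0, 0), g)) (𝓝 (g • f 0)) := by
      have h2 : Tendsto (fun z : (V × V) × G => f z.1.1) (𝓝 ((0, 0), g)) (𝓝 (f 0)) :=
        hfc.tendsto.comp ((continuous_fst.comp continuous_fst).tendsto' ((0, 0), g) 0 rfl)
      exact (continuous_snd.tendsto ((0, 0), g)).smul h2
    have h2 : Tendsto (fun z : (V × V) × G => f z.1.2) (𝓝 ((0, 0), g)) (𝓝 (f 0)) :=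
      hfc.tendsto.comp ((continuous_snd.comp continuous_fst).tendsto' ((0, 0), g) 0 rfl)
    exact (h1.prodMk_nhds h2).eventually (isClosed_diagonal.isOpen_compl.mem_nhds (x := (g • f 0, f 0)) hne)
  have hsep' : {z : V × V | ∀ g ∈ Aᶜ, g • f z.1 ≠ f z.2} ∈ 𝓝 (0 : V) ×ˢ 𝓝 (0 : V) := by
    rw [← nhds_prod_eq]; exact hsep
  obtain ⟨C, hC, hC'⟩ := mem_prod_self_iff.1 hsep'
  obtain ⟨D, hDs, hDo, hD0⟩ := eventually_nhds_iff.1 (hf.and hC)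
  refine ⟨⟨B ∩ D, hB.inter hDo⟩, ⟨hB0, hD0⟩, fun v hv => (hDs v hv.2).1, ?_, ?_⟩
  · rintro v ⟨hvB, hvD⟩
    have hfv := (hDs v hvD).1
    refine eq_top_iff.2 fun w _ => ?_
    -- The tube map is still a local diffeomorphism at `(1, v)`, and surjectivity of its derivative
    -- there is transversality at `f v`.
    have hld : IsLocalDiffeomorphAt (𝓘(ℝ, F).prod 𝓘(ℝ, V)) 𝓘(ℝ, E) ∞
        (fun z : G × V => z.1 • f z.2) (1, v) := ⟨Φ, hAB ⟨hA1, hvB⟩, hΦ⟩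
    obtain ⟨⟨ξ, u⟩, hu⟩ := (hld.mfderivToContinuousLinearEquiv (by simp)).surjective
      (w : E)
    have h1 := (mfderiv_tube_one (F := F) (G := G) hfv (ξ, u)).symm.trans hu
    refine Submodule.mem_sup.2 ⟨_, LinearMap.mem_range_self _ u, _, LinearMap.mem_range_self _ ξ, ?_⟩
    exact (add_comm (G := E) _ _).trans h1
  · rintro v ⟨hvB, hvD⟩ v' ⟨hvB', hvD'⟩ g hg
    -- For `g` near `1` the injectivity of `Φ` on `A × B` applies; for the remaining `g` the
    -- separation `hsep` excludes the equation.
    by_cases hgA : g ∈ A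
    · have h1 : Φ (g, v) = Φ (1, v') := by
        rw [← hΦ (hAB ⟨hgA, hvB⟩), ← hΦ (hAB ⟨hA1, hvB'⟩)]
        simpa using hg
      have h2 := Φ.injOn (hAB ⟨hgA, hvB⟩) (hAB ⟨hA1, hvB'⟩) h1
      exact (Prod.ext_iff.1 h2).2
    · exact absurd hg (hC' (show (v, v') ∈ C ×ˢ C from ⟨(hDs v hvD).2, (hDs v' hvD').2⟩) g hgA)

end Slice

end Action

/-! ### Images of slice maps are local sections. -/

section Opens

variable {V : Type*} [NormedAddCommGroup V] [NormedSpace ℝ V]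
  {M : Type*} [TopologicalSpace M] [ChartedSpace V M] [IsManifold 𝓘(ℝ, V) ∞ M]

theorem isLocalDiffeomorph_subtype_val (O : TopologicalSpace.Opens M) :
    IsLocalDiffeomorph 𝓘(ℝ, V) 𝓘(ℝ, V) ∞ (Subtype.val : O → M) := by
  intro x
  have : Nonempty O := ⟨x⟩
  let e := O.openPartialHomeomorphSubtypeCoe this
  refine ⟨⟨e.toPartialEquiv, e.open_source, e.open_target, contMDiff_subtype_val.contMDiffOn, ?_⟩,
    by simp [e], fun _ _ => by simp [e]⟩
  intro y hy
  refine ContMDiffAt.contMDiffWithinAt ?_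
  have hc : ContinuousAt e.symm y := e.symm.continuousAt hy
  refine (ContMDiffAt.iff_comp_isImmersionAt ((Manifold.IsImmersion.of_opens O).isImmersionAt _)).2
    ⟨hc, ?_⟩
  refine contMDiffAt_id.congr_of_eventuallyEq ?_
  filter_upwards [e.open_target.mem_nhds hy] with z hz
  exact e.right_inv hz

theorem isLocalDiffeomorphAt_of_mem_maximalAtlas {e : OpenPartialHomeomorph M V}
    (he : e ∈ IsManifold.maximalAtlas 𝓘(ℝ, V) ∞ M) {x : M} (hx : x ∈ e.source) :
    IsLocalDiffeomorphAt 𝓘(ℝ, V) 𝓘(ℝ, V) ∞ e x :=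
  ⟨⟨e.toPartialEquiv, e.open_source, e.open_target, contMDiffOn_of_mem_maximalAtlas he,
    contMDiffOn_symm_of_mem_maximalAtlas he⟩, hx, fun _ _ => rfl⟩

end Opens

/-- A chain rule with `k` given by pointwise equality and the values compared in the model space.
The tangent spaces at `k x` and `h (f x)` need not agree definitionally. -/
theorem mfderiv_comp_isLocalDiffeomorphAt
    {V M W N Z Q : Type*} [NormedAddCommGroup V] [NormedSpace ℝ V] [TopologicalSpace M]
    [ChartedSpace V M] [NormedAddCommGroup W] [NormedSpace ℝ W] [TopologicalSpace N]
    [ChartedSpace W N] [NormedAddCommGroup Z] [NormedSpace ℝ Z] [TopologicalSpace Q]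
    [ChartedSpace Z Q] {f : M → N} {h : N → Q} {k : M → Q} {x : M}
    (hk : ∀ x, k x = h (f x))
    (hf : IsLocalDiffeomorphAt 𝓘(ℝ, V) 𝓘(ℝ, W) ∞ f x)
    (hh : ContMDiffAt 𝓘(ℝ, W) 𝓘(ℝ, Z) ∞ h (f x)) :
    (∀ v, (mfderiv 𝓘(ℝ, V) 𝓘(ℝ, Z) k x v : Z) =
      mfderiv 𝓘(ℝ, W) 𝓘(ℝ, Z) h (f x) (mfderiv 𝓘(ℝ, V) 𝓘(ℝ, W) f x v)) := by
  intro v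
  obtain rfl : k = h ∘ f := funext hk
  rw [mfderiv_comp x (hh.mdifferentiableAt (by simp)) (hf.mdifferentiableAt (by simp))]
  rfl

section Action

variable {E : Type*} [NormedAddCommGroup E] [NormedSpace ℝ E] [FiniteDimensional ℝ E]
  {P : Type*} [TopologicalSpace P] [ChartedSpace E P] [IsManifold 𝓘(ℝ, E) ∞ P]
  {F : Type*} [NormedAddCommGroup F] [NormedSpace ℝ F] [FiniteDimensional ℝ F]
  {G : Type*} [TopologicalSpace G] [ChartedSpace F G] [Group G] [LieGroup 𝓘(ℝ, F) ∞ G]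
  [MulAction G P] [ContMDiffSMul 𝓘(ℝ, F) 𝓘(ℝ, E) ∞ G P]

/-- Reparametrising by a local diffeomorphism does not change the range of the derivative, so
transversality is preserved. -/
theorem sup_orbitTangent_eq_top_of_comp_isLocalDiffeomorphAt
    {V M W N : Type*} [NormedAddCommGroup V] [NormedSpace ℝ V] [TopologicalSpace M]
    [ChartedSpace V M] [NormedAddCommGroup W] [NormedSpace ℝ W] [TopologicalSpace N]
    [ChartedSpace W N] {f : M → N} {h : N → P} {k : M → P} {x : M}
    (hk : ∀ x, k x = h (f x))
    (hf : IsLocalDiffeomorphAt 𝓘(ℝ, V) 𝓘(ℝ, W) ∞ f x)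
    (hh : ContMDiffAt 𝓘(ℝ, W) 𝓘(ℝ, E) ∞ h (f x))
    (ht : LinearMap.range (mfderiv 𝓘(ℝ, W) 𝓘(ℝ, E) h (f x)).toLinearMap ⊔
      orbitTangent (E := E) F G (h (f x)) = ⊤) :
    LinearMap.range (mfderiv 𝓘(ℝ, V) 𝓘(ℝ, E) k x).toLinearMap ⊔
      orbitTangent (E := E) F G (k x) = ⊤ := by
  have key : ∀ q : P, q = k x → ∀ ξ : F, (infinitesimalAction (E := E) F G q ξ : E) =
      infinitesimalAction (E := E) F G (k x) ξ := by rintro _ rfl _; rfl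
  refine eq_top_iff.2 fun w _ => ?_
  have hw : ∀ w : TangentSpace 𝓘(ℝ, E) (h (f x)),
      w ∈ (LinearMap.range (mfderiv 𝓘(ℝ, W) 𝓘(ℝ, E) h (f x)).toLinearMap ⊔
        orbitTangent (E := E) F G (h (f x))) := by rw [ht]; exact fun _ => trivial
  obtain ⟨a, ⟨v, rfl⟩, b, ⟨ξ, rfl⟩, hab⟩ := Submodule.mem_sup.1 (hw w)
  obtain ⟨u, rfl⟩ := (hf.mfderivToContinuousLinearEquiv (by simp)).surjective v
  refine Submodule.mem_sup.2 ⟨_, LinearMap.mem_range_self _ u, _, LinearMap.mem_range_self _ ξ, ?_⟩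
  refine Eq.trans ?_ hab
  exact congrArg₂ (HAdd.hAdd (α := E) (β := E)) (mfderiv_comp_isLocalDiffeomorphAt hk hf hh u) (key _ (hk x).symm ξ).symm

/-- `S` is covered by one chart `e`, in which the inclusion reads as `f`. All four conditions are
transported from `f` along the local diffeomorphism `e`. -/
theorem isLocalSection_of_chart {S : Set P} (s : SmoothStructure S)
    {e : OpenPartialHomeomorph S (EuclideanSpace ℝ (Fin s.dim))} (he : e ∈ s.charts)
    (hsrc : e.source = univ) {f : EuclideanSpace ℝ (Fin s.dim) → P} (hfe : ∀ x : S, (x : P) = f (e x))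
    (hf : ∀ v ∈ e.target, ContMDiffAt (𝓡 s.dim) 𝓘(ℝ, E) ∞ f v)
    (hi : ∀ v ∈ e.target, Injective (mfderiv (𝓡 s.dim) 𝓘(ℝ, E) f v))
    (ht : ∀ v ∈ e.target, LinearMap.range (mfderiv (𝓡 s.dim) 𝓘(ℝ, E) f v).toLinearMap ⊔
        orbitTangent (E := E) F G (f v) = ⊤)
    (hinj : ∀ v ∈ e.target, ∀ v' ∈ e.target, ∀ g : G, g • f v = f v' → v = v')
    (hdim : s.dim + Module.finrank ℝ F = Module.finrank ℝ E)
    (θ : TopologicalSpace.Opens (OrbitSpace P G)) (hθ : orbitProj G '' S = θ) :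
    IsLocalSection E F G θ S s := by
  let _ := s.chartedSpace
  have hm := s.isManifold
  have he' : e ∈ IsManifold.maximalAtlas (𝓡 s.dim) ∞ S := by
    rw [s.maximalAtlas_eq]; exact he
  have hx : ∀ x : S, x ∈ e.source := fun x => hsrc ▸ mem_univ x
  have hxt : ∀ x : S, e x ∈ e.target := fun x => e.map_source (hx x)
  have hld : ∀ x : S, IsLocalDiffeomorphAt (𝓡 s.dim) (𝓡 s.dim) ∞ e x := fun x =>
    isLocalDiffeomorphAt_of_mem_maximalAtlas he' (hx x)
  have hval : (Subtype.val : S → P) = f ∘ e := funext hfe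
  have hsm : ContMDiff (𝓡 s.dim) 𝓘(ℝ, E) ∞ (Subtype.val : S → P) := by
    rw [hval]
    exact fun x => (hf _ (hxt x)).comp x (hld x).contMDiffAt
  have hmf := fun x : S => mfderiv_comp_isLocalDiffeomorphAt hfe (hld x) (hf _ (hxt x))
  have hbij : ∀ x : S, Bijective (mfderiv (𝓡 s.dim) (𝓡 s.dim) e x) := fun x =>
    ((hld x).mfderivToContinuousLinearEquiv (by simp)).bijective
  refine ⟨⟨?_, Topology.IsEmbedding.subtypeVal⟩, ?_, ?_, hθ⟩
  -- By `hdim` the codimension of `S` is the dimension of the group, so the model space `F` serves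
  -- as complement.
  · refine Manifold.IsImmersionOfComplement.isImmersion (F := F) fun x => ?_
    refine isImmersionAtOfComplement_of_injective_mfderiv (Eventually.of_forall fun y => hsm y) ?_ ?_
    · intro v w hvw
      refine (hbij x).1 (hi _ (hxt x) ?_)
      exact (hmf x v).symm.trans (hvw.trans (hmf x w))
    · simpa using hdim
  · intro x
    exact sup_orbitTangent_eq_top_of_comp_isLocalDiffeomorphAt hfe (hld x) (hf _ (hxt x)) (ht _ (hxt x))
  · intro x hxS
    refine Subset.antisymm ?_ (singleton_subset_iff.2 ⟨MulAction.mem_orbit_self x, hxS⟩)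
    rintro y ⟨⟨g, rfl⟩, hy⟩
    have h1 := hinj _ (hxt ⟨x, hxS⟩) _ (hxt ⟨g • x, hy⟩) g (by rw [← hfe, ← hfe])
    have h2 := e.injOn (hx _) (hx _) h1
    exact (congrArg Subtype.val h2).symm

/-- The set in the hypothesis is the saturation of `S`, which is the preimage of its image under the
quotient map. -/
theorem isOpen_image_orbitProj {S : Set P} (h : IsOpen {q : P | ∃ g : G, ∃ x ∈ S, g • x = q}) :
    IsOpen (orbitProj G '' S) := by
  have h1 : orbitProj G ⁻¹' (orbitProj G '' S) = {q : P | ∃ g : G, ∃ x ∈ S, g • x = q} := by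
    ext q
    constructor
    · rintro ⟨x, hx, h⟩
      obtain ⟨g, hg⟩ := MulAction.orbitRel_apply.1 (Quotient.exact h.symm)
      exact ⟨g, x, hx, hg⟩
    · rintro ⟨g, x, hx, rfl⟩
      exact ⟨x, hx, (Quotient.sound (MulAction.orbitRel_apply.2 ⟨g, rfl⟩)).symm⟩
  rw [← h1] at h
  exact (isQuotientMap_quotient_mk' (s := MulAction.orbitRel G P)).isOpen_preimage.1 h

section SliceMap

variable {V : Type*} [NormedAddCommGroup V] [NormedSpace ℝ V] [FiniteDimensional ℝ V]
  {f : V → P} {O : TopologicalSpace.Opens V}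

namespace IsSliceMap

theorem isLocalDiffeomorph_tube (h : IsSliceMap (E := E) F G f O)
    (hfree : ∀ (g : G) (p : P), g • p = p → g = 1) :
    IsLocalDiffeomorph (𝓘(ℝ, F).prod 𝓘(ℝ, V)) 𝓘(ℝ, E) ∞ (fun z : G × O => z.1 • f z.2) := by
  have hval := fun x : O => isLocalDiffeomorph_subtype_val (V := V) O x
  let ι : O → P := fun x => f x
  have hι : ContMDiff 𝓘(ℝ, V) 𝓘(ℝ, E) ∞ ι := fun x =>
    (h.contMDiffAt x x.2).comp x (hval x).contMDiffAt
  have hιt : ∀ x : O, LinearMap.range (mfderiv 𝓘(ℝ, V) 𝓘(ℝ, E) ι x).toLinearMap ⊔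
      orbitTangent (E := E) F G (ι x) = ⊤ := fun x =>
    sup_orbitTangent_eq_top_of_comp_isLocalDiffeomorphAt (k := ι) (f := (Subtype.val : O → _))
      (h := f) (fun _ => rfl) (hval x) (h.contMDiffAt x x.2) (h.transversal x x.2)
  exact SliceTheorem.isLocalDiffeomorph_tube hfree hι hιt
    fun x x' g hg => Subtype.ext (h.injOn x x.2 x' x'.2 g hg)

theorem injective_tube (h : IsSliceMap (E := E) F G f O)
    (hfree : ∀ (g : G) (p : P), g • p = p → g = 1) :
    Injective (fun z : G × O => z.1 • f z.2) :=
  SliceTheorem.injective_tube (ι := fun x : O => f x) hfree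
    fun x x' g hg => Subtype.ext (h.injOn x x.2 x' x'.2 g hg)

theorem isOpenEmbedding_tube (h : IsSliceMap (E := E) F G f O)
    (hfree : ∀ (g : G) (p : P), g • p = p → g = 1) :
    Topology.IsOpenEmbedding (fun z : G × O => z.1 • f z.2) :=
  (h.isLocalDiffeomorph_tube hfree).isLocalHomeomorph.isOpenEmbedding_of_injective
    (h.injective_tube hfree)

/-- A dimension count: the orbit direction contributes at most `finrank F` to a sum of ranges that
fills `E`, so the derivative of `f` must have full rank `finrank V`. -/
theorem injective_mfderiv (h : IsSliceMap (E := E) F G f O)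
    (hd : Module.finrank ℝ V + Module.finrank ℝ F = Module.finrank ℝ E) {v : V} (hv : v ∈ O) :
    Injective (mfderiv 𝓘(ℝ, V) 𝓘(ℝ, E) f v) := by
  let A : V →ₗ[ℝ] E := (mfderiv 𝓘(ℝ, V) 𝓘(ℝ, E) f v).toLinearMap
  let B : F →ₗ[ℝ] E := (infinitesimalAction (E := E) F G (f v)).toLinearMap
  have hAB : LinearMap.range A ⊔ LinearMap.range B = ⊤ := h.transversal v hv
  have h1 := Submodule.finrank_add_le_finrank_add_finrank (LinearMap.range A) (LinearMap.range B)
  rw [hAB, finrank_top] at h1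
  have h2 := B.finrank_range_le
  have h3 := A.finrank_range_add_finrank_ker
  have h4 : Module.finrank ℝ (LinearMap.ker A) = 0 := by omega
  have h5 : LinearMap.ker A = ⊥ := Submodule.finrank_eq_zero.1 h4
  exact LinearMap.ker_eq_bot.1 h5

/-- Openness holds because the saturation of the image of `U` is the tube image of `G × U`, and the
tube map is open. -/
theorem isOpenEmbedding_orbitProj (h : IsSliceMap (E := E) F G f O)
    (hfree : ∀ (g : G) (p : P), g • p = p → g = 1) :
    Topology.IsOpenEmbedding (fun x : O => orbitProj G (f x)) := by
  have hf : Continuous fun x : O => f x := continuous_iff_continuousAt.2 fun x =>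
    (h.contMDiffAt x x.2).continuousAt.comp continuous_subtype_val.continuousAt
  refine .of_continuous_injective_isOpenMap ((continuous_orbitProj G).comp hf) ?_ ?_
  · intro x x' hx
    obtain ⟨g, hg⟩ := MulAction.orbitRel_apply.1 (Quotient.exact hx.symm)
    exact Subtype.ext (h.injOn x x.2 x' x'.2 g hg)
  · intro U hU
    have h1 : (fun x : O => orbitProj G (f x)) '' U = orbitProj G '' ((fun x : O => f x) '' U) :=
      (image_image _ _ _).symm
    rw [h1]
    refine isOpen_image_orbitProj ?_
    convert (h.isOpenEmbedding_tube hfree).isOpenMap _ (isOpen_univ.prod hU) using 1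
    ext q
    constructor
    · rintro ⟨g, _, ⟨x, hx, rfl⟩, rfl⟩
      exact ⟨(g, x), ⟨trivial, hx⟩, rfl⟩
    · rintro ⟨⟨g, x⟩, ⟨-, hx⟩, rfl⟩
      exact ⟨g, _, ⟨x, hx, rfl⟩, rfl⟩

end IsSliceMap

end SliceMap

/-- The image of a slice map is a local section. -/
theorem IsSliceMap.exists_isLocalSection_image (hfree : ∀ (g : G) (p : P), g • p = p → g = 1)
    {d : ℕ} (hd : d + Module.finrank ℝ F = Module.finrank ℝ E) {f : EuclideanSpace ℝ (Fin d) → P}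
    {O : TopologicalSpace.Opens (EuclideanSpace ℝ (Fin d))} (hs : IsSliceMap (E := E) F G f O)
    (hne : Nonempty O) :
    ∃ (θ : TopologicalSpace.Opens (OrbitSpace P G)) (s : SmoothStructure (f '' O)),
      IsLocalSection E F G θ (f '' O) s := by
  let ι : O → P := fun x => f x
  have hemb : Topology.IsEmbedding ι := by
    -- The slice is the restriction of the open embedding given by the tube to `{1} × O`, hence an
    -- embedding.
    have : ι = (fun z : G × O => z.1 • ι z.2) ∘ fun x => (1, x) := by ext; simp
    rw [this]
    exact (hs.isOpenEmbedding_tube hfree).isEmbedding.comp (isEmbedding_prodMkRight 1)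
  have hrange : range ι = f '' O := by
    ext q
    exact ⟨fun ⟨x, hx⟩ => ⟨x, x.2, hx⟩, fun ⟨x, hx, h⟩ => ⟨⟨x, hx⟩, h⟩⟩
  let h : O ≃ₜ f '' O := hemb.toHomeomorph.trans (Homeomorph.setCongr hrange)
  have hh : ∀ x : O, (h x : P) = f x := fun x => rfl
  let e : OpenPartialHomeomorph (f '' O) (EuclideanSpace ℝ (Fin d)) :=
    h.symm.transOpenPartialHomeomorph (O.openPartialHomeomorphSubtypeCoe hne)
  have hsrc : e.source = univ := by simp [e]
  have htgt : e.target = O := by simp [e]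
  have hfe : ∀ x : f '' O, (x : P) = f (e x) := fun x => by
    have := hh (h.symm x)
    rw [h.apply_symm_apply] at this
    exact this
  let s : SmoothStructure (f '' O) := SmoothStructure.ofAtlas d {e}
    (fun x => ⟨e, rfl, hsrc ▸ mem_univ x⟩) (by
      rintro _ rfl _ rfl
      exact symm_trans_mem_contDiffGroupoid _)
  have hθ : IsOpen (orbitProj G '' (f '' O)) := by
    convert (hs.isOpenEmbedding_orbitProj hfree).isOpen_range using 1
    ext q
    constructor
    · rintro ⟨_, ⟨x, hx, rfl⟩, rfl⟩
      exact ⟨⟨x, hx⟩, rfl⟩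
    · rintro ⟨x, rfl⟩
      exact ⟨_, ⟨x, x.2, rfl⟩, rfl⟩
  refine ⟨⟨_, hθ⟩, s, isLocalSection_of_chart s (e := e) ?_ hsrc hfe ?_ ?_ ?_ ?_ hd _ rfl⟩
  · exact SmoothStructure.subset_charts_ofAtlas _ _ _ _ rfl
  all_goals rw [htgt]
  · exact hs.contMDiffAt
  · exact fun v hv => hs.injective_mfderiv (by simpa using hd) hv
  · exact hs.transversal
  · exact hs.injOn

end Action

/-! ### The Hausdorff property of the quotient and slices through every point. -/

section Quotient

variable {G P : Type*} [TopologicalSpace G] [Group G] [CompactSpace G] [T2Space G]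
  [TopologicalSpace P] [T2Space P] [MulAction G P]

/-- Keeping `g` in the target, `(g, x) ↦ (g, g • x, x)` has a continuous left inverse and is a
closed embedding. Forgetting the compact factor `G` is proper. -/
theorem properSMul_of_compactSpace [ContinuousSMul G P] : ProperSMul G P := by
  constructor
  have h1 : Continuous (fun z : G × P => (z.1, (z.1 • z.2, z.2))) := by fun_prop
  have h2 : LeftInverse (fun w : G × P × P => (w.1, w.2.2))
      (fun z : G × P => (z.1, (z.1 • z.2, z.2))) := fun _ => rfl
  have h3 := (h2.isClosedEmbedding (by fun_prop) h1).isProperMap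
  exact (isProperMap_snd_of_compactSpace (X := G) (Y := P × P)).comp h3

theorem t2Space_orbitSpace [ContinuousSMul G P] : T2Space (OrbitSpace P G) := by
  have := properSMul_of_compactSpace (G := G) (P := P)
  exact t2Space_quotient_mulAction_of_properSMul

end Quotient

section Action

variable {E : Type*} [NormedAddCommGroup E] [NormedSpace ℝ E] [FiniteDimensional ℝ E]
  {P : Type*} [TopologicalSpace P] [ChartedSpace E P] [IsManifold 𝓘(ℝ, E) ∞ P]
  {F : Type*} [NormedAddCommGroup F] [NormedSpace ℝ F] [FiniteDimensional ℝ F]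
  {G : Type*} [TopologicalSpace G] [ChartedSpace F G] [Group G] [LieGroup 𝓘(ℝ, F) ∞ G]
  [MulAction G P] [ContMDiffSMul 𝓘(ℝ, F) 𝓘(ℝ, E) ∞ G P]

variable (E F G) in
/-- The tangent space of the orbit of `p`, as a subspace of the model space. -/
def orbitTangentModel (p : P) : Submodule ℝ E := orbitTangent (E := E) F G p

theorem finrank_orbitTangentModel (hfree : ∀ (g : G) (p : P), g • p = p → g = 1) (p : P) :
    Module.finrank ℝ (orbitTangentModel E F G p) = Module.finrank ℝ F := by
  let A : F →L[ℝ] E := infinitesimalAction (E := E) F G p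
  have hA : Injective A := injective_infinitesimalAction hfree p
  exact LinearMap.finrank_range_of_inj (f := A.toLinearMap) hA

-- Orbits have the dimension of `G` by freeness, so it is at most that of `P`; the difference `d` is
-- the dimension of the orbit space.
variable (E P F G) in
theorem exists_add_finrank_eq [Nonempty P] (hfree : ∀ (g : G) (p : P), g • p = p → g = 1) :
    ∃ d : ℕ, d + Module.finrank ℝ F = Module.finrank ℝ E := by
  obtain ⟨p⟩ := (inferInstance : Nonempty P)
  have h := Submodule.finrank_le (orbitTangentModel E F G p)
  rw [finrank_orbitTangentModel hfree] at h
  exact ⟨_, Nat.sub_add_cancel h⟩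

/-- There is a slice map through every point. -/
theorem exists_isSliceMap [T2Space P] [CompactSpace G]
    (hfree : ∀ (g : G) (p : P), g • p = p → g = 1) {d : ℕ}
    (hd : d + Module.finrank ℝ F = Module.finrank ℝ E) (p : P) :
    ∃ (f : EuclideanSpace ℝ (Fin d) → P) (O : TopologicalSpace.Opens (EuclideanSpace ℝ (Fin d))),
      (0 : EuclideanSpace ℝ (Fin d)) ∈ O ∧ f 0 = p ∧ IsSliceMap (E := E) F G f O := by
  let e := extChartAt 𝓘(ℝ, E) p
  let h : E → P := fun w => e.symm (e p + w)
  have hp : h 0 = p := by simp [h, e]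
  have hsym : IsLocalDiffeomorphAt 𝓘(ℝ, E) 𝓘(ℝ, E) ∞ e.symm (e p) :=
    ⟨(chartPartialDiffeomorph 𝓘(ℝ, E) p).symm, mem_extChartAt_target p, fun _ _ => rfl⟩
  have hh : IsLocalDiffeomorphAt 𝓘(ℝ, E) 𝓘(ℝ, E) ∞ h 0 := by
    have h1 : IsLocalDiffeomorph 𝓘(ℝ, E) 𝓘(ℝ, E) ∞ (fun w => e p + w) := by
      let φ : Diffeomorph 𝓘(ℝ, E) 𝓘(ℝ, E) E E ∞ :=
        ⟨Equiv.addLeft (e p), (contDiff_const.add contDiff_id).contMDiff,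
          (contDiff_const.add contDiff_id).contMDiff⟩
      exact φ.isLocalDiffeomorph
    exact IsLocalDiffeomorphAt.comp (hf := h1 0) (hg := by rw [add_zero]; exact hsym)
  let D : E ≃L[ℝ] E := hh.mfderivToContinuousLinearEquiv (by simp)
  have hD : ∀ v : E, D v = mfderiv 𝓘(ℝ, E) 𝓘(ℝ, E) h 0 v := fun v => rfl
  obtain ⟨W, hW⟩ := Submodule.exists_isCompl (orbitTangentModel E F G p)
  have hWd : Module.finrank ℝ W = d := by
    have h1 := Submodule.finrank_add_eq_of_isCompl hW
    rw [finrank_orbitTangentModel hfree] at h1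
    omega
  let κ : EuclideanSpace ℝ (Fin d) ≃L[ℝ] W := ContinuousLinearEquiv.ofFinrankEq (by simp [hWd])
  -- Precomposing with the inverse of the derivative `D` of `h` makes the derivative of `f` at `0`
  -- exactly `κ`, with range the chosen complement `W`.
  let L : EuclideanSpace ℝ (Fin d) →L[ℝ] E :=
    D.symm.toContinuousLinearMap.comp (W.subtypeL.comp κ.toContinuousLinearMap)
  let f : EuclideanSpace ℝ (Fin d) → P := fun v => h (L v)
  have hf0 : f 0 = p := by simp [f, hp]
  have hhs : ∀ᶠ w in 𝓝 (0 : E), ContMDiffAt 𝓘(ℝ, E) 𝓘(ℝ, E) ∞ h w := by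
    obtain ⟨Φ, hΦ, hΦ'⟩ := hh
    filter_upwards [Φ.open_source.mem_nhds hΦ] with w hw
    exact IsLocalDiffeomorphAt.contMDiffAt ⟨Φ, hw, hΦ'⟩
  have hfs : ∀ᶠ v in 𝓝 0, ContMDiffAt (𝓡 d) 𝓘(ℝ, E) ∞ f v := by
    have h1 : Tendsto L (𝓝 0) (𝓝 0) := L.continuous.tendsto' 0 0 (map_zero L)
    filter_upwards [h1.eventually hhs] with v hv
    exact hv.comp v L.contDiff.contMDiff.contMDiffAt
  have hder : ∀ v : EuclideanSpace ℝ (Fin d), (mfderiv (𝓡 d) 𝓘(ℝ, E) f 0 v : E) = (κ v : E) := by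
    have h1 : ContMDiffAt 𝓘(ℝ, E) 𝓘(ℝ, E) ∞ h (L 0) := by
      rw [map_zero]; exact hh.contMDiffAt
    have hL : MDifferentiableAt (𝓡 d) 𝓘(ℝ, E) L 0 := L.differentiableAt.mdifferentiableAt
    have h2 := mfderiv_comp (0 : EuclideanSpace ℝ (Fin d)) (h1.mdifferentiableAt (by simp)) hL
    intro v
    have h3 : (mfderiv (𝓡 d) 𝓘(ℝ, E) f 0 v : E) = mfderiv 𝓘(ℝ, E) 𝓘(ℝ, E) h (L 0)
        (mfderiv (𝓡 d) 𝓘(ℝ, E) L 0 v) := congrArg (fun T : EuclideanSpace ℝ (Fin d) →L[ℝ] E => T v) h2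
    have h4 : (mfderiv (𝓡 d) 𝓘(ℝ, E) L 0 v : E) = L v := by
      rw [mfderiv_eq_fderiv]
      exact congrArg (fun T : EuclideanSpace ℝ (Fin d) →L[ℝ] E => T v) L.fderiv
    have key : ∀ w : E, w = 0 → ∀ u : E, (mfderiv 𝓘(ℝ, E) 𝓘(ℝ, E) h w u : E) = D u := by
      rintro _ rfl u; rfl
    refine h3.trans ((key _ (map_zero L) _).trans ?_)
    rw [h4]
    exact D.apply_symm_apply _
  have hrange : (LinearMap.range (mfderiv (𝓡 d) 𝓘(ℝ, E) f 0).toLinearMap : Submodule ℝ E) = W := by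
    ext w
    constructor
    · rintro ⟨v, rfl⟩
      exact (hder v).symm ▸ (κ v).2
    · intro hw
      refine ⟨κ.symm ⟨w, hw⟩, (hder _).trans ?_⟩
      exact congrArg Subtype.val (κ.apply_symm_apply _)
  have hinj : Injective (mfderiv (𝓡 d) 𝓘(ℝ, E) f 0) := fun v w hvw =>
    κ.injective (Subtype.ext (((hder v).symm.trans hvw).trans (hder w)))
  have hcompl : IsCompl (LinearMap.range (mfderiv (𝓡 d) 𝓘(ℝ, E) f 0).toLinearMap)
      (orbitTangent (E := E) F G (f 0)) := by
    have key : ∀ q : P, q = p → IsCompl W (orbitTangent (E := E) F G q) := by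
      rintro _ rfl; exact hW.symm
    exact hrange ▸ key _ hf0
  obtain ⟨O, hO, hs⟩ := exists_slice hfree hfs hinj hcompl
  exact ⟨f, O, hO, hf0, hs⟩

end Action

/-! ### Slice charts and the submersion structure on the orbit space. -/

section Action

variable {E : Type*} [NormedAddCommGroup E] [NormedSpace ℝ E] [FiniteDimensional ℝ E]
  {P : Type*} [TopologicalSpace P] [ChartedSpace E P] [IsManifold 𝓘(ℝ, E) ∞ P]
  {F : Type*} [NormedAddCommGroup F] [NormedSpace ℝ F] [FiniteDimensional ℝ F]
  {G : Type*} [TopologicalSpace G] [ChartedSpace F G] [Group G] [LieGroup 𝓘(ℝ, F) ∞ G]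
  [MulAction G P] [ContMDiffSMul 𝓘(ℝ, F) 𝓘(ℝ, E) ∞ G P]

theorem orbitProj_eq_iff {p q : P} : orbitProj G p = orbitProj G q ↔ ∃ g : G, g • q = p :=
  Quotient.eq.trans MulAction.orbitRel_apply

theorem orbitProj_smul (g : G) (p : P) : orbitProj G (g • p) = orbitProj G p :=
  orbitProj_eq_iff.2 ⟨g, rfl⟩

namespace IsSliceMap

section Chart

variable {V : Type*} [NormedAddCommGroup V] [NormedSpace ℝ V] [FiniteDimensional ℝ V]
  {f : V → P} {O : TopologicalSpace.Opens V}

/-- The chart of the orbit space given by a slice. -/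
def chart (h : IsSliceMap (E := E) F G f O) (hfree : ∀ (g : G) (p : P), g • p = p → g = 1)
    (hne : Nonempty O) : OpenPartialHomeomorph (OrbitSpace P G) V :=
  ((h.isOpenEmbedding_orbitProj hfree).toOpenPartialHomeomorph _).symm.trans
    (O.openPartialHomeomorphSubtypeCoe hne)

variable (h : IsSliceMap (E := E) F G f O) (hfree : ∀ (g : G) (p : P), g • p = p → g = 1)
  (hne : Nonempty O)

theorem chart_target : (h.chart hfree hne).target = O := by
  simp [chart]

theorem chart_symm_apply {v : V} (hv : v ∈ O) :
    (h.chart hfree hne).symm v = orbitProj G (f v) := by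
  have h1 : (O.openPartialHomeomorphSubtypeCoe hne).symm v = ⟨v, hv⟩ :=
    (O.openPartialHomeomorphSubtypeCoe hne).left_inv (x := ⟨v, hv⟩) (by simp)
  simp [chart, h1]

theorem orbitProj_mem_chart_source {v : V} (hv : v ∈ O) :
    orbitProj G (f v) ∈ (h.chart hfree hne).source := by
  rw [← h.chart_symm_apply hfree hne hv]
  exact (h.chart hfree hne).map_target (by rwa [chart_target])

theorem chart_orbitProj {v : V} (hv : v ∈ O) : h.chart hfree hne (orbitProj G (f v)) = v := by
  rw [← h.chart_symm_apply hfree hne hv]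
  exact (h.chart hfree hne).right_inv (by rwa [chart_target])

theorem exists_eq_of_mem_chart_source {m : OrbitSpace P G} (hm : m ∈ (h.chart hfree hne).source) :
    ∃ v ∈ O, orbitProj G (f v) = m := by
  have h1 := (h.chart hfree hne).map_source hm
  rw [chart_target] at h1
  exact ⟨_, h1, by rw [← h.chart_symm_apply hfree hne h1, (h.chart hfree hne).left_inv hm]⟩

include h hfree in
/-- Near a point of the saturation of a slice, the projection to the slice is smooth. -/
theorem exists_retraction {v : V} (hv : v ∈ O) {q : P} (hq : orbitProj G (f v) = orbitProj G q) :
    ∃ r : P → V, ContMDiffAt 𝓘(ℝ, E) 𝓘(ℝ, V) ∞ r q ∧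
      ∀ᶠ y in 𝓝 q, r y ∈ O ∧ orbitProj G (f (r y)) = orbitProj G y := by
  obtain ⟨g, rfl⟩ := orbitProj_eq_iff.1 hq.symm
  have h1 : IsLocalDiffeomorphAt (𝓘(ℝ, F).prod 𝓘(ℝ, V)) 𝓘(ℝ, E) ∞
      (fun z : G × O => z.1 • f z.2) (g, ⟨v, hv⟩) := h.isLocalDiffeomorph_tube hfree _
  -- The retraction is the slice component of a local inverse of the tube map; it slides `y` along
  -- its orbit onto the slice.
  refine ⟨fun y => (h1.localInverse y).2, ?_, ?_⟩
  · exact (contMDiff_subtype_val _).comp _ (contMDiff_snd.contMDiffAt.comp _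
      h1.localInverse_contMDiffAt)
  · filter_upwards [h1.localInverse_eventuallyEq_right] with y hy
    refine ⟨(h1.localInverse y).2.2, ?_⟩
    conv_rhs => rw [← show (h1.localInverse y).1 • f (h1.localInverse y).2 = y from hy]
    exact (orbitProj_smul _ _).symm

end Chart

section Transition

variable {d : ℕ} {f f' : EuclideanSpace ℝ (Fin d) → P}
  {O O' : TopologicalSpace.Opens (EuclideanSpace ℝ (Fin d))}
  (h : IsSliceMap (E := E) F G f O) (h' : IsSliceMap (E := E) F G f' O')
  (hfree : ∀ (g : G) (p : P), g • p = p → g = 1)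
  (hne : Nonempty O) (hne' : Nonempty O')

/-- Near each point the transition is `r ∘ f`: enter the first slice, then retract along the orbits
onto the second. -/
theorem contDiffOn_chart_comp_chart_symm :
    ContDiffOn ℝ ∞ ((h.chart hfree hne).symm.trans (h'.chart hfree hne'))
      ((h.chart hfree hne).symm.trans (h'.chart hfree hne')).source := by
  intro v hv
  have hvO : v ∈ O := by
    have : v ∈ (h.chart hfree hne).target := hv.1
    rwa [chart_target] at this
  have hv2 : orbitProj G (f v) ∈ (h'.chart hfree hne').source := by
    have : (h.chart hfree hne).symm v ∈ (h'.chart hfree hne').source := hv.2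
    rwa [chart_symm_apply _ _ _ hvO] at this
  obtain ⟨v', hv', hvv'⟩ := h'.exists_eq_of_mem_chart_source hfree hne' hv2
  obtain ⟨r, hr, hr'⟩ := h'.exists_retraction hfree hv' hvv'
  have h1 : ContMDiffAt (𝓡 d) (𝓡 d) ∞ (r ∘ f) v := hr.comp v (h.contMDiffAt v hvO)
  refine ContDiffAt.contDiffWithinAt ?_
  refine (contMDiffAt_iff_contDiffAt.1 h1).congr_of_eventuallyEq ?_
  filter_upwards [(h.contMDiffAt v hvO).continuousAt.eventually hr', O.isOpen.mem_nhds hvO]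
    with w hw hwO
  change h'.chart hfree hne' ((h.chart hfree hne).symm w) = r (f w)
  rw [chart_symm_apply _ _ _ hwO, ← hw.2, chart_orbitProj _ _ _ hw.1]

theorem chart_compatible : (h.chart hfree hne).symm.trans (h'.chart hfree hne') ∈
    contDiffGroupoid ∞ (𝓡 d) := by
  rw [contDiffGroupoid, mem_groupoid_of_pregroupoid]
  have h1 := contDiffOn_chart_comp_chart_symm h h' hfree hne hne'
  have h2 := contDiffOn_chart_comp_chart_symm h' h hfree hne' hne
  constructor
  · simpa [contDiffPregroupoid] using h1
  · have h3 : ((h.chart hfree hne).symm.trans (h'.chart hfree hne')).symm =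
        (h'.chart hfree hne').symm.trans (h.chart hfree hne) := by
      rw [OpenPartialHomeomorph.trans_symm_eq_symm_trans_symm, OpenPartialHomeomorph.symm_symm]
    rw [← OpenPartialHomeomorph.symm_source, h3]
    simpa [contDiffPregroupoid] using h2

end Transition

end IsSliceMap

/-- Locally the projection is the inverse chart after the retraction, so it is smooth. Its composite
with the slice map is the inverse chart itself, a local diffeomorphism, so its derivative is
surjective. -/
theorem isSubmersionStructure_of_chart_mem (t : SmoothStructure (OrbitSpace P G))
    (hfree : ∀ (g : G) (p : P), g • p = p → g = 1)
    (hd : t.dim + Module.finrank ℝ F = Module.finrank ℝ E)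
    {f : P → EuclideanSpace ℝ (Fin t.dim) → P}
    {O : P → TopologicalSpace.Opens (EuclideanSpace ℝ (Fin t.dim))} (hO : ∀ p, 0 ∈ O p)
    (hf0 : ∀ p, f p 0 = p) (hs : ∀ p, IsSliceMap (E := E) F G (f p) (O p))
    (hχ : ∀ p, (hs p).chart hfree ⟨⟨0, hO p⟩⟩ ∈ t.charts) : IsSubmersionStructure E G t := by
  have hne : ∀ p, Nonempty (O p) := fun p => ⟨⟨0, hO p⟩⟩
  let χ := fun p => (hs p).chart hfree (hne p)
  let _ := t.chartedSpace
  have hm := t.isManifold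
  have hsm : ContMDiff 𝓘(ℝ, E) (𝓡 t.dim) ∞ (orbitProj G : P → OrbitSpace P G) := by
    intro p
    obtain ⟨r, hr, hr'⟩ := (hs p).exists_retraction hfree (hO p) (q := p) (by rw [hf0])
    have h1 : ContMDiffAt (𝓡 t.dim) (𝓡 t.dim) ∞ (χ p).symm (r p) := by
      refine (contMDiffOn_symm_of_mem_maximalAtlas (I := 𝓡 t.dim) ?_).contMDiffAt
        ((χ p).open_target.mem_nhds ?_)
      · rw [t.maximalAtlas_eq]; exact hχ p
      · rw [(hs p).chart_target hfree (hne p)]; exact hr'.self_of_nhds.1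
    refine (h1.comp p hr).congr_of_eventuallyEq ?_
    filter_upwards [hr'] with y hy
    exact hy.2.symm.trans ((hs p).chart_symm_apply hfree (hne p) hy.1).symm
  refine Manifold.IsSubmersionOfComplement.isSubmersion (F := F) fun p => ?_
  refine isSubmersionAtOfComplement_of_surjective_mfderiv (Eventually.of_forall fun y => hsm y)
    ?_ (by simpa using hd)
  have h1 : IsLocalDiffeomorphAt (𝓡 t.dim) (𝓡 t.dim) ∞ (orbitProj G ∘ f p) 0 := by
    have h2 : IsLocalDiffeomorphAt (𝓡 t.dim) (𝓡 t.dim) ∞ (χ p).symm 0 := by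
      refine ⟨⟨(χ p).toPartialEquiv.symm, (χ p).open_target, (χ p).open_source, ?_, ?_⟩, ?_, 
        fun _ _ => rfl⟩
      · refine (contMDiffOn_symm_of_mem_maximalAtlas (I := 𝓡 t.dim) ?_)
        rw [t.maximalAtlas_eq]; exact hχ p
      · refine (contMDiffOn_of_mem_maximalAtlas (I := 𝓡 t.dim) ?_)
        rw [t.maximalAtlas_eq]; exact hχ p
      · change _ ∈ (χ p).target
        rw [(hs p).chart_target hfree (hne p)]; exact hO p
    refine isLocalDiffeomorphAt_congr h2 ?_
    filter_upwards [(O p).isOpen.mem_nhds (hO p)] with v hv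
    exact (hs p).chart_symm_apply hfree (hne p) hv
  have h3 : Surjective (mfderiv (𝓡 t.dim) (𝓡 t.dim) (orbitProj G ∘ f p) 0) :=
    (h1.mfderivToContinuousLinearEquiv (by simp)).surjective
  rw [mfderiv_comp (I' := 𝓘(ℝ, E)) _ (hsm.mdifferentiableAt (by simp))
    (((hs p).contMDiffAt 0 (hO p)).mdifferentiableAt (by simp))] at h3
  have h4 : ∀ q, f p 0 = q → Surjective (mfderiv 𝓘(ℝ, E) (𝓡 t.dim) (orbitProj G) (f p 0)) →
      Surjective (mfderiv 𝓘(ℝ, E) (𝓡 t.dim) (orbitProj G) q) := by rintro _ rfl h; exact h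
  exact h4 p (hf0 p) (Surjective.of_comp h3)

/-- The orbit space has a smooth structure for which the projection is a submersion. -/
theorem exists_isSubmersionStructure [T2Space P] [CompactSpace G]
    (hfree : ∀ (g : G) (p : P), g • p = p → g = 1) {d : ℕ}
    (hd : d + Module.finrank ℝ F = Module.finrank ℝ E) :
    ∃ t : SmoothStructure (OrbitSpace P G), IsSubmersionStructure E G t := by
  choose f O hO hf0 hs using fun p : P => exists_isSliceMap (E := E) hfree hd p
  have hne : ∀ p, Nonempty (O p) := fun p => ⟨⟨0, hO p⟩⟩
  let χ := fun p => (hs p).chart hfree (hne p)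
  let t : SmoothStructure (OrbitSpace P G) := SmoothStructure.ofAtlas d (range χ)
    (fun m => by
      obtain ⟨p, rfl⟩ := Quotient.exists_rep m
      refine ⟨χ p, mem_range_self p, ?_⟩
      have := (hs p).orbitProj_mem_chart_source hfree (hne p) (hO p)
      rwa [hf0] at this)
    (by
      rintro _ ⟨p, rfl⟩ _ ⟨q, rfl⟩
      exact (hs p).chart_compatible (hs q) hfree (hne p) (hne q))
  have hχ : ∀ p, χ p ∈ t.charts := fun p =>
    SmoothStructure.subset_charts_ofAtlas _ _ _ _ (mem_range_self p)
  exact ⟨t, isSubmersionStructure_of_chart_mem t hfree hd hO hf0 hs hχ⟩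

end Action

/-! ### Local sections: diffeomorphy of the projection, trivializations and uniqueness. -/

section Action

variable {E : Type*} [NormedAddCommGroup E] [NormedSpace ℝ E] [FiniteDimensional ℝ E]
  {P : Type*} [TopologicalSpace P] [ChartedSpace E P] [IsManifold 𝓘(ℝ, E) ∞ P]
  {F : Type*} [NormedAddCommGroup F] [NormedSpace ℝ F] [FiniteDimensional ℝ F]
  {G : Type*} [TopologicalSpace G] [ChartedSpace F G] [Group G] [LieGroup 𝓘(ℝ, F) ∞ G]
  [MulAction G P] [ContMDiffSMul 𝓘(ℝ, F) 𝓘(ℝ, E) ∞ G P]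

/-- The projection is constant along orbits, so its derivative kills their tangent directions. -/
theorem mfderiv_orbitProj_infinitesimalAction {d : ℕ}
    {_ : ChartedSpace (EuclideanSpace ℝ (Fin d)) (OrbitSpace P G)}
    (hπ : ContMDiff 𝓘(ℝ, E) (𝓡 d) ∞ (orbitProj G : P → OrbitSpace P G)) (p : P)
    (ξ : TangentSpace 𝓘(ℝ, F) (1 : G)) :
    (mfderiv 𝓘(ℝ, E) (𝓡 d) (orbitProj G : P → OrbitSpace P G) p
      (infinitesimalAction (E := E) F G p ξ : E) : EuclideanSpace ℝ (Fin d)) = 0 := by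
  have h1 : (orbitProj G : P → OrbitSpace P G) ∘ (fun g : G => g • p) = fun _ => orbitProj G p :=
    funext fun g => orbitProj_smul g p
  have h2 := mfderiv_comp (1 : G) (hπ.mdifferentiableAt (x := (1 : G) • p) (by simp))
    ((contMDiff_orbitMap E F p).mdifferentiableAt (by simp))
  rw [h1, mfderiv_const] at h2
  have h3 : (0 : EuclideanSpace ℝ (Fin d)) =
      mfderiv 𝓘(ℝ, E) (𝓡 d) (orbitProj G : P → OrbitSpace P G) ((1 : G) • p)
        (infinitesimalAction (E := E) F G p ξ : E) :=
    congrArg (fun T : F →L[ℝ] EuclideanSpace ℝ (Fin d) => T ξ) h2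
  have key : ∀ q : P, q = p → ∀ w : E,
      (mfderiv 𝓘(ℝ, E) (𝓡 d) (orbitProj G : P → OrbitSpace P G) q w : EuclideanSpace ℝ (Fin d)) =
      mfderiv 𝓘(ℝ, E) (𝓡 d) (orbitProj G : P → OrbitSpace P G) p w := by rintro _ rfl w; rfl
  exact (key _ (one_smul G p) _).symm.trans h3.symm

namespace IsLocalSection

variable {θ : TopologicalSpace.Opens (OrbitSpace P G)} {S : Set P} {s : SmoothStructure S}

theorem eq_of_smul_eq (h : IsLocalSection E F G θ S s) {x x' : S} {g : G}
    (hg : g • (x : P) = x') : x = x' := by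
  have h1 : (x' : P) ∈ MulAction.orbit G (x : P) ∩ S := ⟨⟨g, hg⟩, x'.2⟩
  rw [h.orbit_inter x x.2] at h1
  exact Subtype.ext h1.symm

theorem range_orbitProj (h : IsLocalSection E F G θ S s) :
    range (fun x : S => orbitProj G (x : P)) = θ := by
  rw [← h.image_eq]
  exact (image_eq_range _ _).symm

/-- A preimage of a tangent vector under the derivative of the projection splits into a section part
and an orbit part, and only the former contributes. So the restriction is a submersion; it is
injective because the section meets each orbit once. -/
theorem isLocalDiffeomorph_orbitProj (h : IsLocalSection E F G θ S s)
    {t : SmoothStructure (OrbitSpace P G)} (ht : IsSubmersionStructure E G t) :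
    letI := s.chartedSpace
    letI := t.chartedSpace
    IsLocalDiffeomorph (𝓡 s.dim) (𝓡 t.dim) ∞ (fun x : S => orbitProj G (x : P)) := by
  let _ := s.chartedSpace
  let _ := t.chartedSpace
  have hs' := s.isManifold
  have ht' := t.isManifold
  have hι : ContMDiff (𝓡 s.dim) 𝓘(ℝ, E) ∞ (Subtype.val : S → P) :=
    h.isSmoothEmbedding.isImmersion.contMDiff
  have hπ : ContMDiff 𝓘(ℝ, E) (𝓡 t.dim) ∞ (orbitProj G : P → OrbitSpace P G) := ht.contMDiff
  have hc : ContMDiff (𝓡 s.dim) (𝓡 t.dim) ∞ (fun x : S => orbitProj G (x : P)) := hπ.comp hι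
  intro x
  refine isLocalDiffeomorphAt_of_injOn_of_surjective_mfderiv (Eventually.of_forall fun y => hc y) ?_
    univ_mem ?_
  · intro w
    obtain ⟨u, hu⟩ := surjective_mfderiv_of_isSubmersionAt (ht.isSubmersionAt (x : P)) w
    have hw : u ∈ (LinearMap.range (mfderiv (𝓡 s.dim) 𝓘(ℝ, E) (Subtype.val : S → P) x).toLinearMap ⊔
        orbitTangent (E := E) F G (x : P)) := by rw [h.transversal x]; trivial
    obtain ⟨a, ⟨v, rfl⟩, b, ⟨ξ, rfl⟩, hab⟩ := Submodule.mem_sup.1 hw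
    refine ⟨v, ?_⟩
    have h1 := mfderiv_comp x (hπ.mdifferentiableAt (x := (x : P)) (by simp))
      (hι.mdifferentiableAt (x := x) (by simp))
    have h2 : (mfderiv (𝓡 s.dim) (𝓡 t.dim) (fun x : S => orbitProj G (x : P)) x v :
        EuclideanSpace ℝ (Fin t.dim)) = mfderiv 𝓘(ℝ, E) (𝓡 t.dim) (orbitProj G) (x : P)
          (mfderiv (𝓡 s.dim) 𝓘(ℝ, E) (Subtype.val : S → P) x v) :=
      congrArg (fun T : EuclideanSpace ℝ (Fin s.dim) →L[ℝ] EuclideanSpace ℝ (Fin t.dim) => T v) h1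
    refine h2.trans ?_
    rw [← hu, ← hab]
    have h3 := mfderiv_orbitProj_infinitesimalAction (F := F) hπ (x : P) ξ
    refine ((map_add (mfderiv 𝓘(ℝ, E) (𝓡 t.dim) (orbitProj G) (x : P)) _ _).trans ?_).symm
    exact (congrArg (fun e : EuclideanSpace ℝ (Fin t.dim) =>
      HAdd.hAdd (α := EuclideanSpace ℝ (Fin t.dim)) _ e) h3).trans (add_zero _)
  · intro y _ y' _ hyy
    obtain ⟨g, hg⟩ := orbitProj_eq_iff.1 hyy
    exact (h.eq_of_smul_eq hg).symm

theorem exists_diffeomorph (h : IsLocalSection E F G θ S s)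
    {t : SmoothStructure (OrbitSpace P G)} (ht : IsSubmersionStructure E G t) :
    letI := t.chartedSpace
    letI := s.chartedSpace
    ∃ φ : Diffeomorph (𝓡 s.dim) (𝓡 t.dim) S θ ∞,
      ∀ x : S, (φ x : OrbitSpace P G) = orbitProj G (x : P) := by
  let _ := s.chartedSpace
  let _ := t.chartedSpace
  have ht' := t.isManifold
  refine exists_diffeomorph_of_injective (h.isLocalDiffeomorph_orbitProj ht) ?_ θ h.range_orbitProj
  intro y y' hyy
  obtain ⟨g, hg⟩ := orbitProj_eq_iff.1 hyy
  exact (h.eq_of_smul_eq hg).symm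

/-- A local section gives a local trivialization. -/
theorem exists_trivialization (h : IsLocalSection E F G θ S s)
    (hfree : ∀ (g : G) (p : P), g • p = p → g = 1)
    {t : SmoothStructure (OrbitSpace P G)} (ht : IsSubmersionStructure E G t) :
    ∃ φ : ProductDiffeo E F G t θ, IsTrivialization F G φ ∧ IsAdapted F G φ S := by
  obtain ⟨φ, hφ⟩ := h.exists_diffeomorph ht
  let _ := s.chartedSpace
  let _ := t.chartedSpace
  have hs' := s.isManifold
  have ht' := t.isManifold
  have hι : ContMDiff (𝓡 s.dim) 𝓘(ℝ, E) ∞ (Subtype.val : S → P) :=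
    h.isSmoothEmbedding.isImmersion.contMDiff
  have hτ := isLocalDiffeomorph_tube (F := F) (G := G) hfree hι h.transversal
    fun x x' g hg => h.eq_of_smul_eq hg
  have hτi := injective_tube (ι := (Subtype.val : S → P)) hfree fun x x' g hg => h.eq_of_smul_eq hg
  have hrange : range (fun z : G × S => z.1 • (z.2 : P)) = preimageOpens (P := P) G θ := by
    ext y
    change _ ↔ orbitProj G y ∈ (θ : Set (OrbitSpace P G))
    rw [← h.range_orbitProj]
    constructor
    · rintro ⟨z, rfl⟩
      exact ⟨z.2, (orbitProj_smul _ _).symm⟩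
    · rintro ⟨x, hx⟩
      obtain ⟨g, hg⟩ := orbitProj_eq_iff.1 hx.symm
      exact ⟨(g, x), hg⟩
  obtain ⟨τ, hτ'⟩ := exists_diffeomorph_of_injective hτ hτi _ hrange
  -- Invert the tube map `(g, x) ↦ g • x`, whose range is the preimage of `θ`, and identify the
  -- section with `θ` by `φ`.
  let Φ : ProductDiffeo E F G t θ := τ.symm.trans
    ((Diffeomorph.prodComm 𝓘(ℝ, F) (𝓡 s.dim) G S ∞).trans (φ.prodCongr (Diffeomorph.refl 𝓘(ℝ, F) G ∞)))
  have hΦ : ∀ (y : preimageOpens (P := P) G θ) (g : G) (x : S), (y : P) = g • (x : P) →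
      ((Φ y).1 : OrbitSpace P G) = orbitProj G (x : P) ∧ (Φ y).2 = g := by
    intro y g x hy
    have h1 : τ.symm y = (g, x) := by
      rw [← τ.symm_apply_apply (g, x)]
      congr 1
      exact Subtype.ext (hy.trans (hτ' (g, x)).symm)
    have h2 : Φ y = (φ x, g) := by
      change (φ (τ.symm y).2, (τ.symm y).1) = _
      rw [h1]
    rw [h2]
    exact ⟨hφ x, rfl⟩
  have hex : ∀ y : preimageOpens (P := P) G θ, ∃ (g : G) (x : S), (y : P) = g • (x : P) := by
    intro y
    have : (y : P) ∈ range (fun z : G × S => z.1 • (z.2 : P)) := hrange ▸ y.2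
    obtain ⟨z, hz⟩ := this
    exact ⟨z.1, z.2, hz.symm⟩
  refine ⟨Φ, ⟨?_, ?_⟩, ?_⟩
  · intro y
    obtain ⟨g, x, hy⟩ := hex y
    rw [(hΦ y g x hy).1, hy, orbitProj_smul]
  · intro k y y' hyy
    obtain ⟨g, x, hy⟩ := hex y
    rw [(hΦ y g x hy).2, (hΦ y' (k * g) x (by rw [hyy, hy, mul_smul])).2]
  · intro y g x hx hy
    exact (hΦ y g ⟨x, hx⟩ hy).2

end IsLocalSection

theorem IsSubmersionStructure.isSectionStructure {t : SmoothStructure (OrbitSpace P G)}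
    (ht : IsSubmersionStructure E G t) : IsSectionStructure E F G t :=
  fun _ _ _ h => h.exists_diffeomorph ht

variable [T2Space P] [CompactSpace G]

theorem exists_isLocalSection (hfree : ∀ (g : G) (p : P), g • p = p → g = 1) (p : P) :
    ∃ (θ : TopologicalSpace.Opens (OrbitSpace P G)) (S : Set P) (s : SmoothStructure S),
      p ∈ S ∧ IsLocalSection E F G θ S s := by
  have : Nonempty P := ⟨p⟩
  obtain ⟨d, hd⟩ := exists_add_finrank_eq E P F G hfree
  obtain ⟨f, O, hO, rfl, hs⟩ := exists_isSliceMap (E := E) hfree hd p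
  obtain ⟨θ, s, h⟩ := hs.exists_isLocalSection_image hfree hd ⟨⟨0, hO⟩⟩
  exact ⟨θ, _, s, ⟨0, hO, rfl⟩, h⟩

/-- Both structures restrict to the same structure on a section through a given point, so near there
the identity is `φ'` after the inverse of `φ`. -/
theorem IsSectionStructure.contMDiff_id (hfree : ∀ (g : G) (p : P), g • p = p → g = 1)
    {t t' : SmoothStructure (OrbitSpace P G)} (ht : IsSectionStructure E F G t)
    (ht' : IsSectionStructure E F G t') :
    @ContMDiff ℝ _ _ _ _ _ _ (𝓡 t.dim) (OrbitSpace P G) _ t.chartedSpace _ _ _ _ _ (𝓡 t'.dim)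
      (OrbitSpace P G) _ t'.chartedSpace ∞ id := by
  intro m
  obtain ⟨p, rfl⟩ := Quotient.exists_rep m
  obtain ⟨θ, S, s, hp, h⟩ := exists_isLocalSection (E := E) (F := F) hfree p
  obtain ⟨φ, hφ⟩ := ht θ S s h
  obtain ⟨φ', hφ'⟩ := ht' θ S s h
  have h1 : @IsLocalDiffeomorphAt ℝ _ _ _ _ _ _ _ _ _ _ _ (𝓡 s.dim) (𝓡 t.dim) S _
      s.chartedSpace (OrbitSpace P G) _ t.chartedSpace ∞ (fun x : S => (φ x : OrbitSpace P G))
      ⟨p, hp⟩ := by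
    let _ := s.chartedSpace
    let _ := t.chartedSpace
    have ht' := t.isManifold
    exact IsLocalDiffeomorphAt.comp (hf := φ.isLocalDiffeomorph _)
      (hg := isLocalDiffeomorph_subtype_val _ _)
  have h2 : @ContMDiffAt ℝ _ _ _ _ _ _ (𝓡 s.dim) S _ s.chartedSpace _ _ _ _ _ (𝓡 t'.dim)
      (OrbitSpace P G) _ t'.chartedSpace ∞ (id ∘ fun x : S => (φ x : OrbitSpace P G)) ⟨p, hp⟩ := by
    let _ := s.chartedSpace
    let _ := t'.chartedSpace
    have : (id ∘ fun x : S => (φ x : OrbitSpace P G)) = fun x : S => (φ' x : OrbitSpace P G) :=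
      funext fun x => (hφ x).trans (hφ' x).symm
    rw [this]
    exact (contMDiff_subtype_val _).comp _ (φ'.contMDiff _)
  have h3 := contMDiffAt_of_comp_isLocalDiffeomorphAt h1 h2
  have h4 : (φ ⟨p, hp⟩ : OrbitSpace P G) = Quotient.mk _ p := hφ _
  rwa [h4] at h3

theorem IsSectionStructure.unique (hfree : ∀ (g : G) (p : P), g • p = p → g = 1) [Nonempty P]
    {t t' : SmoothStructure (OrbitSpace P G)} (ht : IsSectionStructure E F G t)
    (ht' : IsSectionStructure E F G t') : t = t' := by
  have : Nonempty (OrbitSpace P G) := ‹Nonempty P›.map (orbitProj G)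
  exact SmoothStructure.eq_of_contMDiff t t' (ht.contMDiff_id hfree ht') (ht'.contMDiff_id hfree ht)

theorem isSubmersionStructure_iff [Nonempty P] (hfree : ∀ (g : G) (p : P), g • p = p → g = 1)
    (t : SmoothStructure (OrbitSpace P G)) :
    IsSubmersionStructure E G t ↔ IsSectionStructure E F G t := by
  obtain ⟨d, hd⟩ := exists_add_finrank_eq E P F G hfree
  obtain ⟨t₀, ht₀⟩ := exists_isSubmersionStructure (F := F) hfree hd
  refine ⟨fun h => h.isSectionStructure, fun h => ?_⟩
  -- By uniqueness a section structure equals the submersion structure `t₀` already constructed.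
  rwa [h.unique hfree ht₀.isSectionStructure]

end Action

/-! ### Existence of invariant Riemannian metrics. -/

section Bilinear

variable {E : Type*} [NormedAddCommGroup E] [NormedSpace ℝ E] [FiniteDimensional ℝ E]

-- The norm of `E` need not come from an inner product, so the form is taken as the sum of squares
-- of the coordinates in a basis.
variable (E) in
theorem exists_posDef_bilinear : ∃ B : E →L[ℝ] E →L[ℝ] ℝ, (∀ v w, B v w = B w v) ∧
    ∀ v, v ≠ 0 → 0 < B v v := by
  let b := Module.finBasis ℝ E
  let φ : Fin (Module.finrank ℝ E) → E →L[ℝ] ℝ := fun i => LinearMap.toContinuousLinearMap (b.coord i)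
  have hB : ∀ v w, (∑ i, (φ i).smulRight (φ i)) v w = ∑ i, φ i v * φ i w := fun v w => by
    simp
  refine ⟨∑ i, (φ i).smulRight (φ i), fun v w => ?_, fun v hv => ?_⟩
  · rw [hB, hB]; exact Finset.sum_congr rfl fun i _ => mul_comm _ _
  · rw [hB]
    obtain ⟨i, hi⟩ : ∃ i, φ i v ≠ 0 := by
      by_contra! h
      exact hv (b.ext_elem fun i => by simpa [φ] using h i)
    exact Finset.sum_pos' (fun i _ => mul_self_nonneg _) ⟨i, Finset.mem_univ i, mul_self_pos.2 hi⟩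

/-- A positive definite form on a finite-dimensional space is coercive. -/
theorem exists_pos_mul_sq_le (B : E →L[ℝ] E →L[ℝ] ℝ) (hB : ∀ v, v ≠ 0 → 0 < B v v) :
    ∃ c : ℝ, 0 < c ∧ ∀ v, c * ‖v‖ ^ 2 ≤ B v v := by
  have hcont : Continuous fun v => B v v := B.continuous.clm_apply continuous_id
  -- The unit sphere is empty exactly when `E` is trivial; otherwise `c` is the minimum of the form
  -- on it.
  rcases (Metric.sphere (0 : E) 1).eq_empty_or_nonempty with h | h
  · refine ⟨1, one_pos, fun v => ?_⟩
    by_cases hv : v = 0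
    · simp [hv]
    · exfalso
      have : (‖v‖⁻¹ • v) ∈ Metric.sphere (0 : E) 1 := by
        simp [norm_smul, hv]
      rw [h] at this
      exact this
  · obtain ⟨u, hu, hmin⟩ := (isCompact_sphere (0 : E) 1).exists_isMinOn h hcont.continuousOn
    have hu0 : u ≠ 0 := by
      rintro rfl; simp at hu
    refine ⟨B u u, hB u hu0, fun v => ?_⟩
    by_cases hv : v = 0
    · simp [hv]
    · have hm : (‖v‖⁻¹ • v) ∈ Metric.sphere (0 : E) 1 := by
        simp [norm_smul, hv]
      have h1 : B u u ≤ B (‖v‖⁻¹ • v) (‖v‖⁻¹ • v) := hmin hm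
      have h2 : v = ‖v‖ • ‖v‖⁻¹ • v := by
        rw [smul_smul, mul_inv_cancel₀ (norm_ne_zero_iff.2 hv), one_smul]
      have h3 : B v v = ‖v‖ ^ 2 * B (‖v‖⁻¹ • v) (‖v‖⁻¹ • v) := by
        conv_lhs => rw [h2]
        simp only [map_smul, smul_apply, smul_eq_mul]
        field_simp
      rw [h3, mul_comm]
      gcongr

theorem isVonNBounded_setOf_lt_one (B : E →L[ℝ] E →L[ℝ] ℝ) (hB : ∀ v, v ≠ 0 → 0 < B v v) :
    Bornology.IsVonNBounded ℝ {v : E | B v v < 1} := by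
  obtain ⟨c, hc, h⟩ := exists_pos_mul_sq_le B hB
  rw [NormedSpace.isVonNBounded_iff, isBounded_iff_forall_norm_le]
  refine ⟨1 + 1 / c, fun v (hv : B v v < 1) => ?_⟩
  have h1 : ‖v‖ ^ 2 ≤ 1 / c := by
    rw [le_div_iff₀ hc, mul_comm]; exact ((h v).trans_lt hv).le
  nlinarith [sq_nonneg (‖v‖ - 1), norm_nonneg v]

end Bilinear

section Pullback

variable {E : Type*} [NormedAddCommGroup E] [NormedSpace ℝ E] [FiniteDimensional ℝ E]
  {P : Type*} [TopologicalSpace P] [ChartedSpace E P] [IsManifold 𝓘(ℝ, E) ∞ P]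
  {E' : Type*} [NormedAddCommGroup E'] [NormedSpace ℝ E']

/-- The pullback of a bilinear form by a linear map. -/
def pullbackForm (B : E' →L[ℝ] E' →L[ℝ] ℝ) (T : E →L[ℝ] E') : E →L[ℝ] E →L[ℝ] ℝ :=
  B.bilinearComp T T

theorem pullbackForm_apply (B : E' →L[ℝ] E' →L[ℝ] ℝ) (T : E →L[ℝ] E') (v w : E) :
    pullbackForm B T v w = B (T v) (T w) := rfl

theorem contDiff_pullbackForm (B : E' →L[ℝ] E' →L[ℝ] ℝ) :
    ContDiff ℝ ∞ fun T : E →L[ℝ] E' => pullbackForm B T := by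
  refine contDiff_clm_apply_iff.2 fun v => contDiff_clm_apply_iff.2 fun w => ?_
  have h : ∀ v : E, ContDiff ℝ ∞ fun T : E →L[ℝ] E' => T v := fun v =>
    contDiff_id.clm_apply contDiff_const
  exact (contDiff_const.clm_apply (h v)).clm_apply (h w)

/-- The pullback of a constant form by a smooth family of linear maps is a smooth section. -/
theorem contMDiffAt_pullbackForm (B : E' →L[ℝ] E' →L[ℝ] ℝ) {y₀ : P} (D : P → E →L[ℝ] E')
    (k : P → E') (hD : ContMDiffAt 𝓘(ℝ, E) 𝓘(ℝ, E →L[ℝ] E') ∞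
      (inTangentCoordinates 𝓘(ℝ, E) 𝓘(ℝ, E') id k D y₀) y₀) :
    ContMDiffAt 𝓘(ℝ, E) (𝓘(ℝ, E).prod 𝓘(ℝ, E →L[ℝ] E →L[ℝ] ℝ)) ∞
      (fun y => Bundle.TotalSpace.mk' (E →L[ℝ] E →L[ℝ] ℝ)
        (E := fun y : P => TangentSpace 𝓘(ℝ, E) y →L[ℝ] TangentSpace 𝓘(ℝ, E) y →L[ℝ] ℝ) y
        (pullbackForm (E := E) B (D y))) y₀ := by
  rw [contMDiffAt_hom_bundle]
  refine ⟨contMDiffAt_id, ?_⟩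
  have h1 : ContMDiffAt 𝓘(ℝ, E) 𝓘(ℝ, E →L[ℝ] E →L[ℝ] ℝ) ∞ (fun y =>
      pullbackForm B (inTangentCoordinates 𝓘(ℝ, E) 𝓘(ℝ, E') id k D y₀ y)) y₀ :=
    (contDiff_pullbackForm B).contMDiff.contMDiffAt.comp y₀ hD
  refine h1.congr_of_eventuallyEq ?_
  filter_upwards [(chartAt E y₀).open_source.mem_nhds (mem_chart_source E y₀)] with y hy
  ext a b
  have hb : y ∈ (trivializationAt E (TangentSpace 𝓘(ℝ, E)) y₀).baseSet := by simpa using hy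
  let ϕ : TangentSpace 𝓘(ℝ, E) y →L[ℝ] TangentSpace 𝓘(ℝ, E) y →L[ℝ] ℝ :=
    pullbackForm (E := E) B (D y)
  have h3 := inCoordinates_apply_eq₂ (𝕜 := ℝ) (E₃ := Bundle.Trivial P ℝ) (F₃ := ℝ) (v := a) (w := b)
    (ϕ := ϕ) hb hb (by simp)
  have h5 : ∀ a : E, ((trivializationAt E (TangentSpace 𝓘(ℝ, E)) y₀).symm y a : E) =
      (tangentBundleCore 𝓘(ℝ, E) P).coordChange (achart E y₀) (achart E y) y a := fun a =>
    (Bundle.Trivialization.symmL_apply _ hb _).symm.trans <| congrArg (fun T : E →L[ℝ] E => T a)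
      (TangentBundle.symmL_trivializationAt_eq_core (𝕜 := ℝ) (I := 𝓘(ℝ, E)) hy)
  have h4 : ∀ a : E, inTangentCoordinates 𝓘(ℝ, E) 𝓘(ℝ, E') id k D y₀ y a =
      D y ((trivializationAt E (TangentSpace 𝓘(ℝ, E)) y₀).symm y a : E) := by
    intro a
    rw [inTangentCoordinates_eq _ _ _ (by exact hy) (mem_univ _), h5]
    simp
  refine h3.trans ?_
  rw [pullbackForm_apply, h4, h4]
  simp [ϕ]
  rfl

end Pullback

section Action

variable {E : Type*} [NormedAddCommGroup E] [NormedSpace ℝ E] [FiniteDimensional ℝ E]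
  {P : Type*} [TopologicalSpace P] [ChartedSpace E P] [IsManifold 𝓘(ℝ, E) ∞ P]
  {F : Type*} [NormedAddCommGroup F] [NormedSpace ℝ F] [FiniteDimensional ℝ F]
  {G : Type*} [TopologicalSpace G] [ChartedSpace F G] [Group G] [LieGroup 𝓘(ℝ, F) ∞ G]
  [MulAction G P] [ContMDiffSMul 𝓘(ℝ, F) 𝓘(ℝ, E) ∞ G P]

/-- Near every orbit there is an equivariant smooth map to the group that moves a neighbourhood
of the orbit into a chart domain. -/
theorem exists_equivariant_map [T2Space P] [CompactSpace G]
    (hfree : ∀ (g : G) (p : P), g • p = p → g = 1) (p : P) :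
    ∃ (U : Set (OrbitSpace P G)) (k : P → G), IsOpen U ∧ orbitProj G p ∈ U ∧
      ∀ y, orbitProj G y ∈ U → ContMDiffAt 𝓘(ℝ, E) 𝓘(ℝ, F) ∞ k y ∧
        (∀ h : G, k (h • y) = h * k y) ∧ (k y)⁻¹ • y ∈ (chartAt E p).source := by
  have : Nonempty P := ⟨p⟩
  obtain ⟨d, hd⟩ := exists_add_finrank_eq E P F G hfree
  obtain ⟨f, O, hO, hf0, hs⟩ := exists_isSliceMap (E := E) hfree hd p
  have hcont : ContinuousOn f O := fun v hv => (hs.contMDiffAt v hv).continuousAt.continuousWithinAt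
  -- The slice is shrunk into the chart domain at `p`, so that `(k y)⁻¹ • y`, a point of the slice,
  -- lies there.
  let O' : TopologicalSpace.Opens (EuclideanSpace ℝ (Fin d)) :=
    ⟨O ∩ f ⁻¹' (chartAt E p).source,
      hcont.isOpen_inter_preimage O.isOpen (chartAt E p).open_source⟩
  have hs' : IsSliceMap (E := E) F G f O' := hs.mono fun v hv => hv.1
  have h0 : (0 : EuclideanSpace ℝ (Fin d)) ∈ O' :=
    ⟨hO, by
      change f 0 ∈ (chartAt E p).source
      rw [hf0]; exact mem_chart_source E p⟩
  let τ : G × O' → P := fun z => z.1 • f z.2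
  have hτ := hs'.isLocalDiffeomorph_tube hfree
  have hτi : Injective τ := hs'.injective_tube hfree
  have : Nonempty (G × O') := ⟨(1, ⟨0, h0⟩)⟩
  have hinv : ∀ z, invFun τ (τ z) = z := leftInverse_invFun hτi
  -- `k` is the group component of the inverse tube map. Its values off the saturated set are
  -- arbitrary.
  refine ⟨range fun x : O' => orbitProj G (f x), fun y => (invFun τ y).1,
    (hs'.isOpenEmbedding_orbitProj hfree).isOpen_range, ⟨⟨0, h0⟩, by simp [hf0]⟩, ?_⟩
  rintro y ⟨x, hx⟩
  obtain ⟨g, rfl⟩ := orbitProj_eq_iff.1 hx.symm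
  refine ⟨?_, fun h => ?_, ?_⟩
  · have h1 := hτ (g, x)
    have h2 : ContMDiffAt 𝓘(ℝ, E) 𝓘(ℝ, F) ∞ (fun y => (h1.localInverse y).1) (g • f x) :=
      contMDiff_fst.contMDiffAt.comp _ h1.localInverse_contMDiffAt
    refine h2.congr_of_eventuallyEq ?_
    filter_upwards [h1.localInverse_eventuallyEq_right] with y hy
    conv_lhs => rw [← show τ (h1.localInverse y) = y from hy]
    rw [hinv]
  · have h1 : h • g • f x = τ (h * g, x) := (mul_smul _ _ _).symm
    have h2 : g • f x = τ (g, x) := rfl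
    change (invFun τ (h • g • f x)).1 = h * (invFun τ (g • f x)).1
    rw [h1, h2, hinv, hinv]
  · change (invFun τ (τ (g, x))).1⁻¹ • g • f x ∈ _
    rw [hinv, inv_smul_smul]
    exact x.2.2

/-- An invariant metric on a saturated neighbourhood of an orbit. -/
theorem exists_local_invariant_form [T2Space P] [CompactSpace G]
    (hfree : ∀ (g : G) (p : P), g • p = p → g = 1) {d : ℕ}
    (_hd : d + Module.finrank ℝ F = Module.finrank ℝ E) (p : P) :
    ∃ (U : Set (OrbitSpace P G)) (b : P → E →L[ℝ] E →L[ℝ] ℝ), IsOpen U ∧ orbitProj G p ∈ U ∧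
      ∀ y, orbitProj G y ∈ U →
        ContMDiffAt 𝓘(ℝ, E) (𝓘(ℝ, E).prod 𝓘(ℝ, E →L[ℝ] E →L[ℝ] ℝ)) ∞
          (fun y => Bundle.TotalSpace.mk' (E →L[ℝ] E →L[ℝ] ℝ)
            (E := fun y : P => TangentSpace 𝓘(ℝ, E) y →L[ℝ] TangentSpace 𝓘(ℝ, E) y →L[ℝ] ℝ) y
            (b y)) y ∧
        (∀ v w, b y v w = b y w v) ∧ (∀ v, v ≠ 0 → 0 < b y v v) ∧
        ∀ (h : G) (v w : E), b (h • y) (mfderiv 𝓘(ℝ, E) 𝓘(ℝ, E) (fun x : P => h • x) y v : E)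
          (mfderiv 𝓘(ℝ, E) 𝓘(ℝ, E) (fun x : P => h • x) y w : E) = b y v w := by
  obtain ⟨U, k, hU, hpU, hk⟩ := exists_equivariant_map (E := E) (F := F) hfree p
  obtain ⟨B, hBs, hBp⟩ := exists_posDef_bilinear E
  -- The group element `k y` is frozen when differentiating in `z` at `z = y`. This makes `f y` a
  -- local diffeomorphism and gives the exact identity `f (h • y) ∘ (h • ·) = f y`.
  let f : P → P → E := fun y z => extChartAt 𝓘(ℝ, E) p ((k y)⁻¹ • z)
  let D : P → E →L[ℝ] E := fun y => mfderiv 𝓘(ℝ, E) 𝓘(ℝ, E) (f y) y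
  have hsm : ∀ h : G, ContMDiff 𝓘(ℝ, E) 𝓘(ℝ, E) ∞ (fun x : P => h • x) := fun h =>
    ContMDiffSMul.contMDiff_const_smul (I := 𝓘(ℝ, F)) h
  have hfy : ∀ y, orbitProj G y ∈ U → IsLocalDiffeomorphAt 𝓘(ℝ, E) 𝓘(ℝ, E) ∞ (f y) y := by
    intro y hy
    have h1 : IsLocalDiffeomorphAt 𝓘(ℝ, E) 𝓘(ℝ, E) ∞ (fun z : P => (k y)⁻¹ • z) y :=
      (Diffeomorph.smul 𝓘(ℝ, F) 𝓘(ℝ, E) ∞ (k y)⁻¹).isLocalDiffeomorph y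
    have h2 : IsLocalDiffeomorphAt 𝓘(ℝ, E) 𝓘(ℝ, E) ∞ (extChartAt 𝓘(ℝ, E) p) ((k y)⁻¹ • y) :=
      ⟨chartPartialDiffeomorph 𝓘(ℝ, E) p, by
        change _ ∈ (extChartAt 𝓘(ℝ, E) p).source
        rw [extChartAt_source]
        exact (hk y hy).2.2, fun _ _ => rfl⟩
    exact IsLocalDiffeomorphAt.comp (hf := h1) (hg := h2)
  refine ⟨U, fun y => pullbackForm B (D y), hU, hpU, fun y hy => ⟨?_, fun v w => hBs _ _, ?_, ?_⟩⟩
  · refine contMDiffAt_pullbackForm B D (fun y => f y y) ?_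
    refine ContMDiffAt.mfderiv (n := ∞) f id ?_ contMDiffAt_id (by simp)
    have h1 : ContMDiffAt 𝓘(ℝ, E) 𝓘(ℝ, E) ∞ (extChartAt 𝓘(ℝ, E) p) ((k y)⁻¹ • y) :=
      contMDiffAt_extChartAt' (hk y hy).2.2
    have h2 : ContMDiffAt (𝓘(ℝ, E).prod 𝓘(ℝ, E)) 𝓘(ℝ, F) ∞ (fun z : P × P => (k z.1)⁻¹) (y, y) :=
      ContMDiffAt.inv ((hk y hy).1.comp (y, y) contMDiffAt_fst)
    have h3 : ContMDiffAt (𝓘(ℝ, E).prod 𝓘(ℝ, E)) 𝓘(ℝ, E) ∞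
        (fun z : P × P => (k z.1)⁻¹ • z.2) (y, y) :=
      ((contMDiff_smul (I := 𝓘(ℝ, F)) (I' := 𝓘(ℝ, E))).contMDiffAt).comp (y, y)
        (h2.prodMk contMDiffAt_snd)
    exact h1.comp (y, y) h3
  · intro v hv
    refine hBp _ fun h => hv ?_
    exact ((hfy y hy).mfderivToContinuousLinearEquiv (by simp)).injective (h.trans (map_zero _).symm)
  · intro h v w
    have h1 : f (h • y) ∘ (fun x : P => h • x) = f y := by
      funext z
      change extChartAt 𝓘(ℝ, E) p ((k (h • y))⁻¹ • h • z) = extChartAt 𝓘(ℝ, E) p ((k y)⁻¹ • z)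
      rw [(hk y hy).2.1, mul_inv_rev, mul_smul, inv_smul_smul]
    have h2 := mfderiv_comp y
      ((hfy (h • y) (by rwa [orbitProj_smul])).mdifferentiableAt (by simp))
      ((hsm h).mdifferentiableAt (x := y) (by simp))
    rw [h1] at h2
    have h3 : ∀ v : E, D y v = D (h • y) (mfderiv 𝓘(ℝ, E) 𝓘(ℝ, E) (fun x : P => h • x) y v : E) :=
      fun v => congrArg (fun T : E →L[ℝ] E => T v) h2
    exact (congrArg₂ (fun a b : E => B a b) (h3 v) (h3 w)).symm

/-- Invariant metrics exist. -/
theorem exists_isInvariant [T2Space P] [SecondCountableTopology P] [T2Space G]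
    [CompactSpace G] (hfree : ∀ (g : G) (p : P), g • p = p → g = 1) {d : ℕ}
    (hd : d + Module.finrank ℝ F = Module.finrank ℝ E) :
    ∃ γ : RiemMetric E P, RiemMetric.IsInvariant G γ := by
  obtain ⟨t, ht⟩ := exists_isSubmersionStructure (F := F) hfree hd
  have hcs : ContinuousSMul G P :=
    ContMDiffSMul.continuousSMul (I := 𝓘(ℝ, F)) (I' := 𝓘(ℝ, E)) ∞
  have hM2 : T2Space (OrbitSpace P G) := t2Space_orbitSpace
  have hMc : SecondCountableTopology (OrbitSpace P G) :=
    ContinuousConstSMul.secondCountableTopology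
  let _ := t.chartedSpace
  have htm := t.isManifold
  have hlc : LocallyCompactSpace (OrbitSpace P G) := Manifold.locallyCompact_of_finiteDimensional (𝓡 t.dim)
  have hπ : ContMDiff 𝓘(ℝ, E) (𝓡 t.dim) ∞ (orbitProj G : P → OrbitSpace P G) := ht.contMDiff
  have hex : ∀ m : OrbitSpace P G, _ := fun m =>
    exists_local_invariant_form (E := E) (F := F) hfree hd m.out
  choose U b hUo hmU hb using hex
  have hmU' : ∀ m, m ∈ U m := fun m => by
    have := hmU m
    rwa [show orbitProj G m.out = m from Quotient.out_eq m] at this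
  -- The partition of unity lives on the orbit space, so the weights pulled back to `P` are constant
  -- on orbits and preserve invariance.
  obtain ⟨ρ, hρ⟩ := SmoothPartitionOfUnity.exists_isSubordinate (𝓡 t.dim)
    (isClosed_univ (X := OrbitSpace P G)) U hUo (fun m _ => mem_iUnion.2 ⟨m, hmU' m⟩)
  have hρU : ∀ m x, ρ m x ≠ 0 → x ∈ U m := fun m x h => hρ m (subset_closure h)
  let s : P → E →L[ℝ] E →L[ℝ] ℝ := fun y =>
    ∑ m ∈ ρ.finsupport (orbitProj G y), ρ m (orbitProj G y) • b m y
  have hs : ∀ y v w, s y v w =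
      ∑ m ∈ ρ.finsupport (orbitProj G y), ρ m (orbitProj G y) * b m y v w := fun y v w => by
    simp [s]
  have hmem : ∀ y, ∀ m ∈ ρ.finsupport (orbitProj G y), orbitProj G y ∈ U m := fun y m hm =>
    hρU m _ (by simpa using hm)
  have hpos : ∀ y, ∀ v : E, v ≠ 0 → 0 < s y v v := by
    intro y v hv
    rw [hs]
    obtain ⟨m, hm⟩ := ρ.exists_pos_of_mem (mem_univ (orbitProj G y))
    refine Finset.sum_pos' (fun m hm => mul_nonneg (ρ.nonneg m _)
      (((hb m y (hmem y m hm)).2.2.1 v hv).le)) ⟨m, ?_, ?_⟩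
    · simpa using hm.ne'
    · exact mul_pos hm ((hb m y (hρU m _ hm.ne')).2.2.1 v hv)
  let b' : OrbitSpace P G → ∀ y : P, TangentSpace 𝓘(ℝ, E) y →L[ℝ] TangentSpace 𝓘(ℝ, E) y →L[ℝ] ℝ :=
    fun m y => b m y
  have hz : ∀ m y, ρ m (orbitProj G y) = 0 → ρ m (orbitProj G y) • b' m y = 0 := by
    intro m y h
    rw [h]
    exact ContinuousLinearMap.ext fun v => ContinuousLinearMap.ext fun w => zero_mul _
  -- Local finiteness gives smoothness for the `finsum` over all indices; `hfin` identifies it with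
  -- the finite sum `s` used for positivity and invariance.
  have hsmooth : ContMDiff 𝓘(ℝ, E) (𝓘(ℝ, E).prod 𝓘(ℝ, E →L[ℝ] E →L[ℝ] ℝ)) ∞
      (fun y => Bundle.TotalSpace.mk' (E →L[ℝ] E →L[ℝ] ℝ)
        (E := fun y : P => TangentSpace 𝓘(ℝ, E) y →L[ℝ] TangentSpace 𝓘(ℝ, E) y →L[ℝ] ℝ) y
        (∑ᶠ m, (ρ m (orbitProj G y)) • b' m y)) := by
    refine ContMDiff.finsum_section_of_locallyFinite ?_ fun m => ?_
    · refine (ρ.locallyFinite.preimage_continuous (continuous_orbitProj G)).subset fun m y hy => ?_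
      exact fun h => (show ρ m (orbitProj G y) • b' m y ≠ 0 from hy) (hz m y h)
    · refine ContMDiffOn.smul_section_of_tsupport (u := orbitProj G ⁻¹' U m)
        (ψ := fun y => ρ m (orbitProj G y)) (s := b' m) ?_ ((hUo m).preimage (continuous_orbitProj G)) ?_ ?_
      · exact ((ρ m).contMDiff.comp hπ).contMDiffOn
      · exact (tsupport_comp_subset_preimage _ (continuous_orbitProj G)).trans (preimage_mono (hρ m))
      · exact fun y hy => (hb m y hy).1.contMDiffWithinAt
  have hfin : ∀ y, (∑ᶠ m, (ρ m (orbitProj G y)) • b' m y) = s y := by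
    intro y
    refine finsum_eq_sum_of_support_subset _ fun m hm => ?_
    have : ρ m (orbitProj G y) ≠ 0 :=
      fun h => (show ρ m (orbitProj G y) • b' m y ≠ 0 from hm) (hz m y h)
    simpa using this
  refine ⟨⟨fun y => s y, fun y v w => ?_, fun y v hv => hpos y v hv, fun y => ?_, ?_⟩, ?_⟩
  · refine (hs y v w).trans (Eq.trans ?_ (hs y w v).symm)
    exact Finset.sum_congr rfl fun m hm => congrArg _ ((hb m y (hmem y m hm)).2.1 v w)
  · exact isVonNBounded_setOf_lt_one (s y) (hpos y)
  · refine hsmooth.congr fun y => ?_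
    rw [hfin]
  · intro g y v w
    refine (hs _ _ _).trans (Eq.trans ?_ (hs y v w).symm)
    rw [orbitProj_smul]
    exact Finset.sum_congr rfl fun m hm => congrArg _ ((hb m y (hmem y m hm)).2.2.2 g v w)

end Action

/-! ### Smooth dependence of second order flows, by calculus on spaces of curves. -/

section Superposition

universe u

variable {K : Type*} [TopologicalSpace K] [CompactSpace K]

/-- Pointwise evaluation of a continuous family of linear maps. -/
def pointwiseApply (K : Type*) [TopologicalSpace K] [CompactSpace K]
    (V W : Type*) [NormedAddCommGroup V] [NormedSpace ℝ V] [NormedAddCommGroup W] [NormedSpace ℝ W] :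
    C(K, V →L[ℝ] W) →L[ℝ] C(K, V) →L[ℝ] C(K, W) :=
  LinearMap.mkContinuous₂
    (LinearMap.mk₂ ℝ (fun (T : C(K, V →L[ℝ] W)) (α : C(K, V)) =>
        (⟨fun t => T t (α t), T.continuous.clm_apply α.continuous⟩ : C(K, W)))
      (fun _ _ _ => by ext; simp) (fun _ _ _ => by ext; simp)
      (fun _ _ _ => by ext; simp) (fun _ _ _ => by ext; simp)) 1
    (fun T α => by
      rw [one_mul]
      refine (ContinuousMap.norm_le _ (by positivity)).2 fun t => ?_
      exact ((T t).le_opNorm _).trans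
        (mul_le_mul (T.norm_coe_le_norm t) (α.norm_coe_le_norm t) (norm_nonneg _)
          ((norm_nonneg _).trans (T.norm_coe_le_norm t))))

/-- The range of `α` is compact, so the derivative of `f` is uniformly continuous near it. The mean
value inequality on the balls around the `α t` bounds the remainder by `c * ‖β‖` uniformly in `t`.
-/
theorem hasFDerivAt_superposition {V W : Type*} [NormedAddCommGroup V] [NormedSpace ℝ V]
    [NormedAddCommGroup W] [NormedSpace ℝ W] {f : V → W} (hf : ContDiff ℝ 1 f) (α : C(K, V)) :
    HasFDerivAt (fun α : C(K, V) => (⟨f, hf.continuous⟩ : C(V, W)).comp α)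
      (pointwiseApply K V W ((⟨fderiv ℝ f, hf.continuous_fderiv one_ne_zero⟩ : C(V, V →L[ℝ] W)).comp α))
      α := by
  rw [hasFDerivAt_iff_isLittleO_nhds_zero, Asymptotics.isLittleO_iff]
  intro c hc
  have hS : IsCompact (range α) := isCompact_range α.continuous
  have hu := hS.uniformContinuousAt_of_continuousAt (fderiv ℝ f)
    (fun a _ => (hf.continuous_fderiv one_ne_zero).continuousAt) (Metric.dist_mem_uniformity hc)
  obtain ⟨δ, hδ, h⟩ := Metric.mem_uniformity_dist.1 hu
  filter_upwards [Metric.ball_mem_nhds (0 : C(K, V)) hδ] with β hβ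
  refine (ContinuousMap.norm_le _ (by positivity)).2 fun t => ?_
  have hβt : ‖β t‖ < δ := (β.norm_coe_le_norm t).trans_lt (by simpa using hβ)
  have h1 := (convex_ball (α t) δ).norm_image_sub_le_of_norm_fderiv_le' (𝕜 := ℝ) (f := f)
    (φ := fderiv ℝ f (α t)) (C := c) (x := α t) (y := α t + β t)
    (fun x _ => hf.differentiable one_ne_zero x)
    (fun x hx => by
      have := h (a := α t) (b := x) (by rw [dist_comm]; exact hx) (mem_range_self t)
      rw [← dist_eq_norm, dist_comm]; exact this.le)
    (Metric.mem_ball_self hδ) (by simpa using hβt)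
  rw [add_sub_cancel_left] at h1
  exact h1.trans (by gcongr; exact β.norm_coe_le_norm t)

/-- Composition with a smooth map is a smooth operation on continuous maps. -/
theorem contDiff_superposition {V W : Type u} [NormedAddCommGroup V] [NormedSpace ℝ V]
    [NormedAddCommGroup W] [NormedSpace ℝ W] {f : V → W} (hf : ContDiff ℝ ∞ f) :
    ContDiff ℝ ∞ (fun α : C(K, V) => (⟨f, hf.continuous⟩ : C(V, W)).comp α) := by
  rw [contDiff_infty]
  intro n
  -- The derivative of superposition by `f` is superposition by `fderiv ℝ f`, followed by a fixed
  -- bounded map. The induction therefore passes from `W` to `V →L[ℝ] W`, in the same universe.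
  induction n generalizing W with
  | zero =>
    exact contDiff_zero.2 <| continuous_iff_continuousAt.2 fun α =>
      (hasFDerivAt_superposition (hf.of_le (by simp)) α).continuousAt
  | succ n ih =>
    push_cast
    refine contDiff_succ_iff_hasFDerivAt.2 ⟨_, ?_, hasFDerivAt_superposition (hf.of_le (by simp))⟩
    exact (pointwiseApply K V W).contDiff.comp (ih (hf.fderiv_right (m := ∞) (by simp)))

end Superposition

section Flow

variable {E : Type*} [NormedAddCommGroup E] [NormedSpace ℝ E]

/-- The interval of times. -/
abbrev TimeInterval : Type := Icc (-1 : ℝ) 2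

/-- The extension of a curve by constants. -/
def extendCurve (α : C(TimeInterval, E)) : ℝ → E := IccExtend (by norm_num : (-1 : ℝ) ≤ 2) α

theorem continuous_extendCurve (α : C(TimeInterval, E)) : Continuous (extendCurve α) :=
  α.continuous.Icc_extend'

theorem extendCurve_coe (α : C(TimeInterval, E)) (t : TimeInterval) : extendCurve α t = α t :=
  IccExtend_val _ _ _

theorem norm_extendCurve_le (α : C(TimeInterval, E)) (t : ℝ) : ‖extendCurve α t‖ ≤ ‖α‖ :=
  α.norm_coe_le_norm _

variable (E) in
/-- Integration from time `0`. -/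
def primitiveCurve : C(TimeInterval, E) →L[ℝ] C(TimeInterval, E) :=
  LinearMap.mkContinuous
    { toFun := fun α => ⟨fun t => ∫ s in (0 : ℝ)..t, extendCurve α s,
        (intervalIntegral.continuous_primitive
          (fun _ _ => (continuous_extendCurve α).intervalIntegrable _ _) 0).comp
          continuous_subtype_val⟩
      map_add' := fun α β => by
        ext t
        exact intervalIntegral.integral_add ((continuous_extendCurve α).intervalIntegrable _ _)
          ((continuous_extendCurve β).intervalIntegrable _ _)
      map_smul' := fun c α => by
        ext t
        exact intervalIntegral.integral_smul c _ } 2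
    -- The bound `2` is the largest `|t|` on the time interval.
    (fun α => by
      refine (ContinuousMap.norm_le _ (by positivity)).2 fun t => ?_
      refine (intervalIntegral.norm_integral_le_of_norm_le_const
        (fun s _ => norm_extendCurve_le α s)).trans ?_
      rw [mul_comm]
      gcongr
      rw [sub_zero, abs_le]
      exact ⟨by linarith [t.2.1], t.2.2⟩)

theorem hasDerivAt_primitive [CompleteSpace E] (α : C(TimeInterval, E)) (t : ℝ) :
    HasDerivAt (fun t => ∫ s in (0 : ℝ)..t, extendCurve α s) (extendCurve α t) t :=
  (continuous_extendCurve α).integral_hasStrictDerivAt 0 t |>.hasDerivAt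

variable (E) in
/-- Constant curves. -/
def constCurve : E →L[ℝ] C(TimeInterval, E) :=
  LinearMap.mkContinuous
    { toFun := fun v => ContinuousMap.const _ v
      map_add' := fun _ _ => rfl
      map_smul' := fun _ _ => rfl } 1
    (fun v => (ContinuousMap.norm_le _ (by positivity)).2 fun t => by rw [one_mul]; exact le_rfl)

theorem constCurve_apply (v : E) (t : TimeInterval) : constCurve E v t = v := rfl

/-- The curve of positions and velocities of the curve with initial point `x₀` and velocity
`w`. -/
def phaseCurve (x₀ : E) (w : C(TimeInterval, E)) : C(TimeInterval, E × E) :=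
  constCurve (E × E) (x₀, 0) +
    ((ContinuousLinearMap.inl ℝ E E).compLeftContinuous ℝ TimeInterval (primitiveCurve E w) +
      (ContinuousLinearMap.inr ℝ E E).compLeftContinuous ℝ TimeInterval w)

theorem phaseCurve_apply (x₀ : E) (w : C(TimeInterval, E)) (t : TimeInterval) :
    phaseCurve x₀ w t = (x₀ + primitiveCurve E w t, w t) := by
  simp [phaseCurve, constCurve_apply]

theorem contDiff_phaseCurve (x₀ : E) : ContDiff ℝ ∞ (phaseCurve x₀) := by
  unfold phaseCurve
  exact contDiff_const.add ((((ContinuousLinearMap.inl ℝ E E).compLeftContinuous ℝ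
    TimeInterval).contDiff.comp (primitiveCurve E).contDiff).add
      ((ContinuousLinearMap.inr ℝ E E).compLeftContinuous ℝ TimeInterval).contDiff)

/-- The velocity solves `w - ∫ f (x₀ + ∫ w, w) = v`, an equation `Ψ w = v` on the Banach space of
curves over the whole interval. Since `f` has zero derivative at the equilibrium, the derivative of
`Ψ` at `0` is the identity; inverting `Ψ` solves the equation for small `v`, smoothly in `v`. -/
theorem exists_velocity [CompleteSpace E] {f : E × E → E} (hf : ContDiff ℝ ∞ f) {x₀ : E}
    (h0 : f (x₀, 0) = 0) (h1 : fderiv ℝ f (x₀, 0) = 0) :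
    ∃ w : E → C(TimeInterval, E), w 0 = 0 ∧ HasFDerivAt w (constCurve E) 0 ∧
      ∀ᶠ v in 𝓝 0, ContDiffAt ℝ ∞ w v ∧
        w v = constCurve E v + primitiveCurve E
          ((⟨f, hf.continuous⟩ : C(E × E, E)).comp (phaseCurve x₀ (w v))) := by
  let A : C(TimeInterval, E × E) → C(TimeInterval, E) := fun α =>
    (⟨f, hf.continuous⟩ : C(E × E, E)).comp α
  have hA : ContDiff ℝ ∞ A := contDiff_superposition hf
  let Ψ : C(TimeInterval, E) → C(TimeInterval, E) := fun w => w - primitiveCurve E (A (phaseCurve x₀ w))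
  have hΨ : ContDiff ℝ ∞ Ψ :=
    contDiff_id.sub ((primitiveCurve E).contDiff.comp (hA.comp (contDiff_phaseCurve x₀)))
  have hX0 : ∀ t, phaseCurve x₀ 0 t = (x₀, 0) := fun t => by
    rw [phaseCurve_apply, map_zero]; simp
  have hΨ0 : Ψ 0 = 0 := by
    have : A (phaseCurve x₀ 0) = 0 := by
      ext t
      exact (congrArg f (hX0 t)).trans h0
    simp [Ψ, this]
  have hA0 : HasFDerivAt A (0 : C(TimeInterval, E × E) →L[ℝ] C(TimeInterval, E)) (phaseCurve x₀ 0) := by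
    have h := hasFDerivAt_superposition (K := TimeInterval) (f := f) (hf.of_le (by simp)) (phaseCurve x₀ 0)
    convert h using 1
    ext α t
    refine Eq.symm ?_
    change fderiv ℝ f (phaseCurve x₀ 0 t) (α t) = 0
    rw [hX0, h1]
    rfl
  have hΨ' : HasFDerivAt Ψ
      ((ContinuousLinearEquiv.refl ℝ C(TimeInterval, E) : _ →L[ℝ] C(TimeInterval, E))) 0 := by
    have h2 := ((contDiff_phaseCurve x₀).differentiable (by simp) 0).hasFDerivAt
    have h3 := (hasFDerivAt_id (𝕜 := ℝ) (0 : C(TimeInterval, E))).sub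
      ((primitiveCurve E).hasFDerivAt.comp 0 (hA0.comp 0 h2))
    refine h3.congr_fderiv ?_
    ext α t
    simp
  let φ := hΨ.contDiffAt.toOpenPartialHomeomorph Ψ hΨ' (by simp)
  have hφ : ∀ w, φ w = Ψ w := fun w => rfl
  have h0s : (0 : C(TimeInterval, E)) ∈ φ.source :=
    hΨ.contDiffAt.mem_toOpenPartialHomeomorph_source hΨ' (by simp)
  have h0t : (0 : C(TimeInterval, E)) ∈ φ.target := by
    have := φ.map_source h0s
    rwa [hφ, hΨ0] at this
  have hsymm0 : φ.symm 0 = 0 := by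
    have := φ.left_inv h0s
    rwa [hφ, hΨ0] at this
  have hinv : ∀ᶠ w in 𝓝 (0 : C(TimeInterval, E)),
      ∃ T : C(TimeInterval, E) ≃L[ℝ] C(TimeInterval, E), HasFDerivAt Ψ (T : _ →L[ℝ] _) w := by
    have h2 : Tendsto (fderiv ℝ Ψ) (𝓝 0) (𝓝 (ContinuousLinearEquiv.refl ℝ C(TimeInterval, E) :
        C(TimeInterval, E) →L[ℝ] C(TimeInterval, E))) := by
      rw [← hΨ'.fderiv]
      exact (hΨ.continuous_fderiv (by simp)).continuousAt
    filter_upwards [h2.eventually (ContinuousLinearEquiv.nhds _)] with w ⟨T, hT⟩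
    refine ⟨T, ?_⟩
    rw [hT]
    exact (hΨ.differentiable (by simp) w).hasFDerivAt
  have hc0 : constCurve E (0 : E) = 0 := map_zero _
  refine ⟨fun v => φ.symm (constCurve E v), by simp [hsymm0], ?_, ?_⟩
  · have h2 : HasFDerivAt φ.symm ((ContinuousLinearEquiv.refl ℝ C(TimeInterval, E)).symm :
        C(TimeInterval, E) →L[ℝ] C(TimeInterval, E)) (constCurve E (0 : E)) := by
      rw [hc0]
      exact φ.hasFDerivAt_symm h0t (by rw [hsymm0]; exact hΨ')
    exact (h2.comp (0 : E) (constCurve E).hasFDerivAt).congr_fderiv (by ext; simp)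
  · have h2 : Tendsto (constCurve E) (𝓝 0) (𝓝 0) := (constCurve E).continuous.tendsto' 0 0 hc0
    have h3 : Tendsto φ.symm (𝓝 0) (𝓝 0) := by
      have := φ.continuousAt_symm h0t
      rwa [ContinuousAt, hsymm0] at this
    filter_upwards [h2.eventually (φ.open_target.mem_nhds h0t), h2.eventually (h3.eventually hinv)]
      with v hv ⟨T, hT⟩
    refine ⟨(φ.contDiffAt_symm hv hT hΨ.contDiffAt).comp v (constCurve E).contDiff.contDiffAt, ?_⟩
    have h4 : Ψ (φ.symm (constCurve E v)) = constCurve E v := φ.right_inv hv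
    exact sub_eq_iff_eq_add.1 h4

/-- Multiplication by a bump function. Superposition requires a globally smooth map, while the
geodesic spray is smooth only over a chart target. -/
theorem exists_contDiff_eventuallyEq {V W : Type*} [NormedAddCommGroup V] [NormedSpace ℝ V]
    [FiniteDimensional ℝ V] [NormedAddCommGroup W] [NormedSpace ℝ W] {f : V → W} {z : V}
    (hf : ∀ᶠ y in 𝓝 z, ContDiffAt ℝ ∞ f y) : ∃ g : V → W, ContDiff ℝ ∞ g ∧ g =ᶠ[𝓝 z] f := by
  obtain ⟨r, hr, h⟩ := Metric.eventually_nhds_iff_ball.1 hf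
  let χ : ContDiffBump z := ⟨r / 4, r / 2, by positivity, by linarith⟩
  refine ⟨fun y => χ y • f y, contDiff_iff_contDiffAt.2 fun y => ?_, ?_⟩
  · by_cases hy : y ∈ Metric.ball z r
    · exact χ.contDiff.contDiffAt.smul (h y hy)
    · have h1 : ∀ᶠ x in 𝓝 y, x ∉ Metric.closedBall z (r / 2) := by
        refine Metric.isClosed_closedBall.isOpen_compl.mem_nhds fun h2 => hy ?_
        exact lt_of_le_of_lt (Metric.mem_closedBall.1 h2) (by linarith)
      refine (contDiffAt_const (c := (0 : W))).congr_of_eventuallyEq ?_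
      filter_upwards [h1] with x hx
      rw [χ.zero_of_le_dist (by simpa [χ] using (not_le.1 hx).le), zero_smul]
  · filter_upwards [χ.eventuallyEq_one] with y hy
    rw [hy]; simp

/-- Solutions of a second order equation with small initial velocity near an equilibrium exist on a
long interval and depend smoothly on the initial velocity. -/
theorem exists_second_order_flow [FiniteDimensional ℝ E] {f : E × E → E} {x₀ : E}
    (hf : ∀ᶠ z in 𝓝 (x₀, (0 : E)), ContDiffAt ℝ ∞ f z) (h0 : f (x₀, 0) = 0)
    (h1 : fderiv ℝ f (x₀, 0) = 0) {N : Set (E × E)} (hN : N ∈ 𝓝 (x₀, (0 : E))) :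
    ∃ u w : E → ℝ → E, u 0 1 = x₀ ∧
      HasFDerivAt (fun v => u v 1) (ContinuousLinearMap.id ℝ E) 0 ∧
      ∀ᶠ v in 𝓝 0, ContDiffAt ℝ ∞ (fun v => u v 1) v ∧ u v 0 = x₀ ∧ w v 0 = v ∧
        ∀ t ∈ Ioo (-1 : ℝ) 2, (u v t, w v t) ∈ N ∧ HasDerivAt (u v) (w v t) t ∧
          HasDerivAt (w v) (f (u v t, w v t)) t := by
  have : CompleteSpace E := FiniteDimensional.complete ℝ E
  obtain ⟨g, hg, hgf⟩ := exists_contDiff_eventuallyEq hf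
  obtain ⟨W, hW0, hW', hW⟩ := exists_velocity hg (x₀ := x₀) (hgf.self_of_nhds.trans h0)
    (hgf.fderiv_eq.trans h1)
  let one : TimeInterval := ⟨1, by norm_num⟩
  let ev : C(TimeInterval, E) →L[ℝ] E := (ContinuousMap.evalCLM ℝ one).comp (primitiveCurve E)
  have hev : ∀ v, x₀ + ∫ s in (0 : ℝ)..1, extendCurve (W v) s = x₀ + ev (W v) := fun v => rfl
  refine ⟨fun v t => x₀ + ∫ s in (0 : ℝ)..t, extendCurve (W v) s, fun v => extendCurve (W v),
    ?_, ?_, ?_⟩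
  · change x₀ + ev (W 0) = x₀
    rw [hW0, map_zero, add_zero]
  · have h2 := (ev.hasFDerivAt.comp (0 : E) hW').const_add x₀
    refine h2.congr_fderiv ?_
    ext v
    -- To first order the velocity is the constant `v`, whose integral over `[0, 1]` is `v`.
    have h3 : ∫ s in (0 : ℝ)..1, extendCurve (constCurve E v) s = v := by
      have : ∀ s, extendCurve (constCurve E v) s = v := fun s => rfl
      simp [this]
    exact h3
  · have hWc : Tendsto W (𝓝 0) (𝓝 0) := by
      have := hW'.continuousAt
      rwa [ContinuousAt, hW0] at this
    -- For small `v` the phase curve stays uniformly close to rest, hence inside `N` and inside the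
    -- region where `g` agrees with `f`.
    obtain ⟨r, hr, hrN⟩ := Metric.mem_nhds_iff.1 (inter_mem hN hgf)
    have hsmall : ∀ᶠ v in 𝓝 (0 : E), phaseCurve x₀ (W v) ∈ Metric.ball (phaseCurve x₀ 0) r :=
      (((contDiff_phaseCurve x₀).continuous.tendsto 0).comp hWc).eventually (Metric.ball_mem_nhds _ hr)
    filter_upwards [hW, hsmall] with v ⟨hv, hv'⟩ hvr
    have hmem : ∀ t : TimeInterval, (x₀ + primitiveCurve E (W v) t, W v t) ∈
        N ∩ {z | g z = f z} := by
      intro t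
      refine hrN ?_
      rw [← phaseCurve_apply]
      have h2 : phaseCurve x₀ 0 t = (x₀, 0) := by rw [phaseCurve_apply, map_zero]; simp
      rw [Metric.mem_ball, ← h2]
      exact (ContinuousMap.dist_apply_le_dist t).trans_lt hvr
    have hw : ∀ t (ht : t ∈ Icc (-1 : ℝ) 2), extendCurve (W v) t = v + ∫ s in (0 : ℝ)..t,
        extendCurve ((⟨g, hg.continuous⟩ : C(E × E, E)).comp (phaseCurve x₀ (W v))) s := by
      intro t ht
      have h2 : extendCurve (W v) t = W v ⟨t, ht⟩ := extendCurve_coe _ ⟨t, ht⟩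
      rw [h2, hv']
      conv_rhs => rw [← hv']
      rfl
    refine ⟨contDiffAt_const.add (ev.contDiff.contDiffAt.comp v hv), by simp, ?_, fun t ht => ?_⟩
    · rw [hw 0 (by norm_num)]; simp
    have htI : t ∈ Icc (-1 : ℝ) 2 := ⟨ht.1.le, ht.2.le⟩
    have h2 : extendCurve (W v) t = W v ⟨t, htI⟩ := extendCurve_coe _ ⟨t, htI⟩
    have h3 : (x₀ + ∫ s in (0 : ℝ)..t, extendCurve (W v) s, extendCurve (W v) t) =
        (x₀ + primitiveCurve E (W v) ⟨t, htI⟩, W v ⟨t, htI⟩) := by rw [h2]; rfl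
    refine ⟨?_, ?_, ?_⟩
    · rw [h3]; exact (hmem _).1
    · exact (hasDerivAt_primitive (W v) t).const_add x₀
    · have h4 := (hasDerivAt_primitive
        ((⟨g, hg.continuous⟩ : C(E × E, E)).comp (phaseCurve x₀ (W v))) t).const_add v
      have h5 : extendCurve ((⟨g, hg.continuous⟩ : C(E × E, E)).comp (phaseCurve x₀ (W v))) t =
          f (x₀ + ∫ s in (0 : ℝ)..t, extendCurve (W v) s, extendCurve (W v) t) := by
        rw [h3, ← (hmem ⟨t, htI⟩).2, ← phaseCurve_apply]
        exact extendCurve_coe _ ⟨t, htI⟩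
      rw [h5] at h4
      refine h4.congr_of_eventuallyEq ?_
      filter_upwards [Ioo_mem_nhds ht.1 ht.2] with s hs
      exact hw s ⟨hs.1.le, hs.2.le⟩

end Flow

/-! ### The geodesic spray and its invariance under coordinate changes. -/

section Spray

variable {E : Type*} [NormedAddCommGroup E] [NormedSpace ℝ E] [FiniteDimensional ℝ E]

/-- The Euler-Lagrange expression of the kinetic energy of the metric `g` at position `x`,
velocity `a`, acceleration `b`, applied to `w`. -/
def eulerLagrange (g : E → E →L[ℝ] E →L[ℝ] ℝ) (x a b w : E) : ℝ :=
  g x b w + fderiv ℝ g x a a w - fderiv ℝ g x w a a / 2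

/-- The linear form which the metric turns into the acceleration of geodesics. -/
def sprayForm (g : E → E →L[ℝ] E →L[ℝ] ℝ) (z : E × E) : E →L[ℝ] ℝ :=
  (1 / 2 : ℝ) • ((fderiv ℝ g z.1).flip z.2).flip z.2 - fderiv ℝ g z.1 z.2 z.2

/-- The acceleration of the geodesics of the metric `g`, as a function of position and velocity. -/
def spray (g : E → E →L[ℝ] E →L[ℝ] ℝ) (z : E × E) : E :=
  (g z.1).inverse (sprayForm g z)

theorem exists_continuousLinearEquiv_of_posDef {B : E →L[ℝ] E →L[ℝ] ℝ}
    (hB : ∀ v, v ≠ 0 → 0 < B v v) : ∃ T : E ≃L[ℝ] (E →L[ℝ] ℝ), (T : E →L[ℝ] E →L[ℝ] ℝ) = B := by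
  have hi : Injective B.toLinearMap := by
    refine (injective_iff_map_eq_zero _).2 fun v hv => ?_
    by_contra h
    have h1 := hB v h
    have h2 : B v = 0 := hv
    rw [h2] at h1
    exact lt_irrefl _ h1
  have hd : Module.finrank ℝ E = Module.finrank ℝ (E →L[ℝ] ℝ) := by
    rw [← LinearMap.toContinuousLinearMap.finrank_eq, Module.finrank_linearMap,
      Module.finrank_self, mul_one]
  refine ⟨(LinearEquiv.ofInjectiveOfFinrankEq B.toLinearMap hi hd).toContinuousLinearEquiv, ?_⟩
  ext v w
  rfl

/-- The expression is affine in the acceleration with linear part `g x`, which positive definiteness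
makes invertible; so the equation can be solved for `b`. -/
theorem eulerLagrange_eq_zero_iff {g : E → E →L[ℝ] E →L[ℝ] ℝ} {x : E}
    (hg : ∀ v, v ≠ 0 → 0 < g x v v) (a b : E) :
    (∀ w, eulerLagrange g x a b w = 0) ↔ b = spray g (x, a) := by
  obtain ⟨T, hT⟩ := exists_continuousLinearEquiv_of_posDef hg
  have h1 : (∀ w, eulerLagrange g x a b w = 0) ↔ T b = sprayForm g (x, a) := by
    rw [ContinuousLinearMap.ext_iff]
    refine forall_congr' fun w => ?_
    have h2 : T b w = g x b w := by rw [← hT]; rfl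
    rw [h2]
    simp only [eulerLagrange, sprayForm, sub_apply, smul_apply,
      ContinuousLinearMap.flip_apply, smul_eq_mul]
    constructor <;> intro h <;> linarith
  rw [h1, spray]
  change _ ↔ b = (g x).inverse _
  rw [← hT, ContinuousLinearMap.inverse_equiv]
  exact T.eq_symm_apply.symm

set_option maxSynthPendingDepth 4 in
set_option synthInstance.maxHeartbeats 80000 in
theorem contDiffAt_sprayForm {g : E → E →L[ℝ] E →L[ℝ] ℝ} {z : E × E}
    (hg : ContDiffAt ℝ ∞ g z.1) : ContDiffAt ℝ ∞ (sprayForm g) z := by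
  have h1 : ContDiffAt ℝ ∞ (fun z : E × E => fderiv ℝ g z.1) z :=
    (hg.fderiv_right (m := ∞) (by simp)).comp z contDiffAt_fst
  refine ContDiffAt.sub (ContDiffAt.const_smul (1 / 2 : ℝ) ?_) ((h1.clm_apply contDiffAt_snd).clm_apply
    contDiffAt_snd)
  have h3 : ContDiffAt ℝ ∞ (fun z : E × E => (fderiv ℝ g z.1).flip) z :=
    (ContinuousLinearMap.flipₗᵢ ℝ E E (E →L[ℝ] ℝ)).contDiff.contDiffAt.comp z h1
  have h4 : ContDiffAt ℝ ∞ (fun z : E × E => (fderiv ℝ g z.1).flip z.2) z :=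
    h3.clm_apply contDiffAt_snd
  have h5 : ContDiffAt ℝ ∞ (fun z : E × E => ((fderiv ℝ g z.1).flip z.2).flip) z :=
    (ContinuousLinearMap.flipₗᵢ ℝ E E ℝ).contDiff.contDiffAt.comp z h4
  exact h5.clm_apply contDiffAt_snd

theorem contDiffAt_spray {g : E → E →L[ℝ] E →L[ℝ] ℝ} {z : E × E}
    (hg : ContDiffAt ℝ ∞ g z.1) (hpos : ∀ v, v ≠ 0 → 0 < g z.1 v v) :
    ContDiffAt ℝ ∞ (spray g) z := by
  have : CompleteSpace E := FiniteDimensional.complete ℝ E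
  obtain ⟨T, hT⟩ := exists_continuousLinearEquiv_of_posDef hpos
  have h1 : ContDiffAt ℝ ∞ (ContinuousLinearMap.inverse : (E →L[ℝ] E →L[ℝ] ℝ) → _) (g z.1) := by
    rw [← hT]; exact contDiffAt_map_inverse T
  have h2 : ContDiffAt ℝ ∞ (fun z : E × E => (g z.1).inverse) z :=
    ContDiffAt.comp (g := ContinuousLinearMap.inverse) (f := fun z : E × E => g z.1) z h1
      (hg.comp z contDiffAt_fst)
  exact h2.clm_apply (contDiffAt_sprayForm hg)

theorem spray_smul (g : E → E →L[ℝ] E →L[ℝ] ℝ) (x a : E) (r : ℝ) :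
    spray g (x, r • a) = r • r • spray g (x, a) := by
  have h : sprayForm g (x, r • a) = r • r • sprayForm g (x, a) := by
    ext w
    simp only [sprayForm, sub_apply, smul_apply,
      ContinuousLinearMap.flip_apply, smul_eq_mul, map_smul]
    ring
  change (g x).inverse _ = r • r • (g x).inverse _
  rw [h, map_smul, map_smul]

theorem spray_zero (g : E → E →L[ℝ] E →L[ℝ] ℝ) (x : E) : spray g (x, 0) = 0 := by
  have := spray_smul g x 0 0
  rwa [smul_zero, zero_smul] at this

/-- By quadratic homogeneity, `spray g (x + r • h, r • k)` is `r ^ 2` times a function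
differentiable at `r = 0`, so every directional derivative vanishes. This is the equilibrium
hypothesis of `exists_second_order_flow`. -/
theorem fderiv_spray_zero {g : E → E →L[ℝ] E →L[ℝ] ℝ} {x : E} (hg : ContDiffAt ℝ ∞ g x)
    (hpos : ∀ v, v ≠ 0 → 0 < g x v v) : fderiv ℝ (spray g) (x, 0) = 0 := by
  have hd : ∀ a : E, DifferentiableAt ℝ (spray g) (x, a) := fun a =>
    (contDiffAt_spray (z := (x, a)) hg hpos).differentiableAt (by simp)
  refine ContinuousLinearMap.ext fun ⟨h, k⟩ => ?_
  have h1 : HasDerivAt (fun r : ℝ => (x + r • h, r • k)) (h, k) 0 := by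
    have := ((hasDerivAt_id (0 : ℝ)).smul_const h).const_add x
    have h2 := (hasDerivAt_id (0 : ℝ)).smul_const k
    simpa using this.prodMk h2
  have h2 : HasDerivAt (fun r : ℝ => spray g (x + r • h, r • k)) (fderiv ℝ (spray g) (x, 0) (h, k)) 0 := by
    refine HasFDerivAt.comp_hasDerivAt_of_eq (0 : ℝ) (hd 0).hasFDerivAt h1 (by simp)
  have h3 : HasDerivAt (fun r : ℝ => (x + r • h, k)) (h, 0) 0 := by
    have := ((hasDerivAt_id (0 : ℝ)).smul_const h).const_add x
    simpa using this.prodMk (hasDerivAt_const (0 : ℝ) k)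
  have h4 := HasFDerivAt.comp_hasDerivAt_of_eq (0 : ℝ) (hd k).hasFDerivAt h3 (by simp)
  have h5 := (hasDerivAt_id (0 : ℝ)).smul ((hasDerivAt_id (0 : ℝ)).smul h4)
  have h6 : HasDerivAt (fun r : ℝ => spray g (x + r • h, r • k)) 0 0 := by
    refine (h5.congr_deriv (by simp)).congr_of_eventuallyEq (Eventually.of_forall fun r => ?_)
    exact spray_smul g _ k r
  exact h2.unique h6

-- Differentiating the pulled-back metric creates second derivatives of `ψ`. Symmetry of these and
-- of `g` cancels all but the term pairing the value at `(a, a)` with the image of `w`, which is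
-- exactly the correction in the transformed acceleration.
set_option maxSynthPendingDepth 4 in
set_option synthInstance.maxHeartbeats 80000 in
theorem eulerLagrange_comp {g g' : E → E →L[ℝ] E →L[ℝ] ℝ} {ψ : E → E} {y : E}
    (hψ : ContDiffAt ℝ 2 ψ y) (hg : DifferentiableAt ℝ g (ψ y))
    (hdiff : DifferentiableAt ℝ g' y)
    (hsymm : ∀ a b, g (ψ y) a b = g (ψ y) b a)
    (hg' : ∀ᶠ z in 𝓝 y, ∀ a b, g' z a b = g (ψ z) (fderiv ℝ ψ z a) (fderiv ℝ ψ z b))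
    (a b w : E) :
    eulerLagrange g' y a b w = eulerLagrange g (ψ y) (fderiv ℝ ψ y a)
      (fderiv ℝ (fderiv ℝ ψ) y a a + fderiv ℝ ψ y b) (fderiv ℝ ψ y w) := by
  have hD : HasFDerivAt (fderiv ℝ ψ) (fderiv ℝ (fderiv ℝ ψ) y) y :=
    ((hψ.fderiv_right (m := 1) (by norm_num)).differentiableAt (by simp)).hasFDerivAt
  have hψ1 : HasFDerivAt ψ (fderiv ℝ ψ y) y := (hψ.differentiableAt (by simp)).hasFDerivAt
  have hsec : ∀ a b, fderiv ℝ (fderiv ℝ ψ) y a b = fderiv ℝ (fderiv ℝ ψ) y b a := fun a b =>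
    (hψ.isSymmSndFDerivAt (by simp)).eq a b
  have h1 : ∀ a b, HasFDerivAt (fun z => g' z a b) (fderiv ℝ (fun z => g' z a b) y) y ∧
      ∀ c, fderiv ℝ (fun z => g' z a b) y c =
        fderiv ℝ g (ψ y) (fderiv ℝ ψ y c) (fderiv ℝ ψ y a) (fderiv ℝ ψ y b) +
          g (ψ y) (fderiv ℝ (fderiv ℝ ψ) y c a) (fderiv ℝ ψ y b) +
          g (ψ y) (fderiv ℝ ψ y a) (fderiv ℝ (fderiv ℝ ψ) y c b) := by
    intro a b
    have hgψ : HasFDerivAt (fun z => g (ψ z)) ((fderiv ℝ g (ψ y)).comp (fderiv ℝ ψ y)) y :=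
      HasFDerivAt.comp (g := g) (f := ψ) y hg.hasFDerivAt hψ1
    have ha : ∀ a : E, HasFDerivAt (fun z => fderiv ℝ ψ z a)
        ((fderiv ℝ (fderiv ℝ ψ) y).flip a) y := fun a => by
      simpa using hD.clm_apply (hasFDerivAt_const a y)
    have hga : HasFDerivAt (fun z => g (ψ z) (fderiv ℝ ψ z a)) _ y := hgψ.clm_apply (ha a)
    have h2 := hga.clm_apply (ha b)
    have h3 := h2.congr_of_eventuallyEq (f₁ := fun z => g' z a b)
      (by filter_upwards [hg'] with z hz using hz a b)
    refine ⟨h3.differentiableAt.hasFDerivAt, fun c => ?_⟩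
    rw [h3.fderiv]
    simp
    ring
  have h2 : ∀ a b c, fderiv ℝ g' y c a b = fderiv ℝ (fun z => g' z a b) y c := by
    intro a b c
    have h3 := (hdiff.hasFDerivAt.clm_apply (hasFDerivAt_const a y)).clm_apply
      (hasFDerivAt_const b y)
    rw [h3.fderiv]
    simp
  simp only [eulerLagrange, h2, (h1 _ _).2, hg'.self_of_nhds, map_add, add_apply]
  rw [hsec w a, hsymm (fderiv ℝ (fderiv ℝ ψ) y a w)]
  ring

theorem deriv_deriv_comp {ψ : E → E} {u : ℝ → E} {t : ℝ} (hψ : ContDiffAt ℝ 2 ψ (u t))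
    (hu : ContDiffAt ℝ 2 u t) :
    deriv (ψ ∘ u) t = fderiv ℝ ψ (u t) (deriv u t) ∧
    deriv (deriv (ψ ∘ u)) t = fderiv ℝ (fderiv ℝ ψ) (u t) (deriv u t) (deriv u t) +
      fderiv ℝ ψ (u t) (deriv (deriv u) t) := by
  have h1 : ∀ᶠ s in 𝓝 t, deriv (ψ ∘ u) s = fderiv ℝ ψ (u s) (deriv u s) := by
    filter_upwards [hu.eventually (by simp), hu.continuousAt.eventually (hψ.eventually (by simp))]
      with s hs hs'
    exact fderiv_comp_deriv s (hs'.differentiableAt (by simp)) (hs.differentiableAt (by simp))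
  refine ⟨h1.self_of_nhds, ?_⟩
  rw [EventuallyEq.deriv_eq h1]
  have h2 : DifferentiableAt ℝ (fderiv ℝ ψ) (u t) :=
    (hψ.fderiv_right (m := 1) (by norm_num)).differentiableAt (by simp)
  have h3 : DifferentiableAt ℝ (deriv u) t := by
    have h4 : ContDiffAt ℝ 1 (fun s => fderiv ℝ u s 1) t :=
      (hu.fderiv_right (m := 1) (by norm_num)).clm_apply contDiffAt_const
    exact h4.differentiableAt (by simp)
  have h4 := (h2.hasFDerivAt.comp_hasDerivAt t (hu.differentiableAt (by simp)).hasDerivAt).clm_apply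
    h3.hasDerivAt
  exact h4.deriv

/-- Passing to `(u, deriv u)` turns the equation into a first order system with vector field `X`,
Lipschitz near the initial state. -/
theorem second_order_unique {f : E × E → E} {u₁ u₂ : ℝ → E} {t : ℝ}
    (hf : ContDiffAt ℝ 1 f (u₁ t, deriv u₁ t)) (h₁ : ContDiffAt ℝ 2 u₁ t)
    (h₂ : ContDiffAt ℝ 2 u₂ t)
    (e₁ : ∀ᶠ s in 𝓝 t, deriv (deriv u₁) s = f (u₁ s, deriv u₁ s))
    (e₂ : ∀ᶠ s in 𝓝 t, deriv (deriv u₂) s = f (u₂ s, deriv u₂ s))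
    (h0 : u₁ t = u₂ t) (h0' : deriv u₁ t = deriv u₂ t) : u₁ =ᶠ[𝓝 t] u₂ := by
  obtain ⟨K, s, hs, hK⟩ := hf.exists_lipschitzOnWith
  have hd : ∀ u : ℝ → E, ContDiffAt ℝ 2 u t → ContDiffAt ℝ 1 (deriv u) t := fun u hu =>
    (hu.fderiv_right (m := 1) (by norm_num)).clm_apply contDiffAt_const
  let X : E × E → E × E := fun z => (z.2, f z)
  have hX : LipschitzOnWith (max 1 K) X s :=
    (LipschitzWith.prod_snd.lipschitzOnWith (s := s)).prodMk hK
  have key : ∀ u : ℝ → E, ContDiffAt ℝ 2 u t → (∀ᶠ s in 𝓝 t, deriv (deriv u) s = f (u s, deriv u s))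
      → (u t, deriv u t) = (u₁ t, deriv u₁ t) →
      ∀ᶠ r in 𝓝 t, HasDerivAt (fun r => (u r, deriv u r)) (X (u r, deriv u r)) r ∧
        (u r, deriv u r) ∈ s := by
    intro u hu he h
    have hc : ContinuousAt (fun r => (u r, deriv u r)) t :=
      hu.continuousAt.prodMk (hd u hu).continuousAt
    have hm : s ∈ 𝓝 (u t, deriv u t) := by rw [h]; exact hs
    filter_upwards [hu.eventually (by simp), (hd u hu).eventually (by simp), he, hc hm]
      with r h1 h2 h3 h4
    refine ⟨?_, h4⟩
    have h5 := (h2.differentiableAt (by simp)).hasDerivAt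
    rw [h3] at h5
    exact (h1.differentiableAt (by simp)).hasDerivAt.prodMk h5
  have h := ODE_solution_unique_of_eventually (v := fun _ => X) (s := fun _ => s)
    (Eventually.of_forall fun _ => hX) (key u₁ h₁ e₁ rfl) (key u₂ h₂ e₂ (by rw [h0, h0']))
    (by rw [h0, h0'])
  filter_upwards [h] with r hr
  exact congrArg Prod.fst hr

end Spray

/-! ### Metrics and geodesics in charts. -/

section Coordinates

variable {E : Type*} [NormedAddCommGroup E] [NormedSpace ℝ E] [FiniteDimensional ℝ E]
  {P : Type*} [TopologicalSpace P] [ChartedSpace E P] [IsManifold 𝓘(ℝ, E) ∞ P]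
  {e e' : OpenPartialHomeomorph P E}

theorem tangentMap_symm_tangentMap (he : e ∈ IsManifold.maximalAtlas 𝓘(ℝ, E) ∞ P)
    {p : P} (hp : p ∈ e.source) (v : TangentSpace 𝓘(ℝ, E) p) :
    tangentMap 𝓘(ℝ, E) 𝓘(ℝ, E) e.symm (tangentMap 𝓘(ℝ, E) 𝓘(ℝ, E) e ⟨p, v⟩) = ⟨p, v⟩ := by
  have h2 := (contMDiffAt_symm_of_mem_maximalAtlas he (e.map_source hp)).mdifferentiableAt
    (by simp)
  have h3 := (contMDiffAt_of_mem_maximalAtlas he hp).mdifferentiableAt (by simp)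
  rw [← tangentMap_comp_at (⟨p, v⟩ : TangentBundle 𝓘(ℝ, E) P) h2 h3]
  have h1 : e.symm ∘ e =ᶠ[𝓝 p] id := e.eventually_left_inverse hp
  have h4 : mfderiv 𝓘(ℝ, E) 𝓘(ℝ, E) (e.symm ∘ e) p = mfderiv 𝓘(ℝ, E) 𝓘(ℝ, E) (id : P → P) p :=
    h1.mfderiv_eq
  have key : ∀ q, q = p → ∀ w : E, w = v →
      (⟨q, w⟩ : TangentBundle 𝓘(ℝ, E) P) = ⟨p, v⟩ := by
    rintro _ rfl _ rfl; rfl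
  refine key _ h1.self_of_nhds _ ?_
  have h5 := congrArg (fun T : E →L[ℝ] E => T v) h4
  refine h5.trans ?_
  exact congrArg (fun T : E →L[ℝ] E => T v) (mfderiv_id (I := 𝓘(ℝ, E)) (x := p))

theorem mfderiv_symm_comp_mfderiv (he : e ∈ IsManifold.maximalAtlas 𝓘(ℝ, E) ∞ P)
    {p : P} (hp : p ∈ e.source) (v : E) :
    (mfderiv 𝓘(ℝ, E) 𝓘(ℝ, E) e.symm (e p) (mfderiv 𝓘(ℝ, E) 𝓘(ℝ, E) e p v) : E) = v := by
  have h2 := (contMDiffAt_symm_of_mem_maximalAtlas he (e.map_source hp)).mdifferentiableAt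
    (by simp)
  have h3 := (contMDiffAt_of_mem_maximalAtlas he hp).mdifferentiableAt (by simp)
  have h1 : e.symm ∘ e =ᶠ[𝓝 p] id := e.eventually_left_inverse hp
  have h4 : mfderiv 𝓘(ℝ, E) 𝓘(ℝ, E) (e.symm ∘ e) p = mfderiv 𝓘(ℝ, E) 𝓘(ℝ, E) (id : P → P) p :=
    h1.mfderiv_eq
  have h6 := congrArg (fun T : E →L[ℝ] E => T v) (mfderiv_comp p h2 h3)
  have h5 := congrArg (fun T : E →L[ℝ] E => T v) h4
  exact h6.symm.trans (h5.trans (congrArg (fun T : E →L[ℝ] E => T v)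
    (mfderiv_id (I := 𝓘(ℝ, E)) (x := p))))

theorem mfderiv_comp_mfderiv_symm (he : e ∈ IsManifold.maximalAtlas 𝓘(ℝ, E) ∞ P)
    {x : E} (hx : x ∈ e.target) (v : E) :
    (mfderiv 𝓘(ℝ, E) 𝓘(ℝ, E) e (e.symm x) (mfderiv 𝓘(ℝ, E) 𝓘(ℝ, E) e.symm x v) : E) = v := by
  have h2 := (contMDiffAt_symm_of_mem_maximalAtlas he hx).mdifferentiableAt
    (by simp)
  have h3 := (contMDiffAt_of_mem_maximalAtlas he (e.map_target hx)).mdifferentiableAt (by simp)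
  have h1 : e ∘ e.symm =ᶠ[𝓝 x] id := e.eventually_right_inverse hx
  have h4 : mfderiv 𝓘(ℝ, E) 𝓘(ℝ, E) (e ∘ e.symm) x = mfderiv 𝓘(ℝ, E) 𝓘(ℝ, E) (id : E → E) x :=
    h1.mfderiv_eq
  have h6 := congrArg (fun T : E →L[ℝ] E => T v) (mfderiv_comp x h3 h2)
  have h5 := congrArg (fun T : E →L[ℝ] E => T v) h4
  exact h6.symm.trans (h5.trans (congrArg (fun T : E →L[ℝ] E => T v)
    (mfderiv_id (I := 𝓘(ℝ, E)) (x := x))))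

variable (γ : RiemMetric E P)

/-- The metric in the chart `e`, as a field of bilinear forms. -/
def coordForm (e : OpenPartialHomeomorph P E) (x : E) : E →L[ℝ] E →L[ℝ] ℝ :=
  let B : E →L[ℝ] E →L[ℝ] ℝ := γ.inner (e.symm x)
  let T : E →L[ℝ] E := mfderiv 𝓘(ℝ, E) 𝓘(ℝ, E) e.symm x
  pullbackForm B T

theorem coordForm_apply (e : OpenPartialHomeomorph P E) (x a b : E) :
    coordForm γ e x a b = γ.coord e x a b := rfl

theorem coordForm_symm (e : OpenPartialHomeomorph P E) (x a b : E) :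
    coordForm γ e x a b = coordForm γ e x b a := by
  rw [coordForm_apply, coordForm_apply]
  exact γ.symm (e.symm x) (mfderiv 𝓘(ℝ, E) 𝓘(ℝ, E) e.symm x a) (mfderiv 𝓘(ℝ, E) 𝓘(ℝ, E) e.symm x b)

theorem coordForm_pos (he : e ∈ IsManifold.maximalAtlas 𝓘(ℝ, E) ∞ P) {x : E} (hx : x ∈ e.target)
    (v : E) (hv : v ≠ 0) : 0 < coordForm γ e x v v := by
  rw [coordForm_apply]
  refine γ.pos (e.symm x) (mfderiv 𝓘(ℝ, E) 𝓘(ℝ, E) e.symm x v) fun h => hv ?_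
  have h1 := mfderiv_comp_mfderiv_symm he hx v
  have h2 : ∀ a : TangentSpace 𝓘(ℝ, E) (e.symm x), a = 0 →
      mfderiv 𝓘(ℝ, E) 𝓘(ℝ, E) e (e.symm x) a = 0 := by rintro _ rfl; exact map_zero _
  exact h1.symm.trans (h2 _ h)

/-- It suffices to test on constant vectors `a`, `b`. Their images under the tangent map of `e.symm`
vary smoothly, and the metric is a smooth section applied to them. -/
theorem contDiffOn_coordForm (he : e ∈ IsManifold.maximalAtlas 𝓘(ℝ, E) ∞ P) :
    ContDiffOn ℝ ∞ (coordForm γ e) e.target := by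
  refine contDiffOn_clm_apply.2 fun a => contDiffOn_clm_apply.2 fun b => ?_
  intro x hx
  have hnb := e.open_target.mem_nhds hx
  have hT : ∀ a : E, ContMDiffAt 𝓘(ℝ, E) (𝓘(ℝ, E).prod 𝓘(ℝ, E)) ∞ (fun x =>
      Bundle.TotalSpace.mk' E (E := fun p : P => TangentSpace 𝓘(ℝ, E) p) (e.symm x)
        (mfderiv 𝓘(ℝ, E) 𝓘(ℝ, E) e.symm x a)) x := by
    intro a
    have h1 := (contMDiffOn_symm_of_mem_maximalAtlas he).contMDiffOn_tangentMapWithin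
      (m := ∞) (by simp) e.open_target.uniqueMDiffOn
    have h2 : ContMDiffAt 𝓘(ℝ, E) 𝓘(ℝ, E).tangent ∞
        (fun x : E => (⟨x, a⟩ : TangentBundle 𝓘(ℝ, E) E)) x :=
      contMDiffAt_vectorSpace_iff_contDiffAt.2 contDiffAt_const
    have h3 : Bundle.TotalSpace.proj ⁻¹' e.target ∈ 𝓝 (⟨x, a⟩ : TangentBundle 𝓘(ℝ, E) E) :=
      (e.open_target.preimage (FiberBundle.continuous_proj E _)).mem_nhds hx
    have h4 := (h1.contMDiffAt h3).comp x h2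
    refine h4.congr_of_eventuallyEq ?_
    filter_upwards [hnb] with y hy
    simp only [comp_apply, tangentMapWithin]
    rw [mfderivWithin_of_isOpen e.open_target hy]
  have hb := contMDiffAt_symm_of_mem_maximalAtlas he hx
  have hγ := (γ.contMDiff (e.symm x)).comp x hb
  have h := ContMDiffAt.clm_bundle_apply₂ (E₃ := Bundle.Trivial P ℝ) (F₃ := ℝ) (b := e.symm) hγ (hT a) (hT b)
  have h' := (Bundle.contMDiffAt_totalSpace.1 h).2
  exact (contMDiffAt_iff_contDiffAt.1 h').contDiffWithinAt

theorem contDiffAt_coordForm (he : e ∈ IsManifold.maximalAtlas 𝓘(ℝ, E) ∞ P) {x : E}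
    (hx : x ∈ e.target) : ContDiffAt ℝ ∞ (coordForm γ e) x :=
  (contDiffOn_coordForm γ he).contDiffAt (e.open_target.mem_nhds hx)

/-- With the velocity `a` in both slots the first two terms of the Christoffel symbol coincide and
add up to one full derivative. -/
theorem coord_add_christoffel (he : e ∈ IsManifold.maximalAtlas 𝓘(ℝ, E) ∞ P) {x : E}
    (hx : x ∈ e.target) (a b w : E) :
    γ.coord e x b w + γ.christoffel e x a a w = eulerLagrange (coordForm γ e) x a b w := by
  have hdiff := (contDiffAt_coordForm γ he hx).differentiableAt (by simp)
  have h2 : ∀ a b c, fderiv ℝ (fun z => γ.coord e z a b) x c = fderiv ℝ (coordForm γ e) x c a b := by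
    intro a b c
    have h3 := (hdiff.hasFDerivAt.clm_apply (hasFDerivAt_const a x)).clm_apply
      (hasFDerivAt_const b x)
    have h4 := h3.fderiv
    change fderiv ℝ (fun z => coordForm γ e z a b) x c = _
    rw [h4]
    simp
  rw [RiemMetric.christoffel, h2, h2, eulerLagrange, coordForm_apply]
  ring

theorem inner_congr {q q' : P} (h : q = q') {a a' b b' : E} (ha : a = a') (hb : b = b') :
    γ.inner q a b = γ.inner q' a' b' := by
  subst h ha hb; rfl

theorem contDiffAt_transition (he : e ∈ IsManifold.maximalAtlas 𝓘(ℝ, E) ∞ P)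
    (he' : e' ∈ IsManifold.maximalAtlas 𝓘(ℝ, E) ∞ P) {y : E} (hy : y ∈ e'.target)
    (hy' : e'.symm y ∈ e.source) : ContDiffAt ℝ ∞ (e ∘ e'.symm) y :=
  contMDiffAt_iff_contDiffAt.1 <| (contMDiffAt_of_mem_maximalAtlas he hy').comp y
    (contMDiffAt_symm_of_mem_maximalAtlas he' hy)

theorem coordForm_transition (he : e ∈ IsManifold.maximalAtlas 𝓘(ℝ, E) ∞ P)
    (he' : e' ∈ IsManifold.maximalAtlas 𝓘(ℝ, E) ∞ P) {y : E} (hy : y ∈ e'.target)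
    (hy' : e'.symm y ∈ e.source) (a b : E) :
    coordForm γ e' y a b = coordForm γ e ((e ∘ e'.symm) y) (fderiv ℝ (e ∘ e'.symm) y a)
      (fderiv ℝ (e ∘ e'.symm) y b) := by
  have h1 : e.symm ∘ (e ∘ e'.symm) =ᶠ[𝓝 y] e'.symm := by
    filter_upwards [(e'.continuousAt_symm hy).preimage_mem_nhds (e.open_source.mem_nhds hy')]
      with z hz
    exact e.left_inv hz
  have h2 := (contDiffAt_transition he he' hy hy').contMDiffAt.mdifferentiableAt (by simp)
  have h3 := (contMDiffAt_symm_of_mem_maximalAtlas he (x := (e ∘ e'.symm) y)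
    (e.map_source hy')).mdifferentiableAt (by simp)
  have h4 : ∀ a : E, (mfderiv 𝓘(ℝ, E) 𝓘(ℝ, E) e'.symm y a : E) =
      mfderiv 𝓘(ℝ, E) 𝓘(ℝ, E) e.symm ((e ∘ e'.symm) y) (fderiv ℝ (e ∘ e'.symm) y a) := by
    intro a
    have h5 := congrArg (fun T : E →L[ℝ] E => T a) (mfderiv_comp y h3 h2)
    rw [mfderiv_eq_fderiv] at h5
    have h6 := congrArg (fun T : E →L[ℝ] E => T a) (h1.mfderiv_eq (I := 𝓘(ℝ, E)) (I' := 𝓘(ℝ, E)))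
    exact h6.symm.trans h5
  exact inner_congr γ h1.self_of_nhds.symm (h4 a) (h4 b)

end Coordinates

theorem eq_of_frequently_eq {S X : Type*} [TopologicalSpace S] [TopologicalSpace X] [T2Space X]
    {f g : S → X} {s : S} (hf : ContinuousAt f s) (hg : ContinuousAt g s)
    (hfg : ∃ᶠ r in 𝓝 s, f r = g r) : f s = g s := by
  by_contra hne
  obtain ⟨U, V, hU, hV, hfU, hgV, hUV⟩ := t2_separation hne
  have h5 := (hf.eventually (hU.mem_nhds hfU)).and (hg.eventually (hV.mem_nhds hgV))
  obtain ⟨r, hr, hr₁, hr₂⟩ := (hfg.and_eventually h5).exists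
  exact disjoint_left.1 hUV hr₁ (by rwa [hr])

section Geodesics

variable {E : Type*} [NormedAddCommGroup E] [NormedSpace ℝ E] [FiniteDimensional ℝ E]
  {P : Type*} [TopologicalSpace P] [ChartedSpace E P] [IsManifold 𝓘(ℝ, E) ∞ P]
  {e e' : OpenPartialHomeomorph P E} (γ : RiemMetric E P) {c c₁ c₂ : ℝ → P} {t : ℝ}

theorem contDiffAt_chart_comp (he : e ∈ IsManifold.maximalAtlas 𝓘(ℝ, E) ∞ P)
    (hc : ContMDiffAt 𝓘(ℝ, ℝ) 𝓘(ℝ, E) 2 c t) (ht : c t ∈ e.source) : ContDiffAt ℝ 2 (e ∘ c) t :=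
  contMDiffAt_iff_contDiffAt.1 <|
    ((contMDiffAt_of_mem_maximalAtlas he ht).of_le ENat.LEInfty.out).comp t hc

theorem contDiffAt_deriv {u : ℝ → E} (hu : ContDiffAt ℝ 2 u t) : ContDiffAt ℝ 1 (deriv u) t :=
  (hu.fderiv_right (m := 1) (by norm_num)).clm_apply contDiffAt_const

/-- The geodesic equation in one chart thus implies it in every other: the acceleration acquires the
second derivative term that `eulerLagrange_comp` accounts for. -/
theorem eulerLagrange_transition (he : e ∈ IsManifold.maximalAtlas 𝓘(ℝ, E) ∞ P)
    (he' : e' ∈ IsManifold.maximalAtlas 𝓘(ℝ, E) ∞ P)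
    (hc : ContMDiffAt 𝓘(ℝ, ℝ) 𝓘(ℝ, E) 2 c t) (ht : c t ∈ e.source) (ht' : c t ∈ e'.source) (w : E) :
    eulerLagrange (coordForm γ e') (e' (c t)) (deriv (e' ∘ c) t) (deriv (deriv (e' ∘ c)) t) w =
      eulerLagrange (coordForm γ e) (e (c t)) (deriv (e ∘ c) t) (deriv (deriv (e ∘ c)) t)
        (fderiv ℝ (e ∘ e'.symm) (e' (c t)) w) := by
  have hy := e'.map_source ht'
  have hs : e'.symm (e' (c t)) = c t := e'.left_inv ht'
  have hy' : e'.symm (e' (c t)) ∈ e.source := by rwa [hs]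
  have hψ : ContDiffAt ℝ 2 (e ∘ e'.symm) (e' (c t)) :=
    (contDiffAt_transition he he' hy hy').of_le ENat.LEInfty.out
  have hψy : (e ∘ e'.symm) (e' (c t)) = e (c t) := congrArg e hs
  have hg : DifferentiableAt ℝ (coordForm γ e) ((e ∘ e'.symm) (e' (c t))) := by
    rw [hψy]
    exact (contDiffAt_coordForm γ he (e.map_source ht)).differentiableAt (by simp)
  rw [eulerLagrange_comp hψ hg ((contDiffAt_coordForm γ he' hy).differentiableAt (by simp))
    (coordForm_symm γ e _) ?_, hψy]
  · have h1 := deriv_deriv_comp (ψ := e ∘ e'.symm) (u := e' ∘ c) hψ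
      (contDiffAt_chart_comp he' hc ht')
    have h2 : (e ∘ e'.symm) ∘ e' ∘ c =ᶠ[𝓝 t] e ∘ c := by
      filter_upwards [hc.continuousAt.preimage_mem_nhds (e'.open_source.mem_nhds ht')] with s hs
      exact congrArg e (e'.left_inv hs)
    rw [h2.deriv_eq, h2.deriv.deriv_eq] at h1
    rw [h1.1, h1.2]
    rfl
  · filter_upwards [e'.open_target.mem_nhds hy,
      (e'.continuousAt_symm hy).preimage_mem_nhds (e.open_source.mem_nhds hy')] with z hz hz' a b
    exact coordForm_transition γ he he' hz hz' a b

variable {γ}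

theorem IsGeodesicOn.deriv_deriv {J : Set ℝ} (h : γ.IsGeodesicOn c J)
    (he : e ∈ IsManifold.maximalAtlas 𝓘(ℝ, E) ∞ P) (ht : t ∈ J) (hct : c t ∈ e.source) :
    deriv (deriv (e ∘ c)) t = spray (coordForm γ e) ((e ∘ c) t, deriv (e ∘ c) t) := by
  refine (eulerLagrange_eq_zero_iff (coordForm_pos γ he (e.map_source hct)) _ _).1 fun w => ?_
  rw [← coord_add_christoffel γ he (e.map_source hct)]
  exact h.2 e he t ht hct w

variable (γ) in
theorem contDiffAt_spray_coordForm (he : e ∈ IsManifold.maximalAtlas 𝓘(ℝ, E) ∞ P) {z : E × E}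
    (hz : z.1 ∈ e.target) : ContDiffAt ℝ ∞ (spray (coordForm γ e)) z :=
  contDiffAt_spray (contDiffAt_coordForm γ he hz) (coordForm_pos γ he hz)

theorem IsGeodesicOn.eventuallyEq {J : Set ℝ} (hJ : IsOpen J) (h₁ : γ.IsGeodesicOn c₁ J)
    (h₂ : γ.IsGeodesicOn c₂ J) (he : e ∈ IsManifold.maximalAtlas 𝓘(ℝ, E) ∞ P) (ht : t ∈ J)
    (hct : c₁ t ∈ e.source) (h0 : c₁ t = c₂ t) (h0' : deriv (e ∘ c₁) t = deriv (e ∘ c₂) t) :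
    c₁ =ᶠ[𝓝 t] c₂ := by
  have hJt := hJ.mem_nhds ht
  have hct₂ : c₂ t ∈ e.source := h0 ▸ hct
  have hev : ∀ c : ℝ → P, γ.IsGeodesicOn c J → c t ∈ e.source →
      ContMDiffAt 𝓘(ℝ, ℝ) 𝓘(ℝ, E) 2 c t ∧ (∀ᶠ s in 𝓝 t, c s ∈ e.source) ∧ ∀ᶠ s in 𝓝 t,
        deriv (deriv (e ∘ c)) s = spray (coordForm γ e) ((e ∘ c) s, deriv (e ∘ c) s) := by
    intro c hc hct
    have h1 := hc.1.contMDiffAt hJt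
    have h2 : ∀ᶠ s in 𝓝 t, c s ∈ e.source := h1.continuousAt (e.open_source.mem_nhds hct)
    refine ⟨h1, h2, ?_⟩
    filter_upwards [h2, hJt] with s hs hsJ
    exact IsGeodesicOn.deriv_deriv hc he hsJ hs
  obtain ⟨a₁, b₁, d₁⟩ := hev c₁ h₁ hct
  obtain ⟨a₂, b₂, d₂⟩ := hev c₂ h₂ hct₂
  have h := second_order_unique (u₁ := e ∘ c₁) (u₂ := e ∘ c₂)
    ((contDiffAt_spray_coordForm γ he (z := ((e ∘ c₁) t, deriv (e ∘ c₁) t))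
      (e.map_source hct)).of_le (by exact_mod_cast le_top))
    (contDiffAt_chart_comp he a₁ hct) (contDiffAt_chart_comp he a₂ hct₂) d₁ d₂ (congrArg e h0) h0'
  filter_upwards [h, b₁, b₂] with s hs hs₁ hs₂
  exact e.injOn hs₁ hs₂ hs

theorem chartAt_mem_maximalAtlas (p : P) :
    chartAt E p ∈ IsManifold.maximalAtlas 𝓘(ℝ, E) ∞ P :=
  IsManifold.subset_maximalAtlas (chart_mem_atlas E p)

/-- Geodesics are determined by their initial velocity. -/
theorem IsGeodesicOn.eqOn [T2Space P] {J : Set ℝ} (hJ : IsOpen J) (hJ' : IsPreconnected J)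
    (h₁ : γ.IsGeodesicOn c₁ J) (h₂ : γ.IsGeodesicOn c₂ J) (ht : t ∈ J)
    (h : tangentMap 𝓘(ℝ, ℝ) 𝓘(ℝ, E) c₁ ⟨t, (1 : ℝ)⟩ = tangentMap 𝓘(ℝ, ℝ) 𝓘(ℝ, E) c₂ ⟨t, (1 : ℝ)⟩) :
    EqOn c₁ c₂ J := by
  -- The times at which the germs agree form an open set. It is closed in `J` because positions and
  -- velocities agree in the limit and local uniqueness applies again, so connectedness gives all of
  -- `J`.
  have hsub : J ⊆ {s | c₁ =ᶠ[𝓝 s] c₂} := by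
    refine hJ'.subset_of_closure_inter_subset isOpen_setOfPred_eventually_nhds ⟨t, ht, ?_⟩ ?_
    · have h0 : c₁ t = c₂ t := congrArg Bundle.TotalSpace.proj h
      let e := chartAt E (c₁ t)
      have he : e ∈ IsManifold.maximalAtlas 𝓘(ℝ, E) ∞ P := chartAt_mem_maximalAtlas _
      have hct : c₁ t ∈ e.source := mem_chart_source E _
      refine IsGeodesicOn.eventuallyEq hJ h₁ h₂ he ht hct h0 ?_
      have key : ∀ c : ℝ → P, γ.IsGeodesicOn c J → c t ∈ e.source →
          (tangentMap 𝓘(ℝ, E) 𝓘(ℝ, E) e (tangentMap 𝓘(ℝ, ℝ) 𝓘(ℝ, E) c ⟨t, (1 : ℝ)⟩)).2 =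
            deriv (e ∘ c) t := by
        intro c hc hct
        have h2 := (hc.1.contMDiffAt (hJ.mem_nhds ht)).mdifferentiableAt (by simp)
        have h3 := (contMDiffAt_of_mem_maximalAtlas he hct).mdifferentiableAt (by simp)
        rw [← tangentMap_comp_at (⟨t, (1 : ℝ)⟩ : TangentBundle 𝓘(ℝ, ℝ) ℝ) h3 h2]
        exact congrArg (fun T : ℝ →L[ℝ] E => T 1) mfderiv_eq_fderiv
      have hk₁ := key c₁ h₁ hct
      have hk₂ := key c₂ h₂ (h0 ▸ hct)
      have h4 : ∀ z z' : TangentBundle 𝓘(ℝ, E) P, z = z' →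
          ((tangentMap 𝓘(ℝ, E) 𝓘(ℝ, E) e z).2 : E) = (tangentMap 𝓘(ℝ, E) 𝓘(ℝ, E) e z').2 := by
        rintro _ _ rfl; rfl
      exact hk₁.symm.trans ((h4 _ _ h).trans hk₂)
    · rintro s ⟨hs, hsJ⟩
      have hfr : ∃ᶠ r in 𝓝 s, c₁ =ᶠ[𝓝 r] c₂ := mem_closure_iff_frequently.1 hs
      have hd₁ := h₁.1.contMDiffAt (hJ.mem_nhds hsJ)
      have hd₂ := h₂.1.contMDiffAt (hJ.mem_nhds hsJ)
      have h0 : c₁ s = c₂ s := eq_of_frequently_eq hd₁.continuousAt hd₂.continuousAt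
        (hfr.mono fun r hr => hr.self_of_nhds)
      let e := chartAt E (c₁ s)
      have he : e ∈ IsManifold.maximalAtlas 𝓘(ℝ, E) ∞ P := chartAt_mem_maximalAtlas _
      have hct : c₁ s ∈ e.source := mem_chart_source E _
      refine IsGeodesicOn.eventuallyEq hJ h₁ h₂ he hsJ hct h0 ?_
      refine eq_of_frequently_eq (contDiffAt_deriv (contDiffAt_chart_comp he hd₁ hct)).continuousAt
        (contDiffAt_deriv (contDiffAt_chart_comp he hd₂ (h0 ▸ hct))).continuousAt
        (hfr.mono fun r hr => ?_)
      exact (hr.fun_comp e).deriv_eq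
  exact fun s hs => (hsub hs).self_of_nhds

theorem IsGeodesicOn.mono {J J' : Set ℝ} (h : γ.IsGeodesicOn c J) (hJ : J' ⊆ J) :
    γ.IsGeodesicOn c J' :=
  ⟨h.1.mono hJ, fun e he t ht => h.2 e he t (hJ ht)⟩

theorem IsExp.unique [T2Space P] {p : P} {v : TangentSpace 𝓘(ℝ, E) p} {q q' : P}
    (h : γ.IsExp p v q) (h' : γ.IsExp p v q') : q = q' := by
  obtain ⟨c, ε, hε, hc, hv, rfl⟩ := h
  obtain ⟨c', ε', hε', hc', hv', rfl⟩ := h'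
  have h0 : 0 < min ε ε' := lt_min hε hε'
  refine IsGeodesicOn.eqOn (J := Ioo (-min ε ε') (1 + min ε ε')) (t := 0) isOpen_Ioo isPreconnected_Ioo
    (IsGeodesicOn.mono hc (Ioo_subset_Ioo (neg_le_neg (min_le_left _ _)) (by gcongr; exact min_le_left _ _)))
    (IsGeodesicOn.mono hc' (Ioo_subset_Ioo (neg_le_neg (min_le_right _ _)) (by gcongr; exact min_le_right _ _)))
    ⟨by linarith, by linarith⟩ (hv.trans hv'.symm) ⟨by linarith, by linarith⟩

theorem tangentBundle_model_congr {x x' a a' : E} (h : x = x') (h' : a = a') :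
    (⟨x, a⟩ : TangentBundle 𝓘(ℝ, E) E) = ⟨x', a'⟩ := by
  subst h h'; rfl

/-- A solution of the geodesic equation in a chart is a geodesic. -/
theorem isGeodesicOn_of_chart (he : e ∈ IsManifold.maximalAtlas 𝓘(ℝ, E) ∞ P) {J : Set ℝ}
    (hJ : IsOpen J) {u w : ℝ → E} (hu : ∀ t ∈ J, u t ∈ e.target ∧ HasDerivAt u (w t) t ∧
      HasDerivAt w (spray (coordForm γ e) (u t, w t)) t) : γ.IsGeodesicOn (e.symm ∘ u) J := by
  -- Regularity is bootstrapped from the equation: `w` has continuous derivative because the spray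
  -- is continuous, and then `u` is of class `C^2`.
  have hw1 : ContDiffOn ℝ 1 w J := by
    have hwc : ContinuousOn w J := fun t ht => (hu t ht).2.2.continuousAt.continuousWithinAt
    have huc : ContinuousOn u J := fun t ht => (hu t ht).2.1.continuousAt.continuousWithinAt
    rw [show (1 : WithTop ℕ∞) = 0 + 1 by simp, contDiffOn_succ_iff_deriv_of_isOpen hJ]
    refine ⟨fun t ht => (hu t ht).2.2.differentiableAt.differentiableWithinAt, by simp, ?_⟩
    refine contDiffOn_zero.2 (ContinuousOn.congr (f := fun t => spray (coordForm γ e) (u t, w t))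
      (fun t ht => ?_) fun t ht => (hu t ht).2.2.deriv)
    exact ContinuousAt.comp_continuousWithinAt (g := spray (coordForm γ e)) (f := fun t => (u t, w t))
      (contDiffAt_spray_coordForm γ he (z := (u t, w t)) (hu t ht).1).continuousAt
      ((huc t ht).prodMk (hwc t ht))
  have hu2 : ContDiffOn ℝ 2 u J := by
    rw [show (2 : WithTop ℕ∞) = 1 + 1 by norm_num, contDiffOn_succ_iff_deriv_of_isOpen hJ]
    exact ⟨fun t ht => (hu t ht).2.1.differentiableAt.differentiableWithinAt, by simp,
      hw1.congr fun t ht => (hu t ht).2.1.deriv⟩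
  have hc : ContMDiffOn 𝓘(ℝ, ℝ) 𝓘(ℝ, E) 2 (e.symm ∘ u) J := by
    intro t ht
    refine ContMDiffAt.contMDiffWithinAt (ContMDiffAt.comp t
      ((contMDiffAt_symm_of_mem_maximalAtlas he (hu t ht).1).of_le ENat.LEInfty.out) ?_)
    exact (hu2.contDiffAt (hJ.mem_nhds ht)).contMDiffAt
  refine ⟨hc, fun e' he' t ht ht' w' => ?_⟩
  have hs : (e.symm ∘ u) t ∈ e.source := e.map_target (hu t ht).1
  rw [coord_add_christoffel γ he' (e'.map_source ht'),
    eulerLagrange_transition γ he he' (hc.contMDiffAt (hJ.mem_nhds ht)) hs ht']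
  have h1 : e ∘ e.symm ∘ u =ᶠ[𝓝 t] u := by
    filter_upwards [hJ.mem_nhds ht] with s hs
    exact e.right_inv (hu s hs).1
  have h2 : deriv u =ᶠ[𝓝 t] w := by
    filter_upwards [hJ.mem_nhds ht] with s hs
    exact (hu s hs).2.1.deriv
  rw [h1.deriv.deriv_eq, h2.deriv_eq, h1.deriv_eq, h2.self_of_nhds, (hu t ht).2.2.deriv]
  have h3 : e ((e.symm ∘ u) t) = u t := h1.self_of_nhds
  rw [h3]
  exact (eulerLagrange_eq_zero_iff (coordForm_pos γ he (hu t ht).1) _ _).2 rfl _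

end Geodesics

/-! ### The exponential map and normal slices. -/

section Exponential

variable {E : Type*} [NormedAddCommGroup E] [NormedSpace ℝ E] [FiniteDimensional ℝ E]
  {P : Type*} [TopologicalSpace P] [ChartedSpace E P] [IsManifold 𝓘(ℝ, E) ∞ P]

/-- Near the origin the exponential map is defined and smooth, and its derivative at the origin is
the identity. -/
theorem exists_exp (γ : RiemMetric E P) (p : P) : ∃ h : E → P, h 0 = p ∧
    (∀ w : E, (mfderiv 𝓘(ℝ, E) 𝓘(ℝ, E) h 0 w : E) = w) ∧
    ∀ᶠ v in 𝓝 (0 : E), ContMDiffAt 𝓘(ℝ, E) 𝓘(ℝ, E) ∞ h v ∧ γ.IsExp p v (h v) := by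
  let e := chartAt E p
  have he : e ∈ IsManifold.maximalAtlas 𝓘(ℝ, E) ∞ P := chartAt_mem_maximalAtlas _
  have hp : p ∈ e.source := mem_chart_source E p
  have hpt : e p ∈ e.target := e.map_source hp
  -- `A` turns a tangent vector at `p` into a coordinate velocity; the derivative of `e.symm` undoes
  -- it, which leaves the identity as derivative of the exponential.
  let A : E →L[ℝ] E := mfderiv 𝓘(ℝ, E) 𝓘(ℝ, E) e p
  have hN : {z : E × E | z.1 ∈ e.target} ∈ 𝓝 (e p, (0 : E)) :=
    continuous_fst.continuousAt.preimage_mem_nhds (e.open_target.mem_nhds hpt)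
  obtain ⟨u, w, h0, h1, huw⟩ := exists_second_order_flow (f := spray (coordForm γ e)) (x₀ := e p)
    (by filter_upwards [hN] with z hz using contDiffAt_spray_coordForm γ he hz)
    (spray_zero _ _) (fderiv_spray_zero (contDiffAt_coordForm γ he hpt) (coordForm_pos γ he hpt)) hN
  let k : E → E := fun v => u (A v) 1
  have hk0 : k 0 = e p := by simp only [k, map_zero, h0]
  have hAt : Tendsto A (𝓝 0) (𝓝 0) := A.continuous.tendsto' 0 0 (map_zero A)
  have hk : HasFDerivAt k A 0 := by
    have h1' : HasFDerivAt (fun v => u v 1) (ContinuousLinearMap.id ℝ E) (A 0) := by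
      rw [map_zero]; exact h1
    exact h1'.comp (0 : E) A.hasFDerivAt
  have hes : ∀ x, x ∈ e.target → ContMDiffAt 𝓘(ℝ, E) 𝓘(ℝ, E) ∞ e.symm x := fun x hx =>
    contMDiffAt_symm_of_mem_maximalAtlas he hx
  refine ⟨e.symm ∘ k, ?_, fun v => ?_, ?_⟩
  · rw [comp_apply, hk0, e.left_inv hp]
  · have h2 : MDifferentiableAt 𝓘(ℝ, E) 𝓘(ℝ, E) e.symm (k 0) :=
      (hes _ (by rw [hk0]; exact hpt)).mdifferentiableAt (by simp)
    have h3 := congrArg (fun T : E →L[ℝ] E => T v)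
      (mfderiv_comp (0 : E) h2 hk.differentiableAt.mdifferentiableAt)
    refine h3.trans ?_
    have h4 : ∀ x, x = e p → ∀ T : E →L[ℝ] E, T = A →
        (mfderiv 𝓘(ℝ, E) 𝓘(ℝ, E) e.symm x (T v) : E) = v := by
      rintro _ rfl _ rfl
      exact mfderiv_symm_comp_mfderiv he hp v
    exact h4 _ hk0 _ (mfderiv_eq_fderiv.trans hk.fderiv)
  · filter_upwards [hAt.eventually huw] with v ⟨hv, hv0, hv0', hvt⟩
    -- The flow interval `(-1, 2)` is the interval of `IsExp` with `ε = 1`.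
    have hJ : ∀ t ∈ Ioo (-1 : ℝ) (1 + 1), u (A v) t ∈ e.target ∧ HasDerivAt (u (A v)) (w (A v) t) t ∧
        HasDerivAt (w (A v)) (spray (coordForm γ e) (u (A v) t, w (A v) t)) t := fun t ht =>
      hvt t ⟨ht.1, by linarith [ht.2]⟩
    have hkv : ContDiffAt ℝ ∞ k v :=
      ContDiffAt.comp (g := fun v => u v 1) v hv A.contDiff.contDiffAt
    refine ⟨(hes _ (hJ 1 (by norm_num)).1).comp v hkv.contMDiffAt, e.symm ∘ u (A v), 1, one_pos,
      isGeodesicOn_of_chart he isOpen_Ioo hJ, ?_, rfl⟩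
    have h0t := hJ 0 (by norm_num)
    change tangentMap 𝓘(ℝ, ℝ) 𝓘(ℝ, E) (e.symm ∘ u (A v)) ⟨0, (1 : ℝ)⟩ = _
    rw [tangentMap_comp_at (⟨0, (1 : ℝ)⟩ : TangentBundle 𝓘(ℝ, ℝ) ℝ)
      ((hes _ h0t.1).mdifferentiableAt (by simp)) h0t.2.1.differentiableAt.mdifferentiableAt]
    refine Eq.trans (congrArg _ ?_) (tangentMap_symm_tangentMap he hp v)
    refine tangentBundle_model_congr hv0 ?_
    refine (congrArg (fun T : ℝ →L[ℝ] E => T 1) mfderiv_eq_fderiv).trans ?_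
    exact h0t.2.1.deriv.trans hv0'

end Exponential

section Slices

variable {E : Type*} [NormedAddCommGroup E] [NormedSpace ℝ E] [FiniteDimensional ℝ E]
  {P : Type*} [TopologicalSpace P] [ChartedSpace E P] [IsManifold 𝓘(ℝ, E) ∞ P]
  {F : Type*} [NormedAddCommGroup F] [NormedSpace ℝ F] [FiniteDimensional ℝ F]
  {G : Type*} [TopologicalSpace G] [ChartedSpace F G] [Group G] [LieGroup 𝓘(ℝ, F) ∞ G]
  [MulAction G P] [ContMDiffSMul 𝓘(ℝ, F) 𝓘(ℝ, E) ∞ G P]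

/-- For a positive definite form a vector of `W` orthogonal to `W` is zero, so the orthogonal space
is a complement. -/
theorem exists_isCompl_orthogonal (B : E →L[ℝ] E →L[ℝ] ℝ) (hs : ∀ v w, B v w = B w v)
    (hB : ∀ v, v ≠ 0 → 0 < B v v) (W : Submodule ℝ E) :
    ∃ N : Submodule ℝ E, IsCompl N W ∧ ∀ v, v ∈ N ↔ ∀ w ∈ W, B v w = 0 := by
  let b : LinearMap.BilinForm ℝ E := B.toBilinForm
  have hb : ∀ v w, b v w = B v w := fun _ _ => rfl
  have hr : b.IsRefl := fun v w h => by rw [hb, hs]; exact h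
  refine ⟨b.orthogonal W, ((LinearMap.BilinForm.isCompl_orthogonal_iff_disjoint hr).2 ?_).symm,
    fun v => ?_⟩
  · refine Submodule.disjoint_def.2 fun v hv hv' => ?_
    by_contra h
    exact (hB v h).ne' (hv' v hv)
  · refine forall₂_congr fun w _ => ?_
    change B w v = 0 ↔ _
    rw [hs]

/-- Small normal balls exponentiate to local sections. -/
theorem exists_isLocalSection_expNormalBall [T2Space P] [CompactSpace G]
    (hfree : ∀ (g : G) (p : P), g • p = p → g = 1) {d : ℕ}
    (hd : d + Module.finrank ℝ F = Module.finrank ℝ E) (γ : RiemMetric E P) (p : P) :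
    ∃ δ₀ : ℝ, 0 < δ₀ ∧ ∀ δ : ℝ, 0 < δ → δ ≤ δ₀ →
      (∀ v ∈ RiemMetric.normalBall F G γ p δ, ∃! q : P, γ.IsExp p v q) ∧
      p ∈ RiemMetric.expNormalBall F G γ p δ ∧
      ∃ (θ : TopologicalSpace.Opens (OrbitSpace P G))
        (s : SmoothStructure (RiemMetric.expNormalBall F G γ p δ)),
        IsLocalSection E F G θ (RiemMetric.expNormalBall F G γ p δ) s := by
  obtain ⟨h, hh0, hh', hh⟩ := exists_exp γ p
  let B : E →L[ℝ] E →L[ℝ] ℝ := γ.inner p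
  have hBpos : ∀ v, v ≠ 0 → 0 < B v v := fun v hv => γ.pos p v hv
  obtain ⟨N, hN, hNmem⟩ := exists_isCompl_orthogonal B (fun v w => γ.symm p v w) hBpos
    (orbitTangentModel E F G p)
  have hNd : Module.finrank ℝ N = d := by
    have h1 := Submodule.finrank_add_eq_of_isCompl hN
    rw [finrank_orbitTangentModel hfree] at h1
    omega
  let κ : EuclideanSpace ℝ (Fin d) ≃L[ℝ] N := ContinuousLinearEquiv.ofFinrankEq (by simp [hNd])
  let L : EuclideanSpace ℝ (Fin d) →L[ℝ] E := N.subtypeL.comp κ.toContinuousLinearMap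
  have hLmem : ∀ x, L x ∈ N := fun x => (κ x).2
  have hLsurj : ∀ v ∈ N, ∃ x, L x = v := fun v hv => ⟨κ.symm ⟨v, hv⟩, by simp [L]⟩
  have hLinj : Injective L := Subtype.val_injective.comp κ.injective
  have hLt : Tendsto L (𝓝 0) (𝓝 0) := L.continuous.tendsto' 0 0 (map_zero L)
  let f : EuclideanSpace ℝ (Fin d) → P := fun x => h (L x)
  have hf0 : f 0 = p := by simp only [f, map_zero, hh0]
  have hfs : ∀ᶠ x in 𝓝 (0 : EuclideanSpace ℝ (Fin d)),
      ContMDiffAt 𝓘(ℝ, EuclideanSpace ℝ (Fin d)) 𝓘(ℝ, E) ∞ f x := by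
    filter_upwards [hLt.eventually hh] with x hx
    exact ContMDiffAt.comp (g := h) (f := L) x hx.1 L.contDiff.contDiffAt.contMDiffAt
  have hf' : ∀ x : EuclideanSpace ℝ (Fin d),
      (mfderiv 𝓘(ℝ, EuclideanSpace ℝ (Fin d)) 𝓘(ℝ, E) f 0 x : E) = L x := by
    intro x
    have h1 : MDifferentiableAt 𝓘(ℝ, E) 𝓘(ℝ, E) h (L 0) := by
      rw [map_zero]; exact hh.self_of_nhds.1.mdifferentiableAt (by simp)
    have h2 := congrArg (fun T : EuclideanSpace ℝ (Fin d) →L[ℝ] E => T x) (mfderiv_comp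
      (0 : EuclideanSpace ℝ (Fin d)) h1 L.differentiableAt.mdifferentiableAt)
    refine h2.trans ?_
    have h4 : ∀ y, y = (0 : E) → ∀ T : EuclideanSpace ℝ (Fin d) →L[ℝ] E, T = L →
        (mfderiv 𝓘(ℝ, E) 𝓘(ℝ, E) h y (T x) : E) = L x := by
      rintro _ rfl _ rfl
      exact hh' _
    exact h4 _ (map_zero L) _ (mfderiv_eq_fderiv.trans L.hasFDerivAt.fderiv)
  let T : EuclideanSpace ℝ (Fin d) →L[ℝ] E := mfderiv 𝓘(ℝ, EuclideanSpace ℝ (Fin d)) 𝓘(ℝ, E) f 0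
  have hTL : T = L := ContinuousLinearMap.ext hf'
  have hrange : LinearMap.range T.toLinearMap = N := by
    rw [hTL]
    ext v
    constructor
    · rintro ⟨x, rfl⟩; exact hLmem x
    · intro hv; obtain ⟨x, hx⟩ := hLsurj v hv; exact ⟨x, hx⟩
  have hc : IsCompl (LinearMap.range T.toLinearMap) (orbitTangentModel E F G (f 0)) := by
    rw [hrange, hf0]; exact hN
  obtain ⟨O, hO, hs⟩ := exists_slice (E := E) hfree hfs (fun x y hxy => hLinj
    ((hf' x).symm.trans (Eq.trans hxy (hf' y)))) hc
  obtain ⟨c, hcpos, hcB⟩ := exists_pos_mul_sq_le B hBpos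
  let Good : E → Prop := fun v => γ.IsExp p v (h v)
  have hgood : ∀ᶠ v in 𝓝 (0 : E), Good v := hh.mono fun _ h => h.2
  obtain ⟨r, hr, hball⟩ := Metric.eventually_nhds_iff_ball.1 hgood
  have hκ : ∀ᶠ y in 𝓝 (0 : N), κ.symm y ∈ O :=
    (κ.symm.continuous.tendsto' 0 0 (map_zero _)).eventually (O.isOpen.mem_nhds hO)
  obtain ⟨r', hr', hball'⟩ := Metric.eventually_nhds_iff_ball.1 hκ
  -- Coercivity converts metric length into norm. Radius `r` ensures that the exponential is
  -- defined, radius `r'` that the parameter lies in the slice domain `O`.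
  have hsmall : ∀ δ, δ ≤ Real.sqrt c * min r r' → ∀ v, Real.sqrt (B v v) < δ → ‖v‖ < min r r' := by
    intro δ hδ v hv
    have h1 : Real.sqrt c * ‖v‖ ≤ Real.sqrt (B v v) := by
      rw [← Real.sqrt_sq (norm_nonneg v), ← Real.sqrt_mul hcpos.le]
      exact Real.sqrt_le_sqrt (hcB v)
    exact lt_of_mul_lt_mul_left ((h1.trans_lt hv).trans_le hδ) (Real.sqrt_nonneg c)
  refine ⟨Real.sqrt c * min r r', mul_pos (Real.sqrt_pos.2 hcpos) (lt_min hr hr'),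
    fun δ hδ hδ₀ => ?_⟩
  have hball_iff : ∀ v : E, v ∈ RiemMetric.normalBall F G γ p δ ↔
      v ∈ N ∧ Real.sqrt (B v v) < δ := fun v => by
    rw [hNmem]; rfl
  have hexp : ∀ v : E, Real.sqrt (B v v) < δ → γ.IsExp p v (h v) := fun v hv =>
    hball v (by rw [mem_ball_zero_iff]; exact (hsmall δ hδ₀ v hv).trans_le (min_le_left _ _))
  have hcontB : Continuous fun x => Real.sqrt (B (L x) (L x)) :=
    Real.continuous_sqrt.comp ((B.continuous.comp L.continuous).clm_apply L.continuous)
  let Oδ : TopologicalSpace.Opens (EuclideanSpace ℝ (Fin d)) :=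
    ⟨{x | Real.sqrt (B (L x) (L x)) < δ}, isOpen_lt hcontB continuous_const⟩
  have h0δ : (0 : EuclideanSpace ℝ (Fin d)) ∈ Oδ := by
    change Real.sqrt (B (L 0) (L 0)) < δ
    simpa using hδ
  have hOδ : Oδ ≤ O := by
    intro x hx
    have h1 := hball' (κ x) (by
      rw [mem_ball_zero_iff]; exact (hsmall δ hδ₀ (L x) hx).trans_le (min_le_right _ _))
    simpa using h1
  -- Uniqueness of geodesics makes the relation `IsExp` a function on the ball, so its image is
  -- parametrised by `f`.
  have himage : RiemMetric.expNormalBall F G γ p δ = f '' Oδ := by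
    ext q
    constructor
    · rintro ⟨v, hv, hq⟩
      obtain ⟨hvN, hvδ⟩ := (hball_iff v).1 hv
      obtain ⟨x, rfl⟩ := hLsurj v hvN
      exact ⟨x, hvδ, IsExp.unique (hexp _ hvδ) hq⟩
    · rintro ⟨x, hx, rfl⟩
      exact ⟨L x, (hball_iff _).2 ⟨hLmem x, hx⟩, hexp _ hx⟩
  refine ⟨fun v hv => ⟨h v, hexp v ((hball_iff v).1 hv).2, fun q hq =>
    IsExp.unique hq (hexp v ((hball_iff v).1 hv).2)⟩, ?_, ?_⟩
  · rw [himage]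
    exact ⟨0, h0δ, hf0⟩
  · rw [himage]
    exact (hs.mono hOδ).exists_isLocalSection_image hfree hd ⟨⟨0, h0δ⟩⟩

end Slices

end SliceTheorem

end

end Development

/-! ### Assembly of the theorem. -/

theorem mainTheorem9
    {E : Type*} [NormedAddCommGroup E] [NormedSpace ℝ E] [FiniteDimensional ℝ E]
    {P : Type*} [TopologicalSpace P] [ChartedSpace E P] [IsManifold 𝓘(ℝ, E) ∞ P]
    [T2Space P] [SecondCountableTopology P] [Nonempty P]
    {F : Type*} [NormedAddCommGroup F] [NormedSpace ℝ F] [FiniteDimensional ℝ F]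
    {G : Type*} [TopologicalSpace G] [ChartedSpace F G] [Group G] [LieGroup 𝓘(ℝ, F) ∞ G]
    [T2Space G] [CompactSpace G]
    [MulAction G P] [ContMDiffSMul 𝓘(ℝ, F) 𝓘(ℝ, E) ∞ G P]
    (hfree : ∀ (g : G) (p : P), g • p = p → g = 1) :
    -- there are invariant metrics, and small normal balls exponentiate to local sections
    (∃ γ : RiemMetric E P, RiemMetric.IsInvariant G γ) ∧
    (∀ γ : RiemMetric E P, RiemMetric.IsInvariant G γ → ∀ p : P,
      ∃ δ₀ : ℝ, 0 < δ₀ ∧ ∀ δ : ℝ, 0 < δ → δ ≤ δ₀ →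
        (∀ v ∈ RiemMetric.normalBall F G γ p δ, ∃! q : P, γ.IsExp p v q) ∧
        p ∈ RiemMetric.expNormalBall F G γ p δ ∧
        ∃ (θ : TopologicalSpace.Opens (OrbitSpace P G))
          (s : SmoothStructure (RiemMetric.expNormalBall F G γ p δ)),
          IsLocalSection E F G θ (RiemMetric.expNormalBall F G γ p δ) s) ∧
    -- the smooth structure of the orbit space
    T2Space (OrbitSpace P G) ∧ SecondCountableTopology (OrbitSpace P G) ∧
    (∃! t : SmoothStructure (OrbitSpace P G), IsSubmersionStructure E G t) ∧
    (∃! t : SmoothStructure (OrbitSpace P G), IsSectionStructure E F G t) ∧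
    (∀ t : SmoothStructure (OrbitSpace P G),
      IsSubmersionStructure E G t ↔ IsSectionStructure E F G t) ∧
    -- local triviality
    (∀ t : SmoothStructure (OrbitSpace P G), IsSubmersionStructure E G t →
      (∀ m : OrbitSpace P G, ∃ θ : TopologicalSpace.Opens (OrbitSpace P G), m ∈ θ ∧
        ∃ φ : ProductDiffeo E F G t θ, IsTrivialization F G φ) ∧
      (∀ (θ : TopologicalSpace.Opens (OrbitSpace P G)) (S : Set P) (s : SmoothStructure S),
        IsLocalSection E F G θ S s →
          ∃ φ : ProductDiffeo E F G t θ, IsTrivialization F G φ ∧ IsAdapted F G φ S)) := by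
  obtain ⟨d, hd⟩ := exists_add_finrank_eq E P F G hfree
  have hcs : ContinuousSMul G P :=
    ContMDiffSMul.continuousSMul (I := 𝓘(ℝ, F)) (I' := 𝓘(ℝ, E)) ∞
  obtain ⟨t₀, ht₀⟩ := exists_isSubmersionStructure (F := F) hfree hd
  have hiff : ∀ t : SmoothStructure (OrbitSpace P G),
      IsSubmersionStructure E G t ↔ IsSectionStructure E F G t := isSubmersionStructure_iff hfree
  have huniq : ∀ t : SmoothStructure (OrbitSpace P G), IsSectionStructure E F G t → t = t₀ :=
    fun t ht => IsSectionStructure.unique hfree ht ((hiff t₀).1 ht₀)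
  refine ⟨exists_isInvariant hfree hd,
    fun γ _ p => exists_isLocalSection_expNormalBall hfree hd γ p, t2Space_orbitSpace,
    ContinuousConstSMul.secondCountableTopology, ⟨t₀, ht₀, fun t ht => huniq t ((hiff t).1 ht)⟩,
    ⟨t₀, (hiff t₀).1 ht₀, huniq⟩, hiff, fun t ht => ⟨fun m => ?_, fun θ S s h => ?_⟩⟩
  -- A local section through any point of the orbit `m` provides the trivialization near `m`.
  · obtain ⟨p, rfl⟩ := Quotient.exists_rep m
    obtain ⟨θ, S, s, hp, h⟩ := exists_isLocalSection (E := E) (F := F) hfree p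
    obtain ⟨φ, hφ, -⟩ := h.exists_trivialization hfree ht
    refine ⟨θ, ?_, φ, hφ⟩
    have h1 : orbitProj G p ∈ (θ : Set (OrbitSpace P G)) := h.image_eq ▸ Set.mem_image_of_mem _ hp
    exact h1
  · exact h.exists_trivialization hfree ht
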